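/- **Setting.** Let $U_s$ be a smooth real function on $[-1,1]$ with $U_s(\pm1)=0$, $U_s'(-1)>0$, $U_s'(1)<0$, $U_s''<0$ on $(-1,1)$ and $\max U_s=1$; let $m\in(0,1/\sqrt3)$, $\lambda\ge0$. Write $\mathrm{div}_k(u,v)=iku+\partial_yv$, $\Delta_k=\partial_y^2-k^2$, $A=1-m^2(U_s-c)^2$, and $\Omega(f_u,f_v)=-f_v+\frac1{ik}\partial_y(A^{-1}f_u)$. All derivatives of $\rho,u,v,f_u,f_v$ are weak derivatives on $(-1,1)$, and $\|\cdot\|$ is the norm of $L^2(-1,1)$ (Euclidean for tuples). Consider the remainder system on $(-1,1)$ $$\begin{cases} ik(U_s-c)\rho+\mathrm{div}_k(u,v)=0,\\ -\epsilon\Delta_ku-\lambda ik\epsilon\,\mathrm{div}_k(u,v)+ik(U_s-c)u+(ikm^{-2}+\epsilon U_s'')\rho+vU_s'=f_u,\\ -\epsilon\Delta_kv-\lambda\epsilon\,\partial_y\mathrm{div}_k(u,v)+ik(U_s-c)v+m^{-2}\partial_y\rho=f_v,\\ v|_{y=\pm1}=0.\end{cases}$$ **Statement.** For all constants $0<a<b$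 there are $\epsilon_0>0$ and $C>0$, depending only on $U_s,m,\lambda,a,b$, such that the following holds for all $\epsilon\in(0,\epsilon_0)$, all $k\in[a\epsilon^{1/7},b\epsilon^{1/7}]$ and all $f_u,f_v\in L^2(-1,1)$. Put $R=\{c\in\mathbb C:\ \mathrm{Re}\,c,\ \mathrm{Im}\,c\in(a\epsilon^{2/7},b\epsilon^{2/7})\}$. For every $c\in R$ the system has a solution $(\rho,u,v)=(\rho,u,v)(\cdot\,;c)\in H^1(-1,1)\times(H^2(-1,1))^2$, and these solutions can be chosen such that: 1. for every $c\in R$, $$\epsilon^{5/7}\|(m^{-1}\rho,u,v)\|+\epsilon^{5/7}\|(m^{-2}\partial_y\rho,\partial_yu,\partial_yv)\|+\epsilon^{9/7}\|(\partial_y^2u,\partial_y^2v)\|\le C\|(f_u,f_v)\|;$$ 2. if moreover $f_u,f_v\in H^1(-1,1)$, then for every $c\in R$ the same solution also satisfies $$\epsilon^{2/7}\|(m^{-1}\rho,u,v)\|+\epsilon^{2/7}\|(m^{-2}\partial_y\rho,\partial_yu,\partial_yv)\|+\epsilon^{4/7}\|(\partial_y^2u,\partial_y^2v)\|\le C\|\Omega(f_u,f_v)\|+C\epsilon^{1/7}\|(f_u,f_v)\|+C\epsilon^{2/7}\|\mathrm{div}_k(f_u,f_v)\|;$$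 3. the boundary values $c\mapsto u(1;c)$ and $c\mapsto u(-1;c)$ are analytic on $R$. -/

import Mathlib

open MeasureTheory Set
open scoped ContDiff

noncomputable section

namespace PoiseuilleCNS

/-! ### Sobolev spaces on the interval `(-1,1)` -/

/-- Lebesgue measure on `(-1,1)`. -/
def chan : Measure ℝ := volume.restrict (Ioo (-1) 1)

/-- `f ∈ L²(-1,1)`. -/
def MemL2 (f : ℝ → ℂ) : Prop := MemLp f 2 chan

/-- The norm of `L²(-1,1)`. -/
def l2 (f : ℝ → ℂ) : ℝ := (eLpNorm f 2 chan).toReal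

/-- The `L²(-1,1)` norm of a pair. -/
def l2pair (f g : ℝ → ℂ) : ℝ := Real.sqrt (l2 f ^ 2 + l2 g ^ 2)

/-- The `L²(-1,1)` norm of a triple. -/
def l2triple (f g h : ℝ → ℂ) : ℝ := Real.sqrt (l2 f ^ 2 + l2 g ^ 2 + l2 h ^ 2)

/-- `g` is a weak (distributional) derivative of `f` on `(-1,1)`. -/
def HasWeakDeriv (f g : ℝ → ℂ) : Prop :=
  LocallyIntegrableOn f (Ioo (-1) 1) ∧ LocallyIntegrableOn g (Ioo (-1) 1) ∧
    ∀ φ : ℝ → ℝ, ContDiff ℝ ∞ φ → HasCompactSupport φ → tsupport φ ⊆ Ioo (-1) 1 →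
      ∫ y, deriv φ y • f y ∂chan = -∫ y, φ y • g y ∂chan

/-- Weak derivatives are unique almost everywhere on `(-1,1)`. -/
theorem HasWeakDeriv.ae_unique {f g h : ℝ → ℂ} (hg : HasWeakDeriv f g) (hh : HasWeakDeriv f h) :
    g =ᵐ[chan] h := by
  have key : ∀ᵐ x ∂(volume : Measure ℝ), x ∈ Ioo (-1 : ℝ) 1 → (g - h) x = 0 := by
    refine isOpen_Ioo.ae_eq_zero_of_integral_contDiff_smul_eq_zero (hg.2.1.sub hh.2.1) ?_
    intro φ hφ hc hs
    have hint : ∀ w : ℝ → ℂ, LocallyIntegrableOn w (Ioo (-1) 1) →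
        Integrable (fun y => φ y • w y) volume := by
      intro w hw
      have h1 : IntegrableOn w (tsupport φ) := hw.integrableOn_compact_subset hs hc
      have h2 : IntegrableOn (fun y => φ y • w y) (tsupport φ) :=
        h1.continuousOn_smul hφ.continuous.continuousOn hc
      refine (integrableOn_iff_integrable_of_support_subset ?_).1 h2
      intro y hy
      apply subset_tsupport
      intro h0
      exact hy (by simp [h0])
    have hset : ∀ w : ℝ → ℂ, ∫ y, φ y • w y ∂chan = ∫ y, φ y • w y := by
      intro w
      refine setIntegral_eq_integral_of_forall_compl_eq_zero ?_
      intro y hy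
      have : φ y = 0 := by
        by_contra h0
        exact hy (hs (subset_tsupport _ h0))
      simp [this]
    have e : ∫ y, φ y • g y = ∫ y, φ y • h y := by
      have := (hg.2.2 φ hφ hc hs).symm.trans (hh.2.2 φ hφ hc hs)
      rw [hset, hset] at this
      exact neg_injective this
    have e2 : (fun y => φ y • (g - h) y) = fun y => φ y • g y - φ y • h y := by
      funext y
      simp [smul_sub]
    rw [e2, integral_sub (hint g hg.2.1) (hint h hh.2.1), e, sub_self]
  have := (ae_restrict_iff' measurableSet_Ioo).2 key
  filter_upwards [this] with x hx
  exact sub_eq_zero.1 hx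

open Classical in
/-- `∂_y f` on `(-1,1)` in the weak sense (well defined almost everywhere; `0` if there is no weak
derivative). -/
def weakDeriv (f : ℝ → ℂ) : ℝ → ℂ :=
  if h : ∃ g, HasWeakDeriv f g then h.choose else 0

theorem HasWeakDeriv.weakDeriv_ae_eq {f g : ℝ → ℂ} (hg : HasWeakDeriv f g) :
    weakDeriv f =ᵐ[chan] g := by
  have h : ∃ g, HasWeakDeriv f g := ⟨g, hg⟩
  unfold weakDeriv
  rw [dif_pos h]
  exact h.choose_spec.ae_unique hg

/-- `f ∈ H¹(-1,1)`. -/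
def MemH1 (f : ℝ → ℂ) : Prop := MemL2 f ∧ ∃ g, MemL2 g ∧ HasWeakDeriv f g

/-- `f ∈ H²(-1,1)`. -/
def MemH2 (f : ℝ → ℂ) : Prop := MemL2 f ∧ ∃ g, MemH1 g ∧ HasWeakDeriv f g

/-! ### The background flow and the linear system -/

/-- Poiseuille-type profiles: smooth on `[-1,1]` (given as the restriction of a smooth function on
the line), vanishing at the walls, with `U'(-1) > 0 > U'(1)`, strictly concave in the sense
`U'' < 0` in `(-1,1)`, and normalized to have maximum `1`. -/
structure IsPoiseuilleType (U : ℝ → ℝ) : Prop where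
  smooth : ContDiff ℝ ∞ U
  left : U (-1) = 0
  right : U 1 = 0
  deriv_left : 0 < deriv U (-1)
  deriv_right : deriv U 1 < 0
  concave : ∀ y ∈ Ioo (-1 : ℝ) 1, deriv (deriv U) y < 0
  max_eq_one : IsGreatest (U '' Icc (-1) 1) 1

/-- `div_k(u,v) = i k u + ∂_y v`. -/
def divk (k : ℝ) (u v : ℝ → ℂ) : ℝ → ℂ := fun y => Complex.I * k * u y + weakDeriv v y

/-- `Δ_k f = ∂_y² f - k² f`. -/
def lapk (k : ℝ) (f : ℝ → ℂ) : ℝ → ℂ := fun y => weakDeriv (weakDeriv f) y - (k : ℂ) ^ 2 * f y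

/-- `A(y) = 1 - m² (U(y) - c)²`. -/
def coefA (U : ℝ → ℝ) (m : ℝ) (c : ℂ) : ℝ → ℂ := fun y => 1 - (m : ℂ) ^ 2 * ((U y : ℂ) - c) ^ 2

/-- `Ω(f_u,f_v) = -f_v + (ik)⁻¹ ∂_y (A⁻¹ f_u)`. -/
def Omega (U : ℝ → ℝ) (m k : ℝ) (c : ℂ) (fu fv : ℝ → ℂ) : ℝ → ℂ := fun y =>
  -fv y + (Complex.I * k)⁻¹ * weakDeriv (fun x => (coefA U m c x)⁻¹ * fu x) y

/-- `(ρ,u,v) ∈ H¹ × (H²)²` is a strong solution of the remainder system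
```
  ik(U-c)ρ + div_k(u,v) = 0,
  -ε Δ_k u - λ i k ε div_k(u,v) + ik(U-c)u + (i k m⁻² + ε U'')ρ + v U' = f_u,
  -ε Δ_k v - λ ε ∂_y div_k(u,v) + ik(U-c)v + m⁻² ∂_y ρ = f_v,
  v(±1) = 0.
```
Here `u`, `v` are the representatives that are continuous on `[-1,1]`, so that their traces at the
walls are their values at `±1`. -/
structure IsRemainderSolution (U : ℝ → ℝ) (m lam ε k : ℝ) (c : ℂ) (fu fv : ℝ → ℂ)
    (ρ u v : ℝ → ℂ) : Prop where
  memH1_ρ : MemH1 ρ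
  memH2_u : MemH2 u
  memH2_v : MemH2 v
  cont_u : ContinuousOn u (Icc (-1) 1)
  cont_v : ContinuousOn v (Icc (-1) 1)
  mass : ∀ᵐ y ∂chan, Complex.I * k * ((U y : ℂ) - c) * ρ y + divk k u v y = 0
  momentum_u : ∀ᵐ y ∂chan,
    -(ε : ℂ) * lapk k u y - (lam : ℂ) * Complex.I * k * ε * divk k u v y
      + Complex.I * k * ((U y : ℂ) - c) * u y
      + (Complex.I * k * ((m : ℂ) ^ 2)⁻¹ + (ε : ℂ) * ((deriv (deriv U) y : ℝ) : ℂ)) * ρ y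
      + v y * ((deriv U y : ℝ) : ℂ) = fu y
  momentum_v : ∀ᵐ y ∂chan,
    -(ε : ℂ) * lapk k v y - (lam : ℂ) * ε * weakDeriv (divk k u v) y
      + Complex.I * k * ((U y : ℂ) - c) * v y
      + ((m : ℂ) ^ 2)⁻¹ * weakDeriv ρ y = fv y
  v_left : v (-1) = 0
  v_right : v 1 = 0

/-- The regime of wave speeds `Re c ≈ ε^{2/7}`, `Im c ≈ ε^{2/7}` with constants `a < b`. -/
def speedRegime (a b ε : ℝ) : Set ℂ :=
  {c | c.re ∈ Ioo (a * ε ^ (2 / 7 : ℝ)) (b * ε ^ (2 / 7 : ℝ)) ∧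
       c.im ∈ Ioo (a * ε ^ (2 / 7 : ℝ)) (b * ε ^ (2 / 7 : ℝ))}

end PoiseuilleCNS

end

open MeasureTheory Set Filter Topology
open scoped ContDiff BoundedContinuousFunction ENNReal NNReal ComplexConjugate

noncomputable section

namespace PoiseuilleCNS

section

/-! Put δ = ε^(1/7), so that k ~ δ, c ~ δ², Im c ~ δ² and ν = ε/k ~ δ⁶; write e = U - c and A = 1 -
m²e². The solution comes from a contraction around an explicit family of fields that satisfy the
mass equation exactly and the momentum equations up to a small residual.

These fields are built from three pieces. (a) A viscous vorticity ω = ∫_{-1} θ with iνθ - p = F,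
where p = ∫_y^1 eω. Formally this is -εω'' + ikeω = ikF'. Since only v is prescribed at the walls, ω
may be given convenient boundary conditions, here ω(-1) = 0 and the natural one at 1. Because U is
real, the imaginary part of the energy identity is ν‖θ‖² + (Im c)‖ω‖², which yields solvability and
all the viscous bounds (`isUnit_viscOp`, `inner_viscOp_im`). (b) An inviscid stream function -eΦ
driven by p: Φ' = A(q+p)/e², q' = k²e²Φ, Φ(±1) = 0. (c) A pressure α + ∫g0 prescribed by the data
and a hydrostatic pressure ∫gt, with a small flow restoring the mass equation. The momentum
equations then hold with right-hand sides ikA(F + α + ∫g0) and g0 + gt plus residuals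
(`Unknowns.Solves.isRemainderSolution`). All terms of order k other than those displayed involve gt
alone.

In (b) the pressure q is O(δ²), hence Φ is nearly constant away from the walls. With an affine L
equal to 1/U' at the walls, integrating Aq/e² by parts isolates the wall term -ALq/e and leaves
integrals controlled by ‖1/e‖_{L²} ~ 1/δ. The condition at the right wall becomes a scalar equation
for the amplitude γ, with coefficient c(U'(-1) - U'(1)) - k²A(±1)∫e². Since ∫U² is real, the
imaginary part of this coefficient is of order δ², so it can be divided out
(`IsPoiseuilleType.norm_disp_ge`).

If the vorticity and the inviscid part have size S, the residual is O(δ⁶S) up to terms in the data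
and in gt (`exists_bound_residual`). A forcing z of the tangential equation gives ‖F‖ ~ ‖z‖/δ and S
~ ‖z‖/δ⁵, so the residual is O(δ‖z‖) and the iteration contracts. It depends holomorphically on c,
hence so does its fixed point (`exists_holomorphic_fixedPoint`), and this gives the analyticity of
u(±1).

The two estimates come from two ways of feeding in (f_u, f_v). Treated as a generic forcing it costs
δ⁻⁵. For H¹ forcing, integrating Ω yields f_u = ikA(-∫_y^1 Ω + α + ∫f_v); a forcing in primitive
form can be moved onto ω in the energy identity, and the cost drops to δ⁻²‖Ω‖
(`visc_energy_coprim`). One solution must satisfy both estimates and be analytic in c, so the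
representation may not change with c. It is chosen once for the whole regime by comparing the two
bounds, and comparability of Ω for different c (`exists_vortForcing_comparable`) transfers the
missing estimate. -/

instance : IsFiniteMeasure chan := by
  unfold chan; exact ⟨by simp⟩

instance : NullSingletonClass chan := by unfold chan; infer_instance

theorem chan_univ : chan univ = 2 := by
  simp [chan]; norm_num

theorem ae_chan_mem : ∀ᵐ y ∂chan, y ∈ Ioo (-1 : ℝ) 1 := ae_restrict_mem measurableSet_Ioo

/-! ### The space `L²(-1,1)` and bounded continuous functions -/

abbrev HilbertL2 := Lp ℂ 2 chan

theorem l2_coe (h : HilbertL2) : l2 h = ‖h‖ := by rw [l2, Lp.norm_def]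

theorem memL2_coe (h : HilbertL2) : MemL2 h := Lp.memLp h

theorem MemL2.integrable {f : ℝ → ℂ} (hf : MemL2 f) : Integrable f chan :=
  MemLp.integrable (by norm_num) hf

theorem integrable_coe (h : HilbertL2) : Integrable h chan := (memL2_coe h).integrable

theorem MemL2.norm_toLp {f : ℝ → ℂ} (hf : MemL2 f) : ‖MemLp.toLp f hf‖ = l2 f := by
  exact Lp.norm_toLp f hf

theorem l2_congr {f g : ℝ → ℂ} (h : f =ᵐ[chan] g) : l2 f = l2 g := by
  rw [l2, l2, eLpNorm_congr_ae h]

theorem l2_nonneg (f : ℝ → ℂ) : 0 ≤ l2 f := ENNReal.toReal_nonneg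

theorem MemL2.congr {f g : ℝ → ℂ} (hf : MemL2 f) (h : f =ᵐ[chan] g) : MemL2 g :=
  (memLp_congr_ae h).1 hf

theorem memL2_bcf (b : ℝ →ᵇ ℂ) : MemL2 b :=
  MemLp.of_bound b.continuous.aestronglyMeasurable ‖b‖ (.of_forall b.norm_coe_le_norm)

/-- Minkowski's inequality, in the form through which all pointwise bounds below become L² bounds.
-/
theorem l2_le_sum {n : ℕ} {f : ℝ → ℂ} {g : Fin n → ℝ → ℂ} {C : ℝ} (hC : 0 ≤ C)
    (hg : ∀ i, MemL2 (g i)) (h : ∀ᵐ y ∂chan, ‖f y‖ ≤ C * ∑ i, ‖g i y‖) :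
    l2 f ≤ C * ∑ i, l2 (g i) := by
  have h1 : eLpNorm f 2 chan ≤ ENNReal.ofReal C * eLpNorm (∑ i, fun y => ‖g i y‖) 2 chan := by
    refine eLpNorm_le_mul_eLpNorm_of_ae_le_mul ?_ 2
    filter_upwards [h] with y hy
    rw [Finset.sum_apply, Real.norm_of_nonneg (Finset.sum_nonneg fun i _ => norm_nonneg _)]
    exact hy
  have h2 : eLpNorm (∑ i, fun y => ‖g i y‖) 2 chan ≤ ∑ i, eLpNorm (g i) 2 chan := by
    refine (eLpNorm_sum_le (fun i _ => (hg i).1.norm) (by norm_num)).trans ?_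
    refine Finset.sum_le_sum fun i _ => ?_
    rw [eLpNorm_norm]
  have h3 : ∑ i, eLpNorm (g i) 2 chan ≠ ⊤ := by
    rw [ENNReal.sum_ne_top]
    exact fun i _ => (hg i).2.ne
  have h4 := h1.trans (mul_le_mul_right h2 _)
  unfold l2
  refine (ENNReal.toReal_mono (ENNReal.mul_ne_top ENNReal.ofReal_ne_top h3) h4).trans ?_
  rw [ENNReal.toReal_mul, ENNReal.toReal_ofReal hC, ENNReal.toReal_sum (fun i _ => (hg i).2.ne)]

theorem l2_le_mul {f g : ℝ → ℂ} {C : ℝ} (hC : 0 ≤ C) (hg : MemL2 g)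
    (h : ∀ᵐ y ∂chan, ‖f y‖ ≤ C * ‖g y‖) : l2 f ≤ C * l2 g := by
  have := l2_le_sum (n := 1) (f := f) (g := fun _ => g) hC (fun _ => hg) (by simpa using h)
  simpa using this

theorem l2_add_le {f g : ℝ → ℂ} (hf : MemL2 f) (hg : MemL2 g) :
    l2 (fun y => f y + g y) ≤ l2 f + l2 g := by
  have := l2_le_sum (n := 2) (f := fun y => f y + g y) (g := ![f, g]) zero_le_one
    (by intro i; fin_cases i <;> simpa) (.of_forall fun y => by
      simpa using norm_add_le (f y) (g y))
  simpa using this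

theorem l2_le_sup {f : ℝ → ℂ} {M : ℝ} (hM : 0 ≤ M) (h : ∀ᵐ y ∂chan, ‖f y‖ ≤ M) :
    l2 f ≤ 2 * M := by
  have h1 := eLpNorm_le_of_ae_bound (p := 2) h
  unfold l2
  -- The interval has measure 2, and √2 is rounded up to 2.
  have h2 : chan univ ^ (2 : ℝ≥0∞).toReal⁻¹ ≤ 2 := by
    rw [chan_univ]
    calc (2 : ℝ≥0∞) ^ (2 : ℝ≥0∞).toReal⁻¹ ≤ 2 ^ (1 : ℝ) :=
          ENNReal.rpow_le_rpow_of_exponent_le (by norm_num) (by norm_num)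
      _ = 2 := by simp
  have h3 := h1.trans (mul_le_mul_left h2 _)
  refine (ENNReal.toReal_mono (by finiteness) h3).trans ?_
  rw [ENNReal.toReal_mul, ENNReal.toReal_ofReal hM]
  simp

theorem l2_bcf_le (b : ℝ →ᵇ ℂ) : l2 b ≤ 2 * ‖b‖ :=
  l2_le_sup (norm_nonneg _) (.of_forall b.norm_coe_le_norm)

/-- Cauchy-Schwarz. -/
theorem integral_norm_mul_le {f g : ℝ → ℂ} (hf : MemL2 f) (hg : MemL2 g) :
    ∫ y, ‖f y * g y‖ ∂chan ≤ l2 f * l2 g := by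
  have h := integral_mul_norm_le_Lp_mul_Lq (μ := chan) (f := f) (g := g)
    (p := 2) (q := 2) (by constructor <;> norm_num) (by simpa [MemL2] using hf) (by simpa [MemL2] using hg)
  have e : ∀ w : ℝ → ℂ, MemL2 w → l2 w = (∫ a, ‖w a‖ ^ (2:ℝ) ∂chan) ^ (1 / (2:ℝ)) := by
    intro w hw
    rw [l2, MemLp.eLpNorm_eq_integral_rpow_norm (by norm_num) (by norm_num) hw,
      ENNReal.toReal_ofReal (by positivity)]
    simp
  rw [e f hf, e g hg]
  simpa [norm_mul] using h

theorem integral_norm_le {f : ℝ → ℂ} (hf : MemL2 f) : ∫ y, ‖f y‖ ∂chan ≤ 2 * l2 f := by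
  have h := integral_norm_mul_le (memL2_bcf (BoundedContinuousFunction.const ℝ (1:ℂ))) hf
  have h2 := l2_bcf_le (BoundedContinuousFunction.const ℝ (1:ℂ))
  simp only [BoundedContinuousFunction.const_apply, one_mul] at h
  refine h.trans (mul_le_mul_of_nonneg_right (h2.trans ?_) (l2_nonneg _))
  have := BoundedContinuousFunction.norm_const_le (α := ℝ) (1 : ℂ)
  simp only [norm_one] at this
  linarith

/-- The embedding of bounded continuous functions into `L²(-1,1)`. -/
def toL2 : (ℝ →ᵇ ℂ) →L[ℂ] HilbertL2 := BoundedContinuousFunction.toLp 2 chan ℂ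

theorem coeFn_toL2 (b : ℝ →ᵇ ℂ) : toL2 b =ᵐ[chan] b :=
  BoundedContinuousFunction.coeFn_toLp 2 chan ℂ b

theorem norm_toL2 (b : ℝ →ᵇ ℂ) : ‖toL2 b‖ = l2 b := by
  rw [← l2_coe, l2_congr (coeFn_toL2 b)]

/-- Multiplication of `L²` functions by bounded continuous functions. -/
def mulL2 : (ℝ →ᵇ ℂ) →L[ℂ] HilbertL2 →L[ℂ] HilbertL2 :=
  ((ContinuousLinearMap.mul ℂ ℂ).holderL chan ⊤ 2 2) ∘L
    (BoundedContinuousFunction.toLp ⊤ chan ℂ)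

theorem coeFn_mulL2 (b : ℝ →ᵇ ℂ) (h : HilbertL2) : mulL2 b h =ᵐ[chan] fun y => b y * h y := by
  have h1 := (ContinuousLinearMap.mul ℂ ℂ).coeFn_holder (r := 2)
    (BoundedContinuousFunction.toLp (E := ℂ) ⊤ chan ℂ b) h
  have h2 := BoundedContinuousFunction.coeFn_toLp (E := ℂ) ⊤ chan ℂ b
  have h3 : mulL2 b h = (ContinuousLinearMap.mul ℂ ℂ).holder 2
    (BoundedContinuousFunction.toLp (E := ℂ) ⊤ chan ℂ b) h := rfl
  rw [h3]
  filter_upwards [h1, h2] with y hy1 hy2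
  rw [hy1, hy2]; rfl

/-! ### Primitives -/

/-- The primitive on `(-1,1)` vanishing at `-1`. -/
def prim (h : ℝ → ℂ) (y : ℝ) : ℂ := ∫ t in (-1)..y, h t ∂chan

theorem prim_neg_one (h : ℝ → ℂ) : prim h (-1) = 0 := by simp [prim]

theorem prim_congr {f g : ℝ → ℂ} (h : f =ᵐ[chan] g) : prim f = prim g := by
  funext y
  unfold prim
  refine intervalIntegral.integral_congr_ae ?_
  filter_upwards [h] with t ht _ using ht

theorem prim_eq_indicator (h : ℝ → ℂ) {y : ℝ} (hy : -1 ≤ y) :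
    prim h y = ∫ t, (Iic y).indicator h t ∂chan := by
  rw [prim, intervalIntegral.integral_of_le hy, integral_indicator measurableSet_Iic]
  unfold chan
  rw [Measure.restrict_restrict measurableSet_Ioc, Measure.restrict_restrict measurableSet_Iic]
  congr 2
  ext t; simp only [mem_inter_iff, mem_Ioc, mem_Ioo, mem_Iic]; constructor <;> intro h <;> grind

theorem prim_one (h : ℝ → ℂ) : prim h 1 = ∫ t, h t ∂chan := by
  rw [prim_eq_indicator h (by norm_num)]
  refine integral_congr_ae ?_
  filter_upwards [ae_chan_mem] with t ht
  rw [indicator_of_mem (by exact ht.2.le)]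

theorem prim_eq_volume (h : ℝ → ℂ) {y : ℝ} (hy : y ∈ Icc (-1 : ℝ) 1) :
    prim h y = ∫ t in (-1)..y, h t := by
  rw [prim, intervalIntegral.integral_of_le hy.1, intervalIntegral.integral_of_le hy.1]
  unfold chan
  rw [Measure.restrict_restrict measurableSet_Ioc]
  refine setIntegral_congr_set ?_
  have h1 : (Ioc (-1) y ∩ Ioo (-1) 1 : Set ℝ) =ᵐ[volume] (Ioc (-1) y ∩ Ioc (-1) 1 : Set ℝ) :=
    ae_eq_set_inter (ae_eq_refl _) Ioo_ae_eq_Ioc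
  have h2 : (Ioc (-1) y ∩ Ioc (-1) 1 : Set ℝ) = Ioc (-1) y :=
    inter_eq_left.2 (Ioc_subset_Ioc_right hy.2)
  rwa [h2] at h1

theorem norm_prim_le {h : ℝ → ℂ} (hh : Integrable h chan) (y : ℝ) :
    ‖prim h y‖ ≤ ∫ t, ‖h t‖ ∂chan := by
  unfold prim
  refine intervalIntegral.norm_integral_le_integral_norm_uIoc.trans ?_
  exact setIntegral_le_integral hh.norm (.of_forall fun _ => norm_nonneg _)

theorem continuous_prim {h : ℝ → ℂ} (hh : Integrable h chan) : Continuous (prim h) :=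
  intervalIntegral.continuous_primitive (fun _ _ => hh.intervalIntegrable) _

theorem prim_add {f g : ℝ → ℂ} (hf : Integrable f chan) (hg : Integrable g chan) (y : ℝ) :
    prim (fun t => f t + g t) y = prim f y + prim g y :=
  intervalIntegral.integral_add hf.intervalIntegrable hg.intervalIntegrable

theorem prim_const_mul (c : ℂ) (f : ℝ → ℂ) (y : ℝ) :
    prim (fun t => c * f t) y = c * prim f y :=
  intervalIntegral.integral_const_mul c f

/-- The primitive as an operator from `L²(-1,1)` to bounded continuous functions. -/
def primL : HilbertL2 →L[ℂ] (ℝ →ᵇ ℂ) :=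
  LinearMap.mkContinuous
    { toFun := fun h => BoundedContinuousFunction.ofNormedAddCommGroup (prim h)
        (continuous_prim (integrable_coe h)) _ (norm_prim_le (integrable_coe h))
      map_add' := by
        intro f g
        ext y
        simp only [BoundedContinuousFunction.coe_ofNormedAddCommGroup,
          BoundedContinuousFunction.coe_add, Pi.add_apply]
        rw [prim_congr (Lp.coeFn_add f g)]
        exact prim_add (integrable_coe f) (integrable_coe g) y
      map_smul' := by
        intro c f
        ext y
        simp only [BoundedContinuousFunction.coe_ofNormedAddCommGroup,
          BoundedContinuousFunction.coe_smul, RingHom.id_apply, smul_eq_mul]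
        rw [prim_congr (Lp.coeFn_smul c f)]
        exact prim_const_mul c f y } 2 (by
    intro h
    refine (BoundedContinuousFunction.norm_le (by positivity)).2 fun y => ?_
    exact (norm_prim_le (integrable_coe h) y).trans
      ((integral_norm_le (memL2_coe h)).trans_eq (by rw [l2_coe])))

theorem primL_apply (h : HilbertL2) (y : ℝ) : primL h y = prim h y := rfl

theorem norm_primL_le (h : HilbertL2) : ‖primL h‖ ≤ 2 * ‖h‖ :=
  (LinearMap.mkContinuous_norm_le _ (by norm_num) _ |> primL.le_of_opNorm_le) h

theorem primL_toL2_apply (b : ℝ →ᵇ ℂ) (y : ℝ) : primL (toL2 b) y = prim b y := by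
  rw [primL_apply, prim_congr (coeFn_toL2 b)]

theorem hasDerivAt_prim (b : ℝ →ᵇ ℂ) {y : ℝ} (hy : y ∈ Ioo (-1 : ℝ) 1) :
    HasDerivAt (prim b) (b y) y := by
  have h1 : HasDerivAt (fun x => ∫ t in (-1)..x, b t) (b y) y :=
    intervalIntegral.integral_hasDerivAt_right (b.continuous.intervalIntegrable _ _)
      b.continuous.stronglyMeasurable.stronglyMeasurableAtFilter b.continuous.continuousAt
  refine h1.congr_of_eventuallyEq ?_
  filter_upwards [isOpen_Ioo.mem_nhds hy] with x hx
  exact prim_eq_volume _ ⟨hx.1.le, hx.2.le⟩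

theorem eq_add_prim {f : ℝ → ℂ} (b : ℝ →ᵇ ℂ) (hf : ContinuousOn f (Icc (-1) 1))
    (hd : ∀ y ∈ Ioo (-1 : ℝ) 1, HasDerivAt f (b y) y) {y : ℝ} (hy : y ∈ Icc (-1 : ℝ) 1) :
    f y = f (-1) + prim b y := by
  rw [prim_eq_volume _ hy]
  rw [intervalIntegral.integral_eq_sub_of_hasDerivAt_of_le hy.1
    (hf.mono (Icc_subset_Icc_right hy.2))
    (fun x hx => hd x ⟨hx.1, hx.2.trans_le hy.2⟩) (b.continuous.intervalIntegrable _ _)]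
  ring

/-- Integration by parts for primitives. -/
theorem integral_mul_prim {f g : ℝ → ℂ} (hf : Integrable f chan) (hg : Integrable g chan) :
    ∫ y, f y * prim g y ∂chan = ∫ t, (prim f 1 - prim f t) * g t ∂chan := by
  -- Fubini on the triangle t ≤ y: integrating in t first gives the left side, in y first the right
  -- side.
  let F : ℝ × ℝ → ℂ := fun z => {z : ℝ × ℝ | z.2 ≤ z.1}.indicator (fun z => f z.1 * g z.2) z
  have hF : Integrable F (chan.prod chan) :=
    (hf.mul_prod hg).indicator (measurableSet_le measurable_snd measurable_fst)
  have h1 : ∫ y, f y * prim g y ∂chan = ∫ y, ∫ t, F (y, t) ∂chan ∂chan := by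
    refine integral_congr_ae ?_
    filter_upwards [ae_chan_mem] with y hy
    rw [prim_eq_indicator g hy.1.le, ← integral_const_mul]
    refine integral_congr_ae (.of_forall fun t => ?_)
    simp only [F, indicator_apply, mem_Iic, mem_ofPred_eq]
    split_ifs <;> simp
  have h2 : ∫ t, (prim f 1 - prim f t) * g t ∂chan = ∫ t, ∫ y, F (y, t) ∂chan ∂chan := by
    refine integral_congr_ae ?_
    filter_upwards [ae_chan_mem] with t ht
    rw [prim_one, prim_eq_indicator f ht.1.le, ← integral_sub hf (hf.indicator measurableSet_Iic),
      ← integral_mul_const]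
    refine integral_congr_ae ?_
    -- The two descriptions of the slice differ only at y = t, a null set.
    have : ∀ᵐ y ∂chan, y ≠ t := by
      rw [ae_iff]; simp [measure_singleton]
    filter_upwards [this] with y hy
    simp only [F, indicator_apply, mem_Iic, mem_ofPred_eq]
    rcases lt_or_gt_of_ne hy with h | h
    · simp [h.le, not_le.2 h]
    · simp [h.le, not_le.2 h]
  rw [h1, h2]
  exact integral_integral_swap hF

/-! ### Weak derivatives -/

theorem locInt {f : ℝ → ℂ} (hf : Integrable f chan) : LocallyIntegrableOn f (Ioo (-1) 1) :=
  IntegrableOn.locallyIntegrableOn hf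

theorem test_vanish {φ : ℝ → ℝ} (hs : tsupport φ ⊆ Ioo (-1) 1) {y : ℝ} (hy : y ∉ Ioo (-1 : ℝ) 1) :
    φ y = 0 := by
  by_contra h0
  exact hy (hs (subset_tsupport _ h0))

/-- A primitive of an integrable function is weakly differentiable. -/
theorem hasWeakDeriv_prim {h : ℝ → ℂ} (hh : Integrable h chan) (α : ℂ) :
    HasWeakDeriv (fun y => α + prim h y) h := by
  have hc : Continuous (fun y => α + prim h y) := continuous_const.add (continuous_prim hh)
  refine ⟨hc.locallyIntegrable.locallyIntegrableOn _, locInt hh, ?_⟩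
  intro φ hφ hcs hs
  have hd : ContDiff ℝ ∞ (deriv φ) := by
    have := (contDiff_succ_iff_deriv (n := ∞) (𝕜 := ℝ) (f := φ)).1 (by simpa using hφ)
    exact this.2.2
  have hdc : HasCompactSupport (deriv φ) := hcs.deriv
  obtain ⟨M, hM⟩ := hdc.exists_bound_of_continuous hd.continuous
  -- On [-1,1] the test function is the primitive of b = φ', so testing against φ' reduces to
  -- `integral_mul_prim`; φ(1) = 0 removes the boundary term and the constant α.
  let b : ℝ →ᵇ ℂ := BoundedContinuousFunction.ofNormedAddCommGroup (fun y => ((deriv φ y : ℝ) : ℂ))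
    (Complex.continuous_ofReal.comp hd.continuous) M (by intro y; simpa using hM y)
  have hb : Integrable b chan := (memL2_bcf b).integrable
  have hpb : ∀ y ∈ Icc (-1 : ℝ) 1, prim b y = (φ y : ℂ) := by
    intro y hy
    have := eq_add_prim (f := fun y => (φ y : ℂ)) b
      (Complex.continuous_ofReal.comp hφ.continuous).continuousOn (fun y _ => by
        exact ((hφ.differentiable (by simp)).differentiableAt.hasDerivAt).ofReal_comp) hy
    rw [test_vanish hs (y := -1) (by simp)] at this
    simpa using this.symm
  have hprimint : Integrable (fun y => b y * prim h y) chan := by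
    refine Integrable.bdd_mul (c := ‖b‖) ?_ b.continuous.aestronglyMeasurable
      (.of_forall b.norm_coe_le_norm)
    exact MemLp.integrable (q := ⊤) (by simp) (memLp_top_of_bound
      (continuous_prim hh).aestronglyMeasurable _ (.of_forall (norm_prim_le hh)))
  have e1 : ∫ y, deriv φ y • (α + prim h y) ∂chan
      = α * ∫ y, b y ∂chan + ∫ y, b y * prim h y ∂chan := by
    rw [← integral_const_mul, ← integral_add (hb.const_mul α) hprimint]
    refine integral_congr_ae (.of_forall fun y => ?_)
    simp only [b, BoundedContinuousFunction.coe_ofNormedAddCommGroup, Complex.real_smul]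
    ring
  rw [e1, ← prim_one, hpb 1 (by simp), integral_mul_prim hb hh, hpb 1 (by simp),
    test_vanish hs (y := 1) (by simp), ← integral_neg]
  simp only [Complex.ofReal_zero, mul_zero, zero_add]
  refine integral_congr_ae ?_
  filter_upwards [ae_chan_mem] with y hy
  rw [hpb y ⟨hy.1.le, hy.2.le⟩]
  simp

theorem HasWeakDeriv.congr {f g f' g' : ℝ → ℂ} (h : HasWeakDeriv f g) (hf : f =ᵐ[chan] f')
    (hg : g =ᵐ[chan] g') : HasWeakDeriv f' g' := by
  have key : ∀ {w w' : ℝ → ℂ}, w =ᵐ[chan] w' → LocallyIntegrableOn w (Ioo (-1) 1) →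
      LocallyIntegrableOn w' (Ioo (-1) 1) := by
    intro w w' hw h
    have hloc := (locallyIntegrableOn_iff (isOpen_Ioo.isLocallyClosed)).1 h
    refine (locallyIntegrableOn_iff (isOpen_Ioo.isLocallyClosed)).2 fun k hk hkc => ?_
    refine (hloc k hk hkc).congr ?_
    exact ae_restrict_of_ae_restrict_of_subset hk hw
  refine ⟨key hf h.1, key hg h.2.1, fun φ h1 h2 h3 => ?_⟩
  have := h.2.2 φ h1 h2 h3
  rw [integral_congr_ae (g := fun y => deriv φ y • f' y)
    (by filter_upwards [hf] with y hy; simp [hy]),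
    integral_congr_ae (f := fun y => φ y • g y) (g := fun y => φ y • g' y)
    (by filter_upwards [hg] with y hy; simp [hy])] at this
  exact this

theorem test_integrable {w : ℝ → ℂ} (hw : LocallyIntegrableOn w (Ioo (-1) 1)) {φ : ℝ → ℝ}
    (hφ : Continuous φ) (hc : HasCompactSupport φ) (hs : tsupport φ ⊆ Ioo (-1) 1) :
    Integrable (fun y => φ y • w y) chan := by
  have h1 : IntegrableOn w (tsupport φ) := hw.integrableOn_compact_subset hs hc
  have h2 : IntegrableOn (fun y => φ y • w y) (tsupport φ) :=
    h1.continuousOn_smul hφ.continuousOn hc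
  have h3 : Integrable (fun y => φ y • w y) volume := by
    refine (integrableOn_iff_integrable_of_support_subset ?_).1 h2
    intro y hy
    apply subset_tsupport
    intro h0
    exact hy (by simp [h0])
  exact h3.restrict

theorem deriv_smul_integrable {w : ℝ → ℂ} (hw : LocallyIntegrableOn w (Ioo (-1) 1)) {φ : ℝ → ℝ}
    (hφ : ContDiff ℝ ∞ φ) (hc : HasCompactSupport φ) (hs : tsupport φ ⊆ Ioo (-1) 1) :
    Integrable (fun y => deriv φ y • w y) chan :=
  test_integrable hw (hφ.continuous_deriv (by simp)) hc.deriv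
    ((tsupport_deriv_subset (𝕜 := ℝ) (f := φ)).trans hs)

theorem HasWeakDeriv.add {f g f' g' : ℝ → ℂ} (h : HasWeakDeriv f g) (h' : HasWeakDeriv f' g') :
    HasWeakDeriv (fun y => f y + f' y) (fun y => g y + g' y) := by
  refine ⟨h.1.add h'.1, h.2.1.add h'.2.1, fun φ h1 h2 h3 => ?_⟩
  simp only [smul_add]
  rw [integral_add (deriv_smul_integrable h.1 h1 h2 h3) (deriv_smul_integrable h'.1 h1 h2 h3),
    integral_add (test_integrable h.2.1 h1.continuous h2 h3)
      (test_integrable h'.2.1 h1.continuous h2 h3), h.2.2 φ h1 h2 h3, h'.2.2 φ h1 h2 h3]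
  ring

theorem HasWeakDeriv.const_mul {f g : ℝ → ℂ} (h : HasWeakDeriv f g) (c : ℂ) :
    HasWeakDeriv (fun y => c * f y) (fun y => c * g y) := by
  have key : ∀ {w : ℝ → ℂ}, LocallyIntegrableOn w (Ioo (-1) 1) →
      LocallyIntegrableOn (fun y => c * w y) (Ioo (-1) 1) := fun hw => hw.smul c
  refine ⟨key h.1, key h.2.1, fun φ h1 h2 h3 => ?_⟩
  have := h.2.2 φ h1 h2 h3
  simp only [Complex.real_smul] at this ⊢
  calc _ = ∫ y, c * ((deriv φ y : ℝ) * f y) ∂chan := by congr 1; ext y; ring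
    _ = c * -∫ y, φ y * g y ∂chan := by rw [integral_const_mul, this]
    _ = _ := by rw [mul_neg, ← integral_const_mul]; congr 2; ext y; ring

end

/-! ### Product rule for weak derivatives, and recovery of a function from its weak derivative. -/

section

/-- If φ is a test function then so is φr: it is smooth on the whole line because φ is supported
inside the interval where r is smooth. Testing f against φr gives the rule. -/
theorem HasWeakDeriv.real_smooth_mul {f g : ℝ → ℂ} (h : HasWeakDeriv f g) {r : ℝ → ℝ}
    (hr : ContDiffOn ℝ ∞ r (Ioo (-1) 1)) :
    HasWeakDeriv (fun y => (r y : ℂ) * f y)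
      (fun y => ((deriv r y : ℝ) : ℂ) * f y + (r y : ℂ) * g y) := by
  have hrc : ContinuousOn (fun y => (r y : ℂ)) (Ioo (-1) 1) :=
    Complex.continuous_ofReal.comp_continuousOn hr.continuousOn
  have hrc' : ContinuousOn (fun y => ((deriv r y : ℝ) : ℂ)) (Ioo (-1) 1) :=
    Complex.continuous_ofReal.comp_continuousOn (hr.continuousOn_deriv_of_isOpen isOpen_Ioo
      (by simp))
  have l1 : LocallyIntegrableOn (fun y => (r y : ℂ) * f y) (Ioo (-1) 1) :=
    h.1.continuousOn_mul hrc isOpen_Ioo.isLocallyClosed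
  have l2 : LocallyIntegrableOn (fun y => ((deriv r y : ℝ) : ℂ) * f y) (Ioo (-1) 1) :=
    h.1.continuousOn_mul hrc' isOpen_Ioo.isLocallyClosed
  have l3 : LocallyIntegrableOn (fun y => (r y : ℂ) * g y) (Ioo (-1) 1) :=
    h.2.1.continuousOn_mul hrc isOpen_Ioo.isLocallyClosed
  refine ⟨l1, l2.add l3, fun φ h1 h2 h3 => ?_⟩
  have hη : ContDiff ℝ ∞ (fun y => φ y * r y) := by
    rw [contDiff_iff_contDiffAt]
    intro y
    by_cases hy : y ∈ tsupport φ
    · exact h1.contDiffAt.mul (hr.contDiffAt (isOpen_Ioo.mem_nhds (h3 hy)))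
    · have : (fun y => φ y * r y) =ᶠ[nhds y] fun _ => 0 := by
        filter_upwards [notMem_tsupport_iff_eventuallyEq.1 hy] with z hz
        simp [hz]
      exact contDiffAt_const.congr_of_eventuallyEq this
  have hηs : tsupport (fun y => φ y * r y) ⊆ tsupport φ := tsupport_mul_subset_left
  have key := h.2.2 _ hη (h2.mul_right) (hηs.trans h3)
  have hd : ∀ y ∈ Ioo (-1 : ℝ) 1, deriv (fun y => φ y * r y) y = deriv φ y * r y + φ y * deriv r y :=
    fun y hy => deriv_fun_mul (h1.differentiable (by simp)).differentiableAt
      ((hr.differentiableOn (by simp)).differentiableAt (isOpen_Ioo.mem_nhds hy))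
  have i1 := deriv_smul_integrable l1 h1 h2 h3
  have i2 := test_integrable l2 h1.continuous h2 h3
  have i3 := test_integrable l3 h1.continuous h2 h3
  have e1 : ∫ y, deriv (fun y => φ y * r y) y • f y ∂chan
      = ∫ y, deriv φ y • ((r y : ℂ) * f y) ∂chan
        + ∫ y, φ y • (((deriv r y : ℝ) : ℂ) * f y) ∂chan := by
    rw [← integral_add i1 i2]
    refine integral_congr_ae ?_
    filter_upwards [ae_chan_mem] with y hy
    rw [hd y hy]
    simp only [Complex.real_smul, Complex.ofReal_add, Complex.ofReal_mul]
    ring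
  have e2 : ∫ y, (φ y * r y) • g y ∂chan = ∫ y, φ y • ((r y : ℂ) * g y) ∂chan := by
    congr 1; ext y; simp only [Complex.real_smul, Complex.ofReal_mul]; ring
  simp only [smul_add]
  rw [integral_add i2 i3, ← e2]
  rw [e1] at key
  linear_combination key

/-- The product rule for a smooth coefficient and a weakly differentiable function. -/
theorem HasWeakDeriv.smooth_mul {f g a a' : ℝ → ℂ} (h : HasWeakDeriv f g)
    (ha : ContDiffOn ℝ ∞ a (Ioo (-1) 1)) (hd : ∀ y ∈ Ioo (-1 : ℝ) 1, HasDerivAt a (a' y) y) :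
    HasWeakDeriv (fun y => a y * f y) (fun y => a' y * f y + a y * g y) := by
  have hre : ContDiffOn ℝ ∞ (fun y => (a y).re) (Ioo (-1) 1) :=
    Complex.reCLM.contDiff.comp_contDiffOn ha
  have him : ContDiffOn ℝ ∞ (fun y => (a y).im) (Ioo (-1) 1) :=
    Complex.imCLM.contDiff.comp_contDiffOn ha
  have h1 := (h.real_smooth_mul hre).add ((h.real_smooth_mul him).const_mul Complex.I)
  refine h1.congr (.of_forall fun y => ?_) ?_
  · show _ = a y * f y
    linear_combination f y * Complex.re_add_im (a y)
  · filter_upwards [ae_chan_mem] with y hy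
    have hda := hd y hy
    have d1 : deriv (fun y => (a y).re) y = (a' y).re :=
      (Complex.reCLM.hasFDerivAt.comp_hasDerivAt y hda).deriv
    have d2 : deriv (fun y => (a y).im) y = (a' y).im :=
      (Complex.imCLM.hasFDerivAt.comp_hasDerivAt y hda).deriv
    rw [d1, d2]
    linear_combination g y * Complex.re_add_im (a y) + f y * Complex.re_add_im (a' y)

/-- A function with vanishing weak derivative is constant. -/
theorem HasWeakDeriv.ae_eq_const {f : ℝ → ℂ} (h : HasWeakDeriv f 0) :
    ∃ α : ℂ, f =ᵐ[chan] fun _ => α := by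
  -- A reference test function of mass one; the constant is the integral of f against it.
  let B : ContDiffBump (0 : ℝ) := ⟨1 / 4, 1 / 2, by norm_num, by norm_num⟩
  set φ₀ : ℝ → ℝ := B.normed volume with hφ₀
  have b1 : ContDiff ℝ ∞ φ₀ := B.contDiff_normed
  have b2 : HasCompactSupport φ₀ := B.hasCompactSupport_normed
  have b3 : tsupport φ₀ = Metric.closedBall 0 (1 / 2) := B.tsupport_normed_eq
  have b3' : tsupport φ₀ ⊆ Ioo (-1) 1 := by
    rw [b3, Real.closedBall_eq_Icc]; intro x hx; constructor <;> linarith [hx.1, hx.2]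
  have b4 : ∫ y, φ₀ y = 1 := B.integral_normed
  set α : ℂ := ∫ y, φ₀ y • f y ∂chan with hα
  refine ⟨α, ?_⟩
  have key : ∀ᵐ x ∂(volume : Measure ℝ), x ∈ Ioo (-1 : ℝ) 1 → (fun x => f x - α) x = 0 := by
    have hloc : LocallyIntegrableOn (fun x => f x - α) (Ioo (-1 : ℝ) 1) :=
      h.1.sub (continuous_const.locallyIntegrable.locallyIntegrableOn _)
    refine isOpen_Ioo.ae_eq_zero_of_integral_contDiff_smul_eq_zero hloc ?_
    intro ψ hψ hψc hψs
    have hset : ∀ (χ : ℝ → ℝ) (w : ℝ → ℂ), tsupport χ ⊆ Ioo (-1) 1 →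
        ∫ y, χ y • w y = ∫ y, χ y • w y ∂chan := by
      intro χ w hχ
      refine (setIntegral_eq_integral_of_forall_compl_eq_zero fun y hy => ?_).symm
      simp [test_vanish hχ hy]
    rw [hset _ _ hψs]
    set s : ℝ := ∫ y, ψ y with hs
    -- Subtracting the mass of ψ gives η mean zero, so its primitive Φ is again compactly supported
    -- in the interval and is an admissible test function. The vanishing weak derivative then says
    -- ∫ηf = 0.
    set η : ℝ → ℝ := fun y => ψ y - s * φ₀ y with hη
    have hηd : ContDiff ℝ ∞ η := hψ.sub (contDiff_const.mul b1)
    set Φ : ℝ → ℝ := fun y => ∫ t in (-1)..y, η t with hΦ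
    have hΦd : ∀ y, HasDerivAt Φ (η y) y := fun y =>
      intervalIntegral.integral_hasDerivAt_right (hηd.continuous.intervalIntegrable _ _)
        hηd.continuous.stronglyMeasurable.stronglyMeasurableAtFilter hηd.continuous.continuousAt
    have hderiv : deriv Φ = η := funext fun y => (hΦd y).deriv
    have hΦs : ContDiff ℝ ∞ Φ := by
      rw [contDiff_infty_iff_deriv, hderiv]
      exact ⟨fun y => (hΦd y).differentiableAt, hηd⟩
    have hSc : IsCompact (tsupport ψ ∪ tsupport φ₀) := IsCompact.union hψc b2
    have hSne : (tsupport ψ ∪ tsupport φ₀).Nonempty :=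
      ⟨0, Or.inr (by rw [b3]; simp)⟩
    obtain ⟨p, hpS, hp⟩ := hSc.exists_isLeast hSne
    obtain ⟨q, hqS, hq⟩ := hSc.exists_isGreatest hSne
    have hSs : tsupport ψ ∪ tsupport φ₀ ⊆ Ioo (-1) 1 := union_subset hψs b3'
    have hη0 : ∀ y, y ∉ Icc p q → η y = 0 := by
      intro y hy
      have : y ∉ tsupport ψ ∪ tsupport φ₀ := fun hm => hy ⟨hp hm, hq hm⟩
      rw [mem_union, not_or] at this
      simp only [hη, image_eq_zero_of_notMem_tsupport this.1,
        image_eq_zero_of_notMem_tsupport this.2]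
      ring
    have hηint : ∫ y, η y = 0 := by
      simp only [hη]
      rw [integral_sub (hψ.continuous.integrable_of_hasCompactSupport hψc)
        ((b1.continuous.integrable_of_hasCompactSupport b2).const_mul s), integral_const_mul, b4]
      simp [hs]
    have hp1 := (hSs hpS).1
    have hq1 := (hSs hqS).2
    have hΦ0 : ∀ y, y ∉ Icc p q → Φ y = 0 := by
      intro y hy
      rcases lt_or_ge y p with h' | h'
      · simp only [hΦ]
        refine (intervalIntegral.integral_congr (g := fun _ => (0:ℝ)) fun t ht => ?_).trans (by simp)
        refine hη0 t fun ht' => ?_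
        have := ht.2
        rcases le_total (-1) y with h'' | h''
        · rw [sup_eq_right.2 h''] at this; linarith [ht'.1]
        · rw [sup_eq_left.2 h''] at this; linarith [ht'.1]
      · have hqy : q < y := by
          by_contra hc; exact hy ⟨h', not_lt.1 hc⟩
        have hpq : p ≤ q := hp hqS
        simp only [hΦ]
        rw [← hηint, intervalIntegral.integral_of_le (by linarith)]
        refine setIntegral_eq_integral_of_forall_compl_eq_zero fun t ht => ?_
        refine hη0 t fun ht' => ht ⟨by linarith [ht'.1], by linarith [ht'.2]⟩
    have hΦts : tsupport Φ ⊆ Icc p q := by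
      refine closure_minimal (fun y hy => ?_) isClosed_Icc
      by_contra hc; exact hy (hΦ0 y hc)
    have hΦc : HasCompactSupport Φ := isCompact_Icc.of_isClosed_subset (isClosed_tsupport _) hΦts
    have := h.2.2 Φ hΦs hΦc (hΦts.trans fun y hy => ⟨by linarith [hy.1], by linarith [hy.2]⟩)
    rw [hderiv] at this
    simp only [Pi.zero_apply, smul_zero, integral_zero, neg_zero, hη] at this
    have i1 := test_integrable h.1 hψ.continuous hψc hψs
    have i2 := test_integrable h.1 b1.continuous b2 b3'
    have e : ∫ y, (ψ y - s * φ₀ y) • f y ∂chan = ∫ y, ψ y • f y ∂chan - s * α := by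
      rw [hα, ← integral_const_mul, ← integral_sub i1 (i2.const_mul _)]
      congr 1; ext y
      simp only [Complex.real_smul, Complex.ofReal_sub, Complex.ofReal_mul]
      ring
    rw [e] at this
    have i3 : Integrable (fun y => ψ y • α) chan :=
      test_integrable (continuous_const.locallyIntegrable.locallyIntegrableOn _)
        hψ.continuous hψc hψs
    simp only [smul_sub]
    rw [integral_sub i1 i3, ← hset ψ (fun _ => α) hψs, integral_smul_const, ← hs]
    rw [Complex.real_smul]; exact this
  have := (ae_restrict_iff' measurableSet_Ioo).2 key
  filter_upwards [this] with x hx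
  exact sub_eq_zero.1 hx

/-- A weakly differentiable function is the primitive of its derivative up to a constant. -/
theorem HasWeakDeriv.ae_eq_add_prim {f g : ℝ → ℂ} (h : HasWeakDeriv f g) (hg : Integrable g chan) :
    ∃ α : ℂ, f =ᵐ[chan] fun y => α + prim g y := by
  have h1 := (hasWeakDeriv_prim hg 0).const_mul (-1)
  obtain ⟨α, hα⟩ := HasWeakDeriv.ae_eq_const ((h.add h1).congr (g' := 0) (ae_eq_refl _)
    (.of_forall fun y => by simp))
  refine ⟨α, ?_⟩
  filter_upwards [hα] with y hy
  linear_combination hy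

theorem HasWeakDeriv.of_ae_eq_weakDeriv {f g : ℝ → ℂ} (h : HasWeakDeriv f g) :
    HasWeakDeriv f (weakDeriv f) := h.congr (ae_eq_refl _) h.weakDeriv_ae_eq.symm

theorem weakDeriv_weakDeriv_ae_eq {f g g' : ℝ → ℂ} (h : HasWeakDeriv f g)
    (h' : HasWeakDeriv g g') : weakDeriv (weakDeriv f) =ᵐ[chan] g' :=
  (h'.congr h.weakDeriv_ae_eq.symm (ae_eq_refl _)).weakDeriv_ae_eq

/-- A classical derivative that is continuous up to the boundary is a weak derivative. -/
theorem hasWeakDeriv_of_hasDerivAt {f : ℝ → ℂ} (b : ℝ →ᵇ ℂ) (hf : ContinuousOn f (Icc (-1) 1))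
    (hd : ∀ y ∈ Ioo (-1 : ℝ) 1, HasDerivAt f (b y) y) : HasWeakDeriv f b := by
  refine (hasWeakDeriv_prim (memL2_bcf b).integrable (f (-1))).congr ?_ (ae_eq_refl _)
  filter_upwards [ae_chan_mem] with y hy
  exact (eq_add_prim b hf hd ⟨hy.1.le, hy.2.le⟩).symm

end

section

/-! ### Holomorphic families of contractions -/

/-- The Picard iterates from 0 are holomorphic in c. Their a priori error at c is governed by ‖F c
0‖, which is continuous in c, so convergence is locally uniform and the limit is holomorphic. -/
theorem exists_holomorphic_fixedPoint {E : Type*} [NormedAddCommGroup E] [NormedSpace ℂ E]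
    [CompleteSpace E] {R : Set ℂ} (hR : IsOpen R) (F : ℂ → E → E)
    (hF : ∀ c ∈ R, ∀ x y, ‖F c x - F c y‖ ≤ 1 / 2 * ‖x - y‖)
    (hol : ∀ x : ℂ → E, DifferentiableOn ℂ x R → DifferentiableOn ℂ (fun c => F c (x c)) R) :
    ∃ x : ℂ → E, (∀ c ∈ R, F c (x c) = x c) ∧ DifferentiableOn ℂ x R := by
  classical
  let it : ℕ → ℂ → E := fun n c => (F c)^[n] 0
  have hit : ∀ n, DifferentiableOn ℂ (it n) R := by
    intro n
    induction n with
    | zero => exact differentiableOn_const 0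
    | succ n ih =>
      have := hol _ ih
      refine this.congr fun c _ => ?_
      simp only [it, Function.iterate_succ_apply']
  have hcon : ∀ c ∈ R, ContractingWith (1 / 2) (F c) := by
    intro c hc
    refine ⟨by rw [← NNReal.coe_lt_coe]; norm_num, LipschitzWith.of_dist_le_mul fun x y => ?_⟩
    rw [dist_eq_norm, dist_eq_norm]
    simpa using hF c hc x y
  let x : ℂ → E := fun c => if h : c ∈ R then (hcon c h).fixedPoint (F c) else 0
  have hx : ∀ c (h : c ∈ R), x c = (hcon c h).fixedPoint (F c) := fun c h => by simp [x, h]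
  refine ⟨x, fun c hc => ?_, ?_⟩
  · rw [hx c hc]; exact (hcon c hc).fixedPoint_isFixedPt
  have hloc : TendstoLocallyUniformlyOn it x atTop R := by
    rw [Metric.tendstoLocallyUniformlyOn_iff]
    intro e he c hc
    have hcont : ContinuousWithinAt (fun c => ‖F c 0‖) R c :=
      ((hol (fun _ => 0) (differentiableOn_const 0)).continuousOn c hc).norm
    have hbd : ∀ᶠ c' in 𝓝[R] c, ‖F c' 0‖ < ‖F c 0‖ + 1 :=
      hcont.eventually (gt_mem_nhds (by linarith))
    have hlim : Tendsto (fun n : ℕ => (‖F c 0‖ + 1) * (1 / 2 : ℝ) ^ n / (1 - 1 / 2)) atTop (𝓝 0) := by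
      have := tendsto_pow_atTop_nhds_zero_of_lt_one (r := (1 / 2 : ℝ)) (by norm_num) (by norm_num)
      simpa using (this.const_mul (‖F c 0‖ + 1)).div_const (1 - 1 / 2)
    refine ⟨R ∩ {c' | ‖F c' 0‖ < ‖F c 0‖ + 1}, inter_mem self_mem_nhdsWithin hbd, ?_⟩
    filter_upwards [hlim.eventually (gt_mem_nhds he)] with n hn c' hc'
    rw [hx c' hc'.1, dist_comm]
    refine ((hcon c' hc'.1).apriori_dist_iterate_fixedPoint_le 0 n).trans_lt (lt_of_le_of_lt ?_ hn)
    rw [dist_comm, dist_zero_right]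
    have : ‖F c' 0‖ ≤ ‖F c 0‖ + 1 := le_of_lt hc'.2
    push_cast
    gcongr
  exact hloc.differentiableOn (.of_forall hit) hR

/-! ### A complex Lax-Milgram lemma -/

/-- Coercivity bounds N from below, so it is injective with closed range. A vector orthogonal to the
range pairs to zero with its own image, hence vanishes by coercivity, so the range is everything. -/
theorem isUnit_of_coercive_im {H : Type*} [NormedAddCommGroup H] [InnerProductSpace ℂ H]
    [CompleteSpace H] (N : H →L[ℂ] H) {ν : ℝ} (hν : 0 < ν)
    (hN : ∀ x, ν * ‖x‖ ^ 2 ≤ (inner ℂ x (N x)).im) : IsUnit N := by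
  have hb : ∀ x, ν * ‖x‖ ≤ ‖N x‖ := by
    intro x
    rcases eq_or_ne x 0 with rfl | hx
    · simp
    have h0 : 0 < ‖x‖ := norm_pos_iff.2 hx
    have h1 : ν * ‖x‖ ^ 2 ≤ ‖x‖ * ‖N x‖ :=
      (hN x).trans ((Complex.im_le_norm _).trans (norm_inner_le_norm _ _))
    nlinarith
  have hanti : AntilipschitzWith (ν⁻¹).toNNReal N := by
    refine N.antilipschitz_of_bound fun x => ?_
    rw [Real.coe_toNNReal _ (by positivity), ← div_eq_inv_mul, le_div_iff₀ hν]
    linarith [hb x]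
  have hker : N.ker = ⊥ := LinearMap.ker_eq_bot.2 hanti.injective
  have hclosed : IsClosed (N.range : Set H) := hanti.isClosed_range N.uniformContinuous
  have hrange : N.range = ⊤ := by
    have := hclosed.completeSpace_coe
    rw [← N.range.orthogonal_orthogonal, Submodule.eq_top_iff']
    intro v w hw
    have h0 : inner ℂ w (N w) = 0 := by
      rw [← inner_conj_symm, Submodule.mem_orthogonal _ _ |>.1 hw (N w) ⟨w, rfl⟩, map_zero]
    have h1 := hN w
    rw [h0] at h1
    have h2 : ‖w‖ = 0 := by
      by_contra h
      have : 0 < ‖w‖ ^ 2 := by positivity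
      have := mul_pos hν this
      simp at h1; linarith
    rw [norm_eq_zero.1 h2]
    exact inner_zero_left _
  let e := ContinuousLinearEquiv.ofBijective N hker hrange
  have he : (e : H →L[ℂ] H) = N := by ext x; rfl
  rw [← he]
  exact ⟨ContinuousLinearEquiv.toUnit e, rfl⟩

/-! ### The operator `θ ↦ iνθ - ∫_y^1 e ∫_{-1} θ` -/

/-- The primitive vanishing at `1` with a minus sign: `∫_y^1 h`. -/
def coprimL : HilbertL2 →L[ℂ] (ℝ →ᵇ ℂ) :=
  (ContinuousLinearMap.toSpanSingleton ℂ (1 : ℝ →ᵇ ℂ)) ∘L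
    ((BoundedContinuousFunction.evalCLM ℂ (1 : ℝ)) ∘L primL) - primL

theorem coprimL_apply (h : HilbertL2) (y : ℝ) : coprimL h y = prim h 1 - prim h y := by
  simp [coprimL, primL_apply]

theorem norm_coprimL_le (h : HilbertL2) : ‖coprimL h‖ ≤ 4 * ‖h‖ := by
  refine (BoundedContinuousFunction.norm_le (by positivity)).2 fun y => ?_
  rw [coprimL_apply]
  have h1 := (primL h).norm_coe_le_norm 1
  have h2 := (primL h).norm_coe_le_norm y
  have h3 := norm_primL_le h
  rw [primL_apply] at h1 h2
  linarith [norm_sub_le (prim h 1) (prim h y)]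

theorem inner_eq_integral (f g : HilbertL2) :
    inner ℂ f g = ∫ y, conj (f y) * g y ∂chan := by
  rw [L2.inner_def]
  refine integral_congr_ae (.of_forall fun y => ?_)
  simp [mul_comm]

theorem prim_conj (h : ℝ → ℂ) (y : ℝ) : prim (fun t => conj (h t)) y = conj (prim h y) := by
  unfold prim
  simp only [intervalIntegral, integral_conj, map_sub]

/-- Integration by parts: integration from y to 1 is the adjoint of integration from -1 to y. This
is why p is normalized to vanish at 1 while ω vanishes at -1. -/
theorem inner_coprimL (θ h : HilbertL2) :
    inner ℂ θ (toL2 (coprimL h)) = inner ℂ (toL2 (primL θ)) h := by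
  rw [inner_eq_integral, inner_eq_integral]
  have hc : Integrable (fun y => conj (θ y)) chan :=
    (integrable_coe θ).congr' (by
      exact (Complex.continuous_conj.comp_aestronglyMeasurable (integrable_coe θ).1))
      (.of_forall fun y => by simp)
  have := integral_mul_prim (integrable_coe h) hc
  have e1 : ∫ y, conj (θ y) * (toL2 (coprimL h)) y ∂chan
      = ∫ t, (prim h 1 - prim h t) * conj (θ t) ∂chan := by
    refine integral_congr_ae ?_
    filter_upwards [coeFn_toL2 (coprimL h)] with y hy
    rw [hy, coprimL_apply]; ring
  rw [e1, ← this]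
  refine integral_congr_ae ?_
  filter_upwards [coeFn_toL2 (primL θ)] with y hy
  rw [hy, primL_apply, prim_conj]; ring

/-- The operator `θ ↦ iνθ - ∫_y^1 e ∫_{-1} θ` on `L²(-1,1)`. -/
def viscOp (ν : ℝ) (e : ℝ →ᵇ ℂ) : HilbertL2 →L[ℂ] HilbertL2 :=
  (Complex.I * ν) • ContinuousLinearMap.id ℂ HilbertL2 -
    toL2 ∘L coprimL ∘L toL2 ∘L (ContinuousLinearMap.mul ℂ (ℝ →ᵇ ℂ) e) ∘L primL

theorem viscOp_apply (ν : ℝ) (e : ℝ →ᵇ ℂ) (θ : HilbertL2) :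
    viscOp ν e θ = (Complex.I * ν) • θ - toL2 (coprimL (toL2 (e * primL θ))) := rfl

/-- The pairing is ∫ e|b|², and |b|² is real, so only the constant imaginary part of e survives. -/
theorem inner_toL2_mul_im {e b : ℝ →ᵇ ℂ} {s : ℝ} (he : ∀ y, (e y).im = s) :
    (inner ℂ (toL2 b) (toL2 (e * b))).im = s * l2 b ^ 2 := by
  have h1 : inner ℂ (toL2 b) (toL2 (e * b)) = ∫ y, e y * (‖b y‖ ^ 2 : ℝ) ∂chan := by
    rw [inner_eq_integral]
    refine integral_congr_ae ?_
    filter_upwards [coeFn_toL2 b, coeFn_toL2 (e * b)] with y h1 h2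
    rw [h1, h2, BoundedContinuousFunction.coe_mul, Pi.mul_apply]
    have := Complex.conj_mul' (b y)
    push_cast
    linear_combination e y * this
  have h2 : (l2 b ^ 2 : ℝ) = ∫ y, ‖b y‖ ^ 2 ∂chan := by
    rw [← norm_toL2]
    have h := inner_self_eq_norm_sq_to_K (𝕜 := ℂ) (toL2 b)
    rw [inner_eq_integral] at h
    have h' : ∫ y, conj (toL2 b y) * toL2 b y ∂chan = ((∫ y, ‖b y‖ ^ 2 ∂chan : ℝ) : ℂ) := by
      rw [← integral_complex_ofReal]
      refine integral_congr_ae ?_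
      filter_upwards [coeFn_toL2 b] with y h1
      rw [h1, Complex.conj_mul']; push_cast; rfl
    rw [h'] at h
    exact (Complex.ofReal_injective (by rw [h]; push_cast; rfl)).symm
  have hint : Integrable (fun y => e y * ((‖b y‖ ^ 2 : ℝ) : ℂ)) chan := by
    refine (memL2_bcf (e * (star b * b))).integrable.congr (.of_forall fun y => ?_)
    simp [Complex.conj_mul']
  rw [h1, h2, ← integral_const_mul]
  have := integral_im (𝕜 := ℂ) hint
  simp only [RCLike.im_to_complex] at this
  rw [← this]
  refine integral_congr_ae (.of_forall fun y => ?_)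
  simp only [Complex.im_mul_ofReal, he]

/-- The energy identity. -/
theorem inner_viscOp_im {ν s : ℝ} {e : ℝ →ᵇ ℂ} (he : ∀ y, (e y).im = -s) (θ : HilbertL2) :
    (inner ℂ θ (viscOp ν e θ)).im = ν * ‖θ‖ ^ 2 + s * l2 (primL θ) ^ 2 := by
  rw [viscOp_apply, inner_sub_right, inner_smul_right, inner_coprimL, Complex.sub_im,
    inner_toL2_mul_im he, inner_self_eq_norm_sq_to_K]
  have : (Complex.I * ν * ((‖θ‖ : ℂ)) ^ 2) = ((ν * ‖θ‖ ^ 2 : ℝ) : ℂ) * Complex.I := by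
    push_cast; ring
  simp only [Complex.coe_algebraMap]
  rw [this, Complex.mul_I_im, Complex.ofReal_re]; ring

theorem isUnit_viscOp {ν s : ℝ} (hν : 0 < ν) (hs : 0 ≤ s) {e : ℝ →ᵇ ℂ}
    (he : ∀ y, (e y).im = -s) : IsUnit (viscOp ν e) := by
  refine isUnit_of_coercive_im _ hν fun x => ?_
  rw [inner_viscOp_im he]
  have : 0 ≤ s * l2 (primL x) ^ 2 := by positivity
  linarith

/-- The solution operator. -/
def viscInv (ν : ℝ) (e : ℝ →ᵇ ℂ) : HilbertL2 →L[ℂ] HilbertL2 := Ring.inverse (viscOp ν e)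

theorem viscOp_viscInv {ν s : ℝ} (hν : 0 < ν) (hs : 0 ≤ s) {e : ℝ →ᵇ ℂ}
    (he : ∀ y, (e y).im = -s) (F : HilbertL2) : viscOp ν e (viscInv ν e F) = F := by
  have := Ring.mul_inverse_cancel _ (isUnit_viscOp hν hs he)
  exact congrArg (fun L : HilbertL2 →L[ℂ] HilbertL2 => L F) this

theorem visc_energy {ν s : ℝ} (hν : 0 < ν) (hs : 0 ≤ s) {e : ℝ →ᵇ ℂ}
    (he : ∀ y, (e y).im = -s) (F : HilbertL2) :
    ν * ‖viscInv ν e F‖ ^ 2 + s * l2 (primL (viscInv ν e F)) ^ 2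
      = (inner ℂ (viscInv ν e F) F).im := by
  rw [← inner_viscOp_im he, viscOp_viscInv hν hs he]

theorem norm_viscInv_le {ν s : ℝ} (hν : 0 < ν) (hs : 0 ≤ s) {e : ℝ →ᵇ ℂ}
    (he : ∀ y, (e y).im = -s) (F : HilbertL2) : ν * ‖viscInv ν e F‖ ≤ ‖F‖ := by
  have h := visc_energy hν hs he F
  have h1 := (Complex.im_le_norm _).trans (norm_inner_le_norm (𝕜 := ℂ) (viscInv ν e F) F)
  have h2 : 0 ≤ s * l2 (primL (viscInv ν e F)) ^ 2 := by positivity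
  rcases (norm_nonneg (viscInv ν e F)).eq_or_lt with h0 | h0
  · rw [← h0]; simp
  · nlinarith

/-- The energy identity gives s‖ω‖² ≤ ‖θ‖‖F‖, and ν‖θ‖ ≤ ‖F‖ is inserted. -/
theorem l2_prim_viscInv_le {ν s : ℝ} (hν : 0 < ν) (hs : 0 ≤ s) {e : ℝ →ᵇ ℂ}
    (he : ∀ y, (e y).im = -s) (F : HilbertL2) :
    ν * s * l2 (primL (viscInv ν e F)) ^ 2 ≤ ‖F‖ ^ 2 := by
  have h := visc_energy hν hs he F
  have h1 := (Complex.im_le_norm _).trans (norm_inner_le_norm (𝕜 := ℂ) (viscInv ν e F) F)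
  have h2 : 0 ≤ ν * ‖viscInv ν e F‖ ^ 2 := by positivity
  have h3 := norm_viscInv_le hν hs he F
  have h4 : s * l2 (primL (viscInv ν e F)) ^ 2 ≤ ‖viscInv ν e F‖ * ‖F‖ := by linarith
  have h5 := mul_le_mul_of_nonneg_left h4 hν.le
  have h6 := mul_le_mul_of_nonneg_right h3 (norm_nonneg F)
  nlinarith

/-- For a forcing that is itself a primitive, the right side of the energy identity is the pairing
of W with ω instead of with θ. It is absorbed by the term s‖ω‖², with no power of ν lost; this is
the source of the improved estimate for H¹ forcing. -/
theorem visc_energy_coprim {ν s : ℝ} (hν : 0 < ν) (hs : 0 ≤ s) {e : ℝ →ᵇ ℂ}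
    (he : ∀ y, (e y).im = -s) (W : HilbertL2) :
    let θ := viscInv ν e (-toL2 (coprimL W))
    s * l2 (primL θ) ≤ ‖W‖ ∧ ν * s * ‖θ‖ ^ 2 ≤ ‖W‖ ^ 2 := by
  intro θ
  have h := visc_energy hν hs he (-toL2 (coprimL W))
  change ν * ‖θ‖ ^ 2 + s * l2 (primL θ) ^ 2 = (inner ℂ θ (-toL2 (coprimL W))).im at h
  rw [inner_neg_right, inner_coprimL] at h
  have h1 : (-inner ℂ (toL2 (primL θ)) W).im ≤ l2 (primL θ) * ‖W‖ := by
    refine (Complex.im_le_norm _).trans ?_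
    rw [norm_neg, ← norm_toL2]
    exact norm_inner_le_norm _ _
  have h2 : 0 ≤ ν * ‖θ‖ ^ 2 := by positivity
  have h3 : s * l2 (primL θ) ≤ ‖W‖ := by
    rcases (l2_nonneg (primL θ)).eq_or_lt with h0 | h0
    · rw [← h0]; simp
    · nlinarith
  refine ⟨h3, ?_⟩
  have h4 : 0 ≤ s * l2 (primL θ) ^ 2 := by positivity
  have h5 : ν * ‖θ‖ ^ 2 ≤ l2 (primL θ) * ‖W‖ := by linarith
  have h6 := mul_le_mul_of_nonneg_left h5 hs
  have h7 := mul_le_mul_of_nonneg_right h3 (norm_nonneg W)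
  nlinarith

theorem differentiableAt_viscOp (ν : ℝ) {e : ℂ → (ℝ →ᵇ ℂ)} {c : ℂ}
    (he : DifferentiableAt ℂ e c) : DifferentiableAt ℂ (fun c => viscOp ν (e c)) c := by
  have h1 : DifferentiableAt ℂ (fun c => ContinuousLinearMap.mul ℂ (ℝ →ᵇ ℂ) (e c)) c :=
    (ContinuousLinearMap.mul ℂ (ℝ →ᵇ ℂ)).differentiableAt.comp c he
  unfold viscOp
  refine (differentiableAt_const _).sub ?_
  refine DifferentiableAt.clm_comp (differentiableAt_const _) ?_
  refine DifferentiableAt.clm_comp (differentiableAt_const _) ?_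
  refine DifferentiableAt.clm_comp (differentiableAt_const _) ?_
  exact DifferentiableAt.clm_comp h1 (differentiableAt_const _)

theorem differentiableAt_viscInv {ν s : ℝ} (hν : 0 < ν) (hs : 0 ≤ s) {e : ℂ → (ℝ →ᵇ ℂ)} {c : ℂ}
    (he : DifferentiableAt ℂ e c) (hi : ∀ y, (e c y).im = -s) :
    DifferentiableAt ℂ (fun c => viscInv ν (e c)) c := by
  obtain ⟨u, hu⟩ := isUnit_viscOp hν hs hi
  have h2 : DifferentiableAt ℂ Ring.inverse (viscOp ν (e c)) := by
    rw [← hu]; exact differentiableAt_inverse u.isUnit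
  exact h2.comp c (differentiableAt_viscOp ν he)

end

/-! ### The viscous vorticity and the inviscid pressure problem. -/

section

theorem isUnit_bcf {b : ℝ →ᵇ ℂ} {κ : ℝ} (hκ : 0 < κ) (hb : ∀ y, κ ≤ ‖b y‖) : IsUnit b := by
  have h0 : ∀ y, b y ≠ 0 := fun y h => by have := hb y; rw [h, norm_zero] at this; linarith
  let i : ℝ →ᵇ ℂ := BoundedContinuousFunction.ofNormedAddCommGroup (fun y => (b y)⁻¹)
    (b.continuous.inv₀ h0) κ⁻¹ (fun y => by rw [norm_inv]; exact inv_anti₀ hκ (hb y))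
  refine IsUnit.of_mul_eq_one i ?_
  ext y
  simp [i, h0 y]

theorem inverse_bcf_apply {b : ℝ →ᵇ ℂ} (hb : IsUnit b) (y : ℝ) :
    Ring.inverse b y = (b y)⁻¹ := by
  have h := congrArg (fun f : ℝ →ᵇ ℂ => f y) (Ring.mul_inverse_cancel _ hb)
  simp only [BoundedContinuousFunction.coe_mul, Pi.mul_apply, BoundedContinuousFunction.coe_one,
    Pi.one_apply] at h
  exact eq_inv_of_mul_eq_one_right h

/-- The profile, its derivatives and an affine function `L` with derivative `L1`, as bounded
continuous functions extended from `[-1,1]`. -/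
structure Background where
  U : ℝ →ᵇ ℂ
  U1 : ℝ →ᵇ ℂ
  U2 : ℝ →ᵇ ℂ
  U3 : ℝ →ᵇ ℂ
  L : ℝ →ᵇ ℂ
  L1 : ℝ →ᵇ ℂ

/-- The compatibility conditions of a `Background`. -/
structure Background.Valid (B : Background) : Prop where
  real : ∀ y, (B.U y).im = 0
  dU : ∀ y ∈ Ioo (-1 : ℝ) 1, HasDerivAt B.U (B.U1 y) y
  dU1 : ∀ y ∈ Ioo (-1 : ℝ) 1, HasDerivAt B.U1 (B.U2 y) y
  dU2 : ∀ y ∈ Ioo (-1 : ℝ) 1, HasDerivAt B.U2 (B.U3 y) y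
  dL : ∀ y ∈ Ioo (-1 : ℝ) 1, HasDerivAt B.L (B.L1 y) y
  smoothU : ContDiffOn ℝ ∞ B.U (Ioo (-1) 1)
  smoothU1 : ContDiffOn ℝ ∞ B.U1 (Ioo (-1) 1)
  U_left : B.U (-1) = 0
  U_right : B.U 1 = 0
  L_left : B.L (-1) * B.U1 (-1) = 1
  L_right : B.L 1 * B.U1 1 = 1

/-- The parameters of the system. -/
structure Params where
  m : ℝ
  lam : ℝ
  ε : ℝ
  k : ℝ

variable (B : Background) (P : Params) (c : ℂ)

/-- `U - c`. -/
def ee : ℝ →ᵇ ℂ := B.U - c • 1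
/-- `(U - c)⁻¹`. -/
def ei : ℝ →ᵇ ℂ := Ring.inverse (ee B c)
/-- `A = 1 - m² (U-c)²`. -/
def AA : ℝ →ᵇ ℂ := 1 - ((P.m : ℂ) ^ 2) • (ee B c) ^ 2
/-- `A⁻¹`. -/
def Ai : ℝ →ᵇ ℂ := Ring.inverse (AA B P c)
/-- `A'`. -/
def dA : ℝ →ᵇ ℂ := -((2 * (P.m : ℂ) ^ 2) • (ee B c * B.U1))
/-- The value of `A` at the walls. -/
def Ab : ℂ := 1 - (P.m : ℂ) ^ 2 * c ^ 2
-- The coefficients of q and q' that remain when Aq/e² is written as (-ALq/e)' plus a remainder. As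
-- LU' = 1 at the walls, the part of `n1` with e⁻² carries a factor 1 - LU' that compensates one
-- power of e.
def n1 : ℝ →ᵇ ℂ :=
  (dA B P c * B.L + AA B P c * B.L1) * ei B c + AA B P c * (1 - B.L * B.U1) * ei B c ^ 2
def n2 : ℝ →ᵇ ℂ := AA B P c * B.L * ei B c
/-- The inviscid dispersion function. -/
def disp : ℂ := c * (B.U1 (-1) - B.U1 1) - (P.k : ℂ) ^ 2 * Ab P c * prim (ee B c ^ 2 : ℝ →ᵇ ℂ) 1

/-- The derivative of the viscous vorticity. -/
def th (F : HilbertL2) : HilbertL2 := viscInv (P.ε / P.k) (ee B c) F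
/-- The viscous vorticity. -/
def om (F : HilbertL2) : ℝ →ᵇ ℂ := primL (th B P c F)
/-- The pressure generated by the viscous vorticity. -/
def pp (F : HilbertL2) : ℝ →ᵇ ℂ := coprimL (toL2 (ee B c * om B P c F))
-- The contribution of the viscous pressure p to Φ, obtained by integrating Ap/e² directly.
def Ph (F : HilbertL2) : ℝ →ᵇ ℂ := primL (toL2 (AA B P c * ei B c ^ 2 * pp B P c F))

/-- The derivative of the inviscid pressure. -/
def rr (γ : ℂ) (σ : ℝ →ᵇ ℂ) : ℝ →ᵇ ℂ := ((P.k : ℂ) ^ 2) • (σ - (Ab P c * γ) • ee B c ^ 2)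
/-- The inviscid pressure. -/
def qq (γ : ℂ) (σ : ℝ →ᵇ ℂ) : ℝ →ᵇ ℂ :=
  (c * γ * B.U1 (-1)) • 1 + primL (toL2 (rr B P c γ σ))
-- The remainder of the integration by parts for q. With `SS`, the unknown σ represents e²(Φ +
-- A(±1)γ), the deviation of e²Φ from its leading profile.
def RR (γ : ℂ) (σ : ℝ →ᵇ ℂ) : ℝ →ᵇ ℂ :=
  primL (toL2 (n1 B P c * qq B P c γ σ + n2 B P c * rr B P c γ σ))
def SS (γ : ℂ) (σ : ℝ →ᵇ ℂ) : ℝ →ᵇ ℂ :=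
  AA B P c * B.L * qq B P c γ σ - ee B c * RR B P c γ σ
/-- The quotient `-Ψ/(U-c)` of the stream function. -/
def Phi (F : HilbertL2) (γ : ℂ) (σ : ℝ →ᵇ ℂ) : ℝ →ᵇ ℂ :=
  -((Ab P c * γ) • 1) - AA B P c * B.L * qq B P c γ σ * ei B c + RR B P c γ σ + Ph B P c F

/-- The right-hand side of the equation for `γ`. -/
def newγ (F : HilbertL2) (γ : ℂ) (σ : ℝ →ᵇ ℂ) : ℂ :=
  (disp B P c)⁻¹ * ((P.k : ℂ) ^ 2 *
      primL (toL2 (ee B c * SS B P c γ σ - ee B c ^ 2 * Ph B P c F)) 1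
    - c * B.U1 1 * (Ab P c)⁻¹ * (RR B P c γ σ 1 + Ph B P c F 1))
/-- The right-hand side of the equation for `σ`. -/
def newσ (F : HilbertL2) (γ : ℂ) (σ : ℝ →ᵇ ℂ) : ℝ →ᵇ ℂ :=
  ee B c ^ 2 * Ph B P c F - ee B c * SS B P c γ σ

/-- Invertibility of all the coefficients. -/
structure Nondeg : Prop where
  valid : B.Valid
  ε_pos : 0 < P.ε
  k_pos : 0 < P.k
  im_pos : 0 < c.im
  m_pos : 0 < P.m
  A_unit : IsUnit (AA B P c)
  Ab_ne : Ab P c ≠ 0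
  disp_ne : disp B P c ≠ 0

variable {B P c}

theorem ee_apply (y : ℝ) : ee B c y = B.U y - c := by simp [ee]

theorem AA_apply (y : ℝ) : AA B P c y = 1 - (P.m : ℂ) ^ 2 * (ee B c y) ^ 2 := by simp [AA]

theorem dA_apply (y : ℝ) : dA B P c y = -(2 * (P.m : ℂ) ^ 2 * (ee B c y * B.U1 y)) := by simp [dA]

theorem ee_im (hB : B.Valid) (y : ℝ) : (ee B c y).im = -c.im := by
  rw [ee_apply, Complex.sub_im, hB.real, zero_sub]

namespace Nondeg

variable (h : Nondeg B P c)
include h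

theorem norm_ee (y : ℝ) : c.im ≤ ‖ee B c y‖ := by
  have := Complex.abs_im_le_norm (ee B c y)
  rw [ee_im h.valid, abs_neg, abs_of_pos h.im_pos] at this
  exact this

theorem ee_ne (y : ℝ) : ee B c y ≠ 0 := fun h0 => by
  have := h.norm_ee y
  rw [h0, norm_zero] at this
  linarith [h.im_pos]

theorem ee_unit : IsUnit (ee B c) := isUnit_bcf h.im_pos h.norm_ee

theorem ei_apply (y : ℝ) : ei B c y = (ee B c y)⁻¹ := inverse_bcf_apply h.ee_unit y

theorem AA_ne (y : ℝ) : AA B P c y ≠ 0 := by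
  have h1 := congrArg (fun f : ℝ →ᵇ ℂ => f y) (Ring.mul_inverse_cancel _ h.A_unit)
  intro h0
  simp [h0] at h1

theorem Ai_apply (y : ℝ) : Ai B P c y = (AA B P c y)⁻¹ := inverse_bcf_apply h.A_unit y

theorem ν_pos : 0 < P.ε / P.k := div_pos h.ε_pos h.k_pos

/-- Read as p = iνθ - F, this estimates p without integrating eω, and it eliminates F from the
momentum equation. -/
theorem visc_eq (F : HilbertL2) :
    ∀ᵐ y ∂chan, Complex.I * ((P.ε / P.k : ℝ) : ℂ) * th B P c F y = F y + pp B P c F y := by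
  have h1 : viscOp (P.ε / P.k) (ee B c) (th B P c F) = F :=
    viscOp_viscInv h.ν_pos h.im_pos.le (ee_im h.valid) F
  rw [viscOp_apply, sub_eq_iff_eq_add] at h1
  have h2 := Lp.coeFn_smul (Complex.I * ((P.ε / P.k : ℝ) : ℂ)) (th B P c F)
  have h3 := Lp.coeFn_add F (toL2 (coprimL (toL2 (ee B c * primL (th B P c F)))))
  have h4 := coeFn_toL2 (coprimL (toL2 (ee B c * primL (th B P c F))))
  rw [h1] at h2
  filter_upwards [h2, h3, h4] with y h2 h3 h4
  rw [h3, Pi.add_apply, h4, Pi.smul_apply, smul_eq_mul] at h2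
  exact h2.symm

end Nondeg

theorem hasDerivAt_pp (F : HilbertL2) {y : ℝ} (hy : y ∈ Ioo (-1 : ℝ) 1) :
    HasDerivAt (pp B P c F) (-(ee B c y * om B P c F y)) y := by
  have h1 := hasDerivAt_prim (ee B c * om B P c F) hy
  have h2 : ⇑(pp B P c F) = fun y => prim (ee B c * om B P c F : ℝ →ᵇ ℂ) 1
      - prim (ee B c * om B P c F : ℝ →ᵇ ℂ) y := by
    funext y
    rw [pp, coprimL_apply, prim_congr (coeFn_toL2 _)]
  rw [h2]
  simpa using h1.const_sub _

theorem hasDerivAt_primL_toL2 (b : ℝ →ᵇ ℂ) {y : ℝ} (hy : y ∈ Ioo (-1 : ℝ) 1) :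
    HasDerivAt (primL (toL2 b)) (b y) y := by
  have h2 : ⇑(primL (toL2 b)) = prim b := funext fun y => primL_toL2_apply b y
  rw [h2]; exact hasDerivAt_prim b hy

theorem qq_apply (γ : ℂ) (σ : ℝ →ᵇ ℂ) (y : ℝ) :
    qq B P c γ σ y = c * γ * B.U1 (-1) + primL (toL2 (rr B P c γ σ)) y := by
  simp [qq]

theorem hasDerivAt_qq (γ : ℂ) (σ : ℝ →ᵇ ℂ) {y : ℝ} (hy : y ∈ Ioo (-1 : ℝ) 1) :
    HasDerivAt (qq B P c γ σ) (rr B P c γ σ y) y := by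
  have h2 : ⇑(qq B P c γ σ) = fun y => c * γ * B.U1 (-1) + primL (toL2 (rr B P c γ σ)) y :=
    funext fun y => qq_apply γ σ y
  rw [h2]
  exact (hasDerivAt_primL_toL2 _ hy).const_add _

theorem hasDerivAt_ee (hB : B.Valid) {y : ℝ} (hy : y ∈ Ioo (-1 : ℝ) 1) :
    HasDerivAt (ee B c) (B.U1 y) y := by
  have h2 : ⇑(ee B c) = fun y => B.U y - c := funext ee_apply
  rw [h2]
  exact (hB.dU y hy).sub_const c

theorem hasDerivAt_AA (hB : B.Valid) {y : ℝ} (hy : y ∈ Ioo (-1 : ℝ) 1) :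
    HasDerivAt (AA B P c) (dA B P c y) y := by
  have h2 : ⇑(AA B P c) = fun y => 1 - (P.m : ℂ) ^ 2 * (ee B c y) ^ 2 := funext AA_apply
  rw [h2, dA_apply]
  refine ((((hasDerivAt_ee hB hy).fun_pow 2).const_mul ((P.m : ℂ) ^ 2)).const_sub 1).congr_deriv ?_
  norm_num
  ring

theorem Phi_apply (F : HilbertL2) (γ : ℂ) (σ : ℝ →ᵇ ℂ) (y : ℝ) :
    Phi B P c F γ σ y = -(Ab P c * γ) - AA B P c y * B.L y * qq B P c γ σ y * ei B c y
      + RR B P c γ σ y + Ph B P c F y := by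
  simp [Phi]

namespace Nondeg

variable (h : Nondeg B P c)
include h

/-- The derivative of the wall term -ALq/e and the integrand of `RR` combine to Aq/e², for whatever
values γ and σ take; the equations for γ and σ are needed only for q' and for the right wall. -/
theorem hasDerivAt_Phi (F : HilbertL2) (γ : ℂ) (σ : ℝ →ᵇ ℂ) {y : ℝ} (hy : y ∈ Ioo (-1 : ℝ) 1) :
    HasDerivAt (Phi B P c F γ σ)
      (AA B P c y * (qq B P c γ σ y + pp B P c F y) * ei B c y ^ 2) y := by
  have h2 : ⇑(Phi B P c F γ σ) = fun y => -(Ab P c * γ)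
      - AA B P c y * B.L y * qq B P c γ σ y * (ee B c y)⁻¹
      + RR B P c γ σ y + Ph B P c F y := by
    funext y; rw [Phi_apply, h.ei_apply]
  rw [h2, h.ei_apply]
  have d1 := hasDerivAt_AA (P := P) (c := c) h.valid hy
  have d2 := h.valid.dL y hy
  have d3 := hasDerivAt_qq (B := B) (P := P) (c := c) γ σ hy
  have d4 := (hasDerivAt_ee (c := c) h.valid hy).inv (h.ee_ne y)
  have d5 := hasDerivAt_primL_toL2 (n1 B P c * qq B P c γ σ + n2 B P c * rr B P c γ σ) hy
  have d6 := hasDerivAt_primL_toL2 (AA B P c * ei B c ^ 2 * pp B P c F) hy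
  have d := (((((d1.mul d2).mul d3).mul d4).const_sub (-(Ab P c * γ))).add d5).add d6
  refine d.congr_deriv ?_
  have hy0 := h.ee_ne y
  simp only [BoundedContinuousFunction.coe_add, BoundedContinuousFunction.coe_mul, Pi.add_apply,
    Pi.mul_apply, BoundedContinuousFunction.coe_pow, Pi.pow_apply, n1, n2,
    BoundedContinuousFunction.coe_sub, Pi.sub_apply, BoundedContinuousFunction.coe_one,
    Pi.one_apply, Pi.inv_apply, h.ei_apply]
  field_simp
  ring

theorem AA_left : AA B P c (-1) = Ab P c := by
  rw [AA_apply, ee_apply, h.valid.U_left, Ab]; ring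

theorem AA_right : AA B P c 1 = Ab P c := by
  rw [AA_apply, ee_apply, h.valid.U_right, Ab]; ring

theorem c_ne : c ≠ 0 := by
  intro h0; have := h.im_pos; rw [h0] at this; simp at this

/-- Built into the normalization q(-1) = cγU'(-1): at the left wall e = -c and LU' = 1, so the wall
term cancels the constant. -/
theorem Phi_left (F : HilbertL2) (γ : ℂ) (σ : ℝ →ᵇ ℂ) : Phi B P c F γ σ (-1) = 0 := by
  rw [Phi_apply, h.AA_left, h.ei_apply, ee_apply, h.valid.U_left, qq_apply, RR, Ph]
  simp only [primL_apply, prim_neg_one]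
  have := h.c_ne
  have := h.valid.L_left
  field_simp
  linear_combination -(c * Ab P c * γ) * this

/-- Here q(1) = q(-1) + ∫q', and inserting the equation for σ in ∫q' produces the k² term of `disp`.
The vanishing of Φ(1) is then the scalar equation for γ multiplied by a nonzero factor. -/
theorem Phi_right {F : HilbertL2} {γ : ℂ} {σ : ℝ →ᵇ ℂ} (hγ : newγ B P c F γ σ = γ)
    (hσ : newσ B P c F γ σ = σ) : Phi B P c F γ σ 1 = 0 := by
  have hD := h.disp_ne
  have hA := h.Ab_ne
  have hc := h.c_ne
  have hL := h.valid.L_right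
  rw [Phi_apply, h.AA_right, h.ei_apply, ee_apply, h.valid.U_right]
  have e1 : primL (toL2 (rr B P c γ σ)) 1 = -(P.k : ℂ) ^ 2 *
      (primL (toL2 (ee B c * SS B P c γ σ - ee B c ^ 2 * Ph B P c F)) 1
        + Ab P c * γ * prim (ee B c ^ 2 : ℝ →ᵇ ℂ) 1) := by
    have : rr B P c γ σ = (-(P.k : ℂ) ^ 2) • ((ee B c * SS B P c γ σ - ee B c ^ 2 * Ph B P c F)
        + (Ab P c * γ) • ee B c ^ 2) := by
      conv_lhs => rw [rr, ← hσ, newσ]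
      ext y; simp; ring
    rw [this, map_smul, map_smul, map_add, map_add, map_smul, map_smul, ← primL_toL2_apply]
    simp only [BoundedContinuousFunction.coe_smul, BoundedContinuousFunction.coe_add,
      Pi.add_apply, smul_eq_mul]
  have hγ' : disp B P c * γ = (P.k : ℂ) ^ 2 *
      primL (toL2 (ee B c * SS B P c γ σ - ee B c ^ 2 * Ph B P c F)) 1
    - c * B.U1 1 * (Ab P c)⁻¹ * (RR B P c γ σ 1 + Ph B P c F 1) := by
    conv_lhs => rw [← hγ, newγ]
    rw [mul_inv_cancel_left₀ hD]
  rw [disp] at hγ'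
  have hL0 : B.L 1 ≠ 0 := left_ne_zero_of_mul_eq_one hL
  have hU0 : B.U1 1 ≠ 0 := right_ne_zero_of_mul_eq_one hL
  have hLe : B.L 1 = (B.U1 1)⁻¹ := eq_inv_of_mul_eq_one_left hL
  rw [qq_apply, e1, hLe]
  field_simp at hγ' ⊢
  linear_combination -hγ'

/-- The second equation q' = k²e²Φ of the inviscid system; the fixed point equation for σ is a
rewriting of it. -/
theorem rr_eq {F : HilbertL2} {γ : ℂ} {σ : ℝ →ᵇ ℂ} (hσ : newσ B P c F γ σ = σ) (y : ℝ) :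
    rr B P c γ σ y = (P.k : ℂ) ^ 2 * (ee B c y) ^ 2 * Phi B P c F γ σ y := by
  conv_lhs => rw [rr, ← hσ, newσ]
  rw [Phi_apply, h.ei_apply]
  have := h.ee_ne y
  simp [SS]
  field_simp
  ring

end Nondeg

end

/-! ### Assembly of the fields and identification of the residual. -/

section

theorem smooth_ee {B : Background} (hB : B.Valid) (c : ℂ) :
    ContDiffOn ℝ ∞ (ee B c) (Ioo (-1) 1) := by
  have h2 : ⇑(ee B c) = fun y => B.U y - c := funext ee_apply
  rw [h2]
  exact hB.smoothU.sub contDiffOn_const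

theorem smooth_AA {B : Background} (hB : B.Valid) (P : Params) (c : ℂ) :
    ContDiffOn ℝ ∞ (AA B P c) (Ioo (-1) 1) := by
  have h2 : ⇑(AA B P c) = fun y => 1 - (P.m : ℂ) ^ 2 * (ee B c y) ^ 2 := funext AA_apply
  rw [h2]
  exact contDiffOn_const.sub (contDiffOn_const.mul ((smooth_ee hB c).pow 2))

/-- The unknowns: forcing `F` of the viscous vorticity, amplitude `γ` and remainder `σ` of the
inviscid part, a pressure `α + ∫ g0` with `g0' = g1`, and the forcing `gt` absorbed by a hydrostatic
pressure. -/
structure Unknowns where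
  F : HilbertL2
  γ : ℂ
  σ : ℝ →ᵇ ℂ
  α : ℂ
  g0 : HilbertL2
  g1 : HilbertL2
  gt : HilbertL2

variable (B : Background) (P : Params) (c : ℂ) (X : Unknowns)

def ΦΦ : ℝ →ᵇ ℂ := Phi B P c X.F X.γ X.σ
def qX : ℝ →ᵇ ℂ := qq B P c X.γ X.σ
/-- The total pressure driving the inviscid flow. -/
def qp : ℝ →ᵇ ℂ := qX B P c X + pp B P c X.F
def oX : ℝ →ᵇ ℂ := om B P c X.F
def Φ1 : ℝ →ᵇ ℂ := AA B P c * qp B P c X * ei B c ^ 2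
def ρ0 : ℝ →ᵇ ℂ := X.α • 1 + primL X.g0
def Gt : ℝ →ᵇ ℂ := primL X.gt
-- A uniform tangential flow whose flux balances the mass produced by the hydrostatic pressure; the
-- factor 1/2 is the inverse length of the interval. It is what makes `vr` vanish at the right wall.
def μμ : ℂ := -(1 / 2 * (P.m : ℂ) ^ 2 * primL (toL2 (ee B c * Gt X)) 1)
/-- The derivative of the stream function. -/
def Psi1 : ℝ →ᵇ ℂ := -(B.U1 * ΦΦ B P c X) - AA B P c * qp B P c X * ei B c
/-- The second derivative of the stream function. -/
def Psi2 : ℝ →ᵇ ℂ := -(B.U2 * ΦΦ B P c X) + (2 * (P.m : ℂ) ^ 2) • (B.U1 * qp B P c X)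
  - ((P.k : ℂ) ^ 2) • (AA B P c * ee B c * ΦΦ B P c X) + AA B P c * oX B P c X
/-- The third derivative of the stream function without its top order part. -/
def Z0 : ℝ →ᵇ ℂ := -(B.U3 * ΦΦ B P c X) - B.U2 * Φ1 B P c X
  + (2 * (P.m : ℂ) ^ 2) • (B.U2 * qp B P c X)
  + (2 * (P.m : ℂ) ^ 2) • (B.U1 * (((P.k : ℂ) ^ 2) • (ee B c ^ 2 * ΦΦ B P c X)
      - ee B c * oX B P c X))
  - ((P.k : ℂ) ^ 2) • ((dA B P c * ee B c + AA B P c * B.U1) * ΦΦ B P c X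
      + AA B P c * ee B c * Φ1 B P c X)
  + dA B P c * oX B P c X
/-- The continuous part of `(e (q + ρ0))''`. -/
def X2 : ℝ →ᵇ ℂ := B.U2 * (qX B P c X + ρ0 X)
  + ((P.k : ℂ) ^ 2) • (4 • (B.U1 * ee B c ^ 2 * ΦΦ B P c X) + ee B c ^ 3 * Φ1 B P c X)

/-- The density. -/
def solρ : ℝ →ᵇ ℂ := ((P.m : ℂ) ^ 2) • (qX B P c X + ρ0 X + Gt X)
/-- The tangential velocity. -/
def solu : ℝ →ᵇ ℂ := Psi1 B P c X - ((P.m : ℂ) ^ 2) • (ee B c * (qX B P c X + ρ0 X)) + μμ B P c X • 1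
-- The normal velocity that restores the mass equation for the hydrostatic pressure. The remaining
-- pressure is balanced inside the tangential velocity, so that the mass equation holds exactly.
def vr : ℝ →ᵇ ℂ := -((Complex.I * P.k) •
  primL (toL2 (μμ B P c X • 1 + ((P.m : ℂ) ^ 2) • (ee B c * Gt X))))
/-- The normal velocity. -/
def solv : ℝ →ᵇ ℂ := (Complex.I * P.k) • (ee B c * ΦΦ B P c X) + vr B P c X

def solρ' (y : ℝ) : ℂ :=
  (P.m : ℂ) ^ 2 * ((P.k : ℂ) ^ 2 * ee B c y ^ 2 * ΦΦ B P c X y + X.g0 y + X.gt y)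
def solu' (y : ℝ) : ℂ := Psi2 B P c X y - (P.m : ℂ) ^ 2 * (B.U1 y * (qX B P c X y + ρ0 X y)
  + ee B c y * ((P.k : ℂ) ^ 2 * ee B c y ^ 2 * ΦΦ B P c X y + X.g0 y))
def solu'' (y : ℝ) : ℂ := AA B P c y * th B P c X.F y + Z0 B P c X y
  - (P.m : ℂ) ^ 2 * (X2 B P c X y + 2 * B.U1 y * X.g0 y + ee B c y * X.g1 y)
def solv' : ℝ →ᵇ ℂ := -((Complex.I * P.k) • (Psi1 B P c X + μμ B P c X • 1
  + ((P.m : ℂ) ^ 2) • (ee B c * Gt X)))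
def solv'' (y : ℝ) : ℂ := -(Complex.I * P.k * (Psi2 B P c X y
  + (P.m : ℂ) ^ 2 * (B.U1 y * Gt X y + ee B c y * X.gt y)))

/-- The continuous part of the residual of the tangential momentum equation. -/
def Eub : ℝ →ᵇ ℂ := (P.ε : ℂ) • (-Z0 B P c X + ((P.k : ℂ) ^ 2) • Psi1 B P c X
    + ((P.m : ℂ) ^ 2) • (X2 B P c X - ((P.k : ℂ) ^ 2 * (1 + P.lam)) • (ee B c * (qX B P c X + ρ0 X))
      + B.U2 * (qX B P c X + ρ0 X)))
  + (P.ε * (P.k : ℂ) ^ 2 * μμ B P c X) • 1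
  - (P.lam * P.ε * (P.k : ℂ) ^ 2 * (P.m : ℂ) ^ 2) • (ee B c * Gt X)
  + (Complex.I * P.k * μμ B P c X) • ee B c + (Complex.I * P.k) • Gt X
  + (P.ε * (P.m : ℂ) ^ 2) • (B.U2 * Gt X) + vr B P c X * B.U1
/-- The square integrable part of the residual of the tangential momentum equation. -/
def EuH : HilbertL2 := (P.ε * (P.m : ℂ) ^ 2) • ((2 : ℂ) • mulL2 B.U1 X.g0 + mulL2 (ee B c) X.g1)
/-- The continuous part of the residual of the normal momentum equation. -/
def Evb : ℝ →ᵇ ℂ := (Complex.I * P.k * P.ε) • (Psi2 B P c X + ((P.m : ℂ) ^ 2) • (B.U1 * Gt X))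
  + (P.ε * (P.k : ℂ) ^ 2) • solv B P c X
  + (P.lam * Complex.I * P.k * P.ε) • (B.U1 * solρ B P c X
      + ((P.m : ℂ) ^ 2 * (P.k : ℂ) ^ 2) • (ee B c ^ 3 * ΦΦ B P c X))
  + (Complex.I * P.k) • (ee B c * vr B P c X)
/-- The square integrable part of the residual of the normal momentum equation. -/
def EvH : HilbertL2 := (Complex.I * P.k * P.ε * (P.m : ℂ) ^ 2) •
  mulL2 (ee B c) ((1 + P.lam : ℂ) • X.gt + (P.lam : ℂ) • X.g0)

variable {B P c X}

/-- The equations for the inviscid part, and compatibility of the data. -/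
structure Unknowns.Solves (B : Background) (P : Params) (c : ℂ) (X : Unknowns) : Prop where
  nondeg : Nondeg B P c
  eqγ : newγ B P c X.F X.γ X.σ = X.γ
  eqσ : newσ B P c X.F X.γ X.σ = X.σ
  weak_g : HasWeakDeriv X.g0 X.g1

theorem wd_ρ0 (X : Unknowns) : HasWeakDeriv (ρ0 X) X.g0 :=
  (hasWeakDeriv_prim (integrable_coe X.g0) X.α).congr
    (.of_forall fun y => by simp [ρ0, primL_apply]) (ae_eq_refl _)

theorem wd_Gt (X : Unknowns) : HasWeakDeriv (Gt X) X.gt :=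
  (hasWeakDeriv_prim (integrable_coe X.gt) 0).congr
    (.of_forall fun y => by simp [Gt, primL_apply]) (ae_eq_refl _)

theorem vr_left : vr B P c X (-1) = 0 := by
  simp [vr, primL_apply, prim_neg_one]

theorem vr_right : vr B P c X 1 = 0 := by
  have h1 : primL (toL2 1) 1 = 2 := by
    rw [primL_toL2_apply, prim_one]
    simp [Measure.real, chan_univ]
  rw [vr, map_add, map_add, map_smul, map_smul, map_smul, map_smul]
  simp only [BoundedContinuousFunction.coe_neg, Pi.neg_apply, BoundedContinuousFunction.coe_smul,
    BoundedContinuousFunction.coe_add, Pi.add_apply, smul_eq_mul, h1, μμ]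
  ring

theorem memL2_mul (b : ℝ →ᵇ ℂ) (g : HilbertL2) : MemL2 (fun y => b y * g y) :=
  (memL2_coe (mulL2 b g)).congr (coeFn_mulL2 b g)

namespace Unknowns.Solves

variable (h : X.Solves B P c)
include h

theorem d_q {y : ℝ} (hy : y ∈ Ioo (-1 : ℝ) 1) :
    HasDerivAt (qX B P c X) ((P.k : ℂ) ^ 2 * ee B c y ^ 2 * ΦΦ B P c X y) y := by
  rw [ΦΦ, ← h.nondeg.rr_eq h.eqσ]
  exact hasDerivAt_qq _ _ hy

theorem d_qp {y : ℝ} (hy : y ∈ Ioo (-1 : ℝ) 1) :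
    HasDerivAt (qp B P c X)
      ((P.k : ℂ) ^ 2 * ee B c y ^ 2 * ΦΦ B P c X y - ee B c y * oX B P c X y) y := by
  have := (h.d_q hy).add (hasDerivAt_pp (B := B) (P := P) (c := c) X.F hy)
  rw [← sub_eq_add_neg] at this
  exact this

theorem d_Φ {y : ℝ} (hy : y ∈ Ioo (-1 : ℝ) 1) :
    HasDerivAt (ΦΦ B P c X) (Φ1 B P c X y) y := h.nondeg.hasDerivAt_Phi _ _ _ hy

theorem d_e {y : ℝ} (hy : y ∈ Ioo (-1 : ℝ) 1) : HasDerivAt (ee B c) (B.U1 y) y :=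
  hasDerivAt_ee h.nondeg.valid hy

theorem d_A {y : ℝ} (hy : y ∈ Ioo (-1 : ℝ) 1) : HasDerivAt (AA B P c) (dA B P c y) y :=
  hasDerivAt_AA h.nondeg.valid hy

/-- All inverse powers of e cancel: the two terms U'A(q+p)/e² have opposite signs, A' = -2m²eU'
removes one 1/e, and (q+p)' = e(k²eΦ - ω) removes the other. This leaves Aω as the main viscous
term. -/
theorem d_Psi1 {y : ℝ} (hy : y ∈ Ioo (-1 : ℝ) 1) :
    HasDerivAt (Psi1 B P c X) (Psi2 B P c X y) y := by
  have h2 : ⇑(Psi1 B P c X) = fun y => -(B.U1 y * ΦΦ B P c X y)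
      - AA B P c y * qp B P c X y * (ee B c y)⁻¹ := by
    funext y; simp [Psi1, h.nondeg.ei_apply]
  rw [h2]
  have hy0 := h.nondeg.ee_ne y
  have d := ((h.nondeg.valid.dU1 y hy).mul (h.d_Φ hy)).neg.sub
    (((h.d_A hy).mul (h.d_qp hy)).mul ((h.d_e hy).inv hy0))
  refine d.congr_deriv ?_
  simp only [Psi2, Φ1, BoundedContinuousFunction.coe_add, BoundedContinuousFunction.coe_mul,
    Pi.add_apply, Pi.mul_apply, BoundedContinuousFunction.coe_pow, Pi.pow_apply,
    BoundedContinuousFunction.coe_sub, Pi.sub_apply, Pi.inv_apply, h.nondeg.ei_apply,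
    BoundedContinuousFunction.coe_neg, Pi.neg_apply, BoundedContinuousFunction.coe_smul,
    smul_eq_mul, dA_apply]
  field_simp
  ring

/-- The derivative of the classical part of `Psi2`. -/
theorem wd_Psi2 : HasWeakDeriv (Psi2 B P c X)
    (fun y => AA B P c y * th B P c X.F y + Z0 B P c X y) := by
  have w1 : HasWeakDeriv (oX B P c X) (th B P c X.F) :=
    (hasWeakDeriv_prim (integrable_coe (th B P c X.F)) 0).congr
      (.of_forall fun y => by simp [oX, om, primL_apply]) (ae_eq_refl _)
  have w2 := w1.smooth_mul (smooth_AA h.nondeg.valid P c) (fun y hy => h.d_A hy)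
  -- Only ω lacks a classical derivative; the product Aω is split off and the rest is differentiated
  -- pointwise.
  have w3 : HasWeakDeriv (Psi2 B P c X - AA B P c * oX B P c X : ℝ →ᵇ ℂ)
      (Z0 B P c X - dA B P c * oX B P c X : ℝ →ᵇ ℂ) := by
    refine hasWeakDeriv_of_hasDerivAt _ (BoundedContinuousFunction.continuous _).continuousOn ?_
    intro y hy
    have h2 : ⇑(Psi2 B P c X - AA B P c * oX B P c X : ℝ →ᵇ ℂ) = fun y =>
        -(B.U2 y * ΦΦ B P c X y) + (2 * (P.m : ℂ) ^ 2) * (B.U1 y * qp B P c X y)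
        - ((P.k : ℂ) ^ 2) * (AA B P c y * ee B c y * ΦΦ B P c X y) := by
      funext y; simp [Psi2]
    rw [h2]
    have d := (((h.nondeg.valid.dU2 y hy).mul (h.d_Φ hy)).neg.add
      (((h.nondeg.valid.dU1 y hy).mul (h.d_qp hy)).const_mul (2 * (P.m : ℂ) ^ 2))).sub
      ((((h.d_A hy).mul (h.d_e hy)).mul (h.d_Φ hy)).const_mul ((P.k : ℂ) ^ 2))
    refine d.congr_deriv ?_
    simp only [Z0, BoundedContinuousFunction.coe_add, BoundedContinuousFunction.coe_mul,
      Pi.add_apply, Pi.mul_apply, BoundedContinuousFunction.coe_pow, Pi.pow_apply,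
      BoundedContinuousFunction.coe_sub, Pi.sub_apply,
      BoundedContinuousFunction.coe_neg, Pi.neg_apply, BoundedContinuousFunction.coe_smul,
      smul_eq_mul]
    ring
  refine (w3.add w2).congr (.of_forall fun y => ?_) (.of_forall fun y => ?_)
  · simp
  · simp; ring

theorem wd_q : HasWeakDeriv (qX B P c X) (fun y => (P.k : ℂ) ^ 2 * ee B c y ^ 2 * ΦΦ B P c X y) :=
  (hasWeakDeriv_of_hasDerivAt (((P.k : ℂ) ^ 2) • (ee B c ^ 2 * ΦΦ B P c X))
    (BoundedContinuousFunction.continuous _).continuousOn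
    (fun y hy => (h.d_q hy).congr_deriv (by simp; ring))).congr (ae_eq_refl _)
    (.of_forall fun y => by simp; ring)

theorem wd_solρ : HasWeakDeriv (solρ B P c X) (solρ' B P c X) := by
  refine (((h.wd_q.add (wd_ρ0 X)).add (wd_Gt X)).const_mul ((P.m : ℂ) ^ 2)).congr
    (.of_forall fun y => ?_) (.of_forall fun y => ?_)
  · simp [solρ]; ring
  · simp [solρ']

theorem wd_solu : HasWeakDeriv (solu B P c X) (solu' B P c X) := by
  have w1 : HasWeakDeriv (Psi1 B P c X + μμ B P c X • 1 : ℝ →ᵇ ℂ) (Psi2 B P c X) := by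
    refine hasWeakDeriv_of_hasDerivAt _ (BoundedContinuousFunction.continuous _).continuousOn ?_
    intro y hy
    have h2 : ⇑(Psi1 B P c X + μμ B P c X • 1) = fun y => Psi1 B P c X y + μμ B P c X := by
      funext y; simp
    rw [h2]
    exact (h.d_Psi1 hy).add_const _
  have w2 := ((h.wd_q.add (wd_ρ0 X)).smooth_mul (smooth_ee h.nondeg.valid c)
    (fun y hy => h.d_e hy)).const_mul (-(P.m : ℂ) ^ 2)
  refine (w1.add w2).congr (.of_forall fun y => ?_) (.of_forall fun y => ?_)
  · simp [solu]; ring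
  · simp [solu']; ring

theorem wd_solu' : HasWeakDeriv (solu' B P c X) (solu'' B P c X) := by
  have w1 := h.wd_Psi2
  have w2 := (h.wd_q.add (wd_ρ0 X)).smooth_mul h.nondeg.valid.smoothU1 h.nondeg.valid.dU1
  have w3 := h.weak_g.smooth_mul (smooth_ee h.nondeg.valid c) (fun y hy => h.d_e hy)
  have w4 : HasWeakDeriv (ee B c ^ 3 * ΦΦ B P c X : ℝ →ᵇ ℂ)
      (3 • (B.U1 * ee B c ^ 2 * ΦΦ B P c X) + ee B c ^ 3 * Φ1 B P c X : ℝ →ᵇ ℂ) := by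
    refine hasWeakDeriv_of_hasDerivAt _ (BoundedContinuousFunction.continuous _).continuousOn ?_
    intro y hy
    refine (((h.d_e hy).pow 3).mul (h.d_Φ hy)).congr_deriv ?_
    simp
    ring
  have w := (w1.add ((w2.add (w3.add (w4.const_mul ((P.k : ℂ) ^ 2)))).const_mul (-(P.m : ℂ) ^ 2)))
  refine w.congr (.of_forall fun y => ?_) (.of_forall fun y => ?_)
  · simp [solu']; ring
  · simp [solu'', X2]; ring

theorem wd_solv : HasWeakDeriv (solv B P c X) (solv' B P c X) := by
  refine hasWeakDeriv_of_hasDerivAt _ (BoundedContinuousFunction.continuous _).continuousOn ?_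
  intro y hy
  have h2 : ⇑(solv B P c X) = fun y => (Complex.I * P.k) * (ee B c y * ΦΦ B P c X y)
      - (Complex.I * P.k) * primL (toL2 (μμ B P c X • 1 + ((P.m : ℂ) ^ 2) • (ee B c * Gt X))) y := by
    funext y; simp [solv, vr]; ring
  rw [h2]
  refine ((((h.d_e hy).mul (h.d_Φ hy)).const_mul (Complex.I * P.k)).sub
    ((hasDerivAt_primL_toL2 _ hy).const_mul (Complex.I * P.k))).congr_deriv ?_
  have hy0 := h.nondeg.ee_ne y
  simp [solv', Psi1, Φ1, h.nondeg.ei_apply]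
  field_simp
  ring

theorem wd_solv' : HasWeakDeriv (solv' B P c X) (solv'' B P c X) := by
  have w1 : HasWeakDeriv (Psi1 B P c X + μμ B P c X • 1 : ℝ →ᵇ ℂ) (Psi2 B P c X) := by
    refine hasWeakDeriv_of_hasDerivAt _ (BoundedContinuousFunction.continuous _).continuousOn ?_
    intro y hy
    have h2 : ⇑(Psi1 B P c X + μμ B P c X • 1) = fun y => Psi1 B P c X y + μμ B P c X := by
      funext y; simp
    rw [h2]
    exact (h.d_Psi1 hy).add_const _
  have w2 := ((wd_Gt X).smooth_mul (smooth_ee h.nondeg.valid c)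
    (fun y hy => h.d_e hy)).const_mul ((P.m : ℂ) ^ 2)
  refine ((w1.add w2).const_mul (-(Complex.I * P.k))).congr
    (.of_forall fun y => ?_) (.of_forall fun y => ?_)
  · simp [solv']; ring
  · simp [solv'']

theorem solv_left : solv B P c X (-1) = 0 := by
  simp [solv, vr_left, ΦΦ, h.nondeg.Phi_left]

theorem solv_right : solv B P c X 1 = 0 := by
  simp [solv, vr_right, ΦΦ, h.nondeg.Phi_right h.eqγ h.eqσ]

omit h in
theorem memL2_solρ' : MemL2 (solρ' B P c X) := by
  have h1 := memL2_bcf (((P.k : ℂ) ^ 2) • (ee B c ^ 2 * ΦΦ B P c X))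
  refine (((h1.add (memL2_coe X.g0)).add (memL2_coe X.gt)).const_mul ((P.m : ℂ) ^ 2)).ae_eq
    (.of_forall fun y => ?_)
  simp [solρ', mul_assoc]

omit h in
theorem memL2_solu' : MemL2 (solu' B P c X) := by
  have h1 := memL2_bcf (Psi2 B P c X - ((P.m : ℂ) ^ 2) • (B.U1 * (qX B P c X + ρ0 X)
    + ((P.k : ℂ) ^ 2) • (ee B c ^ 3 * ΦΦ B P c X)))
  refine (h1.sub ((memL2_mul (ee B c) X.g0).const_mul ((P.m : ℂ) ^ 2))).ae_eq
    (.of_forall fun y => ?_)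
  simp [solu']; ring

omit h in
theorem memL2_solu'' : MemL2 (solu'' B P c X) := by
  have h1 := memL2_bcf (Z0 B P c X - ((P.m : ℂ) ^ 2) • X2 B P c X)
  refine (((h1.add (memL2_mul (AA B P c) (th B P c X.F))).sub
    ((memL2_mul B.U1 X.g0).const_mul (2 * (P.m : ℂ) ^ 2))).sub
    ((memL2_mul (ee B c) X.g1).const_mul ((P.m : ℂ) ^ 2))).ae_eq
    (.of_forall fun y => ?_)
  simp [solu'']; ring

omit h in
theorem memL2_solv'' : MemL2 (solv'' B P c X) := by
  have h1 := memL2_bcf (-((Complex.I * P.k) • (Psi2 B P c X + ((P.m : ℂ) ^ 2) • (B.U1 * Gt X))))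
  refine (h1.sub ((memL2_mul (ee B c) X.gt).const_mul (Complex.I * P.k * (P.m : ℂ) ^ 2))).ae_eq
    (.of_forall fun y => ?_)
  simp [solv'']; ring

/-- The functions constructed above solve the remainder system up to a residual. -/
theorem isRemainderSolution {U : ℝ → ℝ} (hU : ∀ y ∈ Ioo (-1 : ℝ) 1, B.U y = (U y : ℂ))
    (hU1 : ∀ y ∈ Ioo (-1 : ℝ) 1, B.U1 y = ((deriv U y : ℝ) : ℂ))
    (hU2 : ∀ y ∈ Ioo (-1 : ℝ) 1, B.U2 y = ((deriv (deriv U) y : ℝ) : ℂ)) {fu fv : ℝ → ℂ}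
    (hfu : ∀ᵐ y ∂chan, fu y = Complex.I * P.k * AA B P c y * (X.F y + ρ0 X y)
      + Eub B P c X y + EuH B P c X y)
    (hfv : ∀ᵐ y ∂chan, fv y = X.g0 y + X.gt y + Evb B P c X y + EvH B P c X y) :
    IsRemainderSolution U P.m P.lam P.ε P.k c fu fv (solρ B P c X) (solu B P c X)
      (solv B P c X) := by
  have hm : (P.m : ℂ) ≠ 0 := by exact_mod_cast h.nondeg.m_pos.ne'
  have hk : (P.k : ℂ) ≠ 0 := by exact_mod_cast h.nondeg.k_pos.ne'
  have hρ := h.wd_solρ.weakDeriv_ae_eq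
  have hu := h.wd_solu.weakDeriv_ae_eq
  have hv := h.wd_solv.weakDeriv_ae_eq
  have hu2 := weakDeriv_weakDeriv_ae_eq h.wd_solu h.wd_solu'
  have hv2 := weakDeriv_weakDeriv_ae_eq h.wd_solv h.wd_solv'
  have hmass : ∀ᵐ y ∂chan, divk P.k (solu B P c X) (solv B P c X) y
      = -(Complex.I * P.k) * (ee B c y * solρ B P c X y) := by
    filter_upwards [hv] with y hv
    rw [divk, hv]
    simp [solρ, solu, solv']
    ring
  -- The divergence is -ikeρ by the mass equation, so its derivative follows from that of ρ alone.
  have hdiv := (((h.wd_solρ.smooth_mul (smooth_ee h.nondeg.valid c)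
    (fun y hy => h.d_e hy)).const_mul (-(Complex.I * P.k))).congr
    (EventuallyEq.symm hmass) (ae_eq_refl _)).weakDeriv_ae_eq
  refine
    { memH1_ρ := ⟨memL2_bcf _, _, memL2_solρ', h.wd_solρ⟩
      memH2_u := ⟨memL2_bcf _, _, ⟨memL2_solu', _, memL2_solu'', h.wd_solu'⟩, h.wd_solu⟩
      memH2_v := ⟨memL2_bcf _, _, ⟨memL2_bcf _, _, memL2_solv'', h.wd_solv'⟩, h.wd_solv⟩
      cont_u := (BoundedContinuousFunction.continuous _).continuousOn
      cont_v := (BoundedContinuousFunction.continuous _).continuousOn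
      mass := ?_
      momentum_u := ?_
      momentum_v := ?_
      v_left := h.solv_left
      v_right := h.solv_right }
  · filter_upwards [hmass, ae_chan_mem] with y h1 hy
    rw [h1, ee_apply, hU y hy]
    ring
  · have hE := coeFn_mulL2 B.U1 X.g0
    have hE2 := coeFn_mulL2 (ee B c) X.g1
    have hE3 := Lp.coeFn_smul (2 : ℂ) (mulL2 B.U1 X.g0)
    have hE4 := Lp.coeFn_add ((2 : ℂ) • mulL2 B.U1 X.g0) (mulL2 (ee B c) X.g1)
    have hE5 := Lp.coeFn_smul (P.ε * (P.m : ℂ) ^ 2)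
      ((2 : ℂ) • mulL2 B.U1 X.g0 + mulL2 (ee B c) X.g1)
    filter_upwards [hmass, ae_chan_mem, hu2, hfu, hE, hE2, hE3, hE4, hE5, h.nondeg.visc_eq X.F]
      with y h1 hy h2 h3 e1 e2 e3 e4 e5 h6
    have hEu : EuH B P c X y = P.ε * (P.m : ℂ) ^ 2 * (2 * (B.U1 y * X.g0 y) + ee B c y * X.g1 y) := by
      rw [EuH, e5, Pi.smul_apply, e4, Pi.add_apply, e3, Pi.smul_apply, e1, e2]
      simp only [smul_eq_mul]
    -- Since ik·iν = -ε, the term ikAF accounts for the top order part -εAθ of -ε∂_y²u and for the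
    -- pressure p left over from the inviscid terms.
    have hF : X.F y = Complex.I * ((P.ε : ℂ) / P.k) * th B P c X.F y - pp B P c X.F y := by
      rw [eq_sub_iff_add_eq, ← h6]; push_cast; ring
    rw [lapk, h2, h1, h3, ← hU y hy, ← hU1 y hy, ← hU2 y hy, ← ee_apply, hEu, hF]
    have hei := h.nondeg.ei_apply y
    have hy0 := h.nondeg.ee_ne y
    simp only [solu'', Eub, solρ, solu, solv, Psi1, qp, BoundedContinuousFunction.coe_add,
      BoundedContinuousFunction.coe_mul,
      Pi.add_apply, Pi.mul_apply,
      BoundedContinuousFunction.coe_sub, Pi.sub_apply,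
      BoundedContinuousFunction.coe_neg, Pi.neg_apply, BoundedContinuousFunction.coe_smul,
      smul_eq_mul, BoundedContinuousFunction.coe_one, Pi.one_apply, hei, AA_apply]
    field_simp
    ring_nf
    simp only [Complex.I_sq]
    ring
  · have hE2 := coeFn_mulL2 (ee B c) ((1 + P.lam : ℂ) • X.gt + (P.lam : ℂ) • X.g0)
    have hE3 := Lp.coeFn_smul (1 + P.lam : ℂ) X.gt
    have hE3' := Lp.coeFn_smul (P.lam : ℂ) X.g0
    have hE4 := Lp.coeFn_add ((1 + P.lam : ℂ) • X.gt) ((P.lam : ℂ) • X.g0)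
    have hE5 := Lp.coeFn_smul (Complex.I * P.k * P.ε * (P.m : ℂ) ^ 2)
      (mulL2 (ee B c) ((1 + P.lam : ℂ) • X.gt + (P.lam : ℂ) • X.g0))
    filter_upwards [ae_chan_mem, hv2, hρ, hfv, hE2, hE3, hE3', hE4, hE5, hdiv]
      with y hy h2 h3 h4 e2 e3 e3' e4 e5 h5
    have hEv : EvH B P c X y = Complex.I * P.k * P.ε * (P.m : ℂ) ^ 2 *
        (ee B c y * ((1 + P.lam) * X.gt y + P.lam * X.g0 y)) := by
      rw [EvH, e5, Pi.smul_apply, e2, e4, Pi.add_apply, e3, e3', Pi.smul_apply, Pi.smul_apply]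
      simp only [smul_eq_mul]
    rw [lapk, h2, h3, h4, h5, ← hU y hy, ← ee_apply, hEv]
    simp only [solv'', Evb, solρ', solv, BoundedContinuousFunction.coe_add,
      BoundedContinuousFunction.coe_mul,
      Pi.add_apply, Pi.mul_apply, BoundedContinuousFunction.coe_pow, Pi.pow_apply,
      BoundedContinuousFunction.coe_smul,
      smul_eq_mul]
    field_simp
    ring_nf
    simp only [Complex.I_sq]
    ring

end Unknowns.Solves

end

section

/-! ### Uniform bounds for expressions with bounded coefficients -/

/-- By homogeneity x may be rescaled to the unit polydisc, and p is bounded on the compact set of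
such x and bounded coefficients. This replaces explicit triangle inequalities for the long formulas
above. -/
theorem exists_bound_of_homogeneous {n r : ℕ} (p : (Fin n → ℂ) → (Fin r → ℂ) → ℂ)
    (hp : Continuous fun z : (Fin n → ℂ) × (Fin r → ℂ) => p z.1 z.2)
    (hom : ∀ a x (t : ℂ), p a (t • x) = t * p a x) (K : ℝ) :
    ∃ C : ℝ, 0 ≤ C ∧ ∀ a x, (∀ i, ‖a i‖ ≤ K) → ‖p a x‖ ≤ C * ∑ i, ‖x i‖ := by
  have hc : IsCompact ((univ.pi fun _ : Fin n => Metric.closedBall (0 : ℂ) K) ×ˢ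
      (univ.pi fun _ : Fin r => Metric.closedBall (0 : ℂ) 1)) :=
    (isCompact_univ_pi fun _ => isCompact_closedBall _ _).prod
      (isCompact_univ_pi fun _ => isCompact_closedBall _ _)
  obtain ⟨C, hC⟩ := hc.exists_bound_of_continuousOn hp.continuousOn
  refine ⟨max C 0, le_max_right _ _, fun a x ha => ?_⟩
  set s : ℝ := ∑ i, ‖x i‖ with hs
  have hs0 : 0 ≤ s := Finset.sum_nonneg fun i _ => norm_nonneg _
  rcases hs0.eq_or_lt with h0 | h0
  · have hx : x = 0 := by
      funext i
      have := (Finset.sum_eq_zero_iff_of_nonneg (fun i _ => norm_nonneg (x i))).1 h0.symm i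
        (Finset.mem_univ i)
      simpa using this
    have := hom a 0 0
    rw [hx, ← h0]
    simp at this
    simp [this]
  · have h1 : p a x = (s : ℂ) * p a ((s : ℂ)⁻¹ • x) := by
      rw [← hom, smul_smul, mul_inv_cancel₀ (by exact_mod_cast h0.ne'), one_smul]
    have h2 : ‖p a ((s : ℂ)⁻¹ • x)‖ ≤ C := by
      refine hC (a, (s : ℂ)⁻¹ • x) ⟨fun i _ => by simpa using ha i, fun i _ => ?_⟩
      simp only [Metric.mem_closedBall, dist_zero_right, Pi.smul_apply, smul_eq_mul, norm_mul,
        norm_inv, Complex.norm_real, Real.norm_of_nonneg hs0]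
      rw [inv_mul_le_iff₀ h0, mul_one]
      exact Finset.single_le_sum (f := fun i => ‖x i‖) (fun i _ => norm_nonneg _) (Finset.mem_univ i)
    rw [h1, norm_mul, Complex.norm_real, Real.norm_of_nonneg hs0, mul_comm]
    gcongr
    exact h2.trans (le_max_left _ _)

theorem exists_l2_bound {n r : ℕ} (p : (Fin n → ℂ) → (Fin r → ℂ) → ℂ)
    (hp : Continuous fun z : (Fin n → ℂ) × (Fin r → ℂ) => p z.1 z.2)
    (hom : ∀ a x (t : ℂ), p a (t • x) = t * p a x) (K : ℝ) :
    ∃ C : ℝ, 0 ≤ C ∧ ∀ (a : ℝ → Fin n → ℂ) (x : Fin r → ℝ → ℂ) (f : ℝ → ℂ),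
      (∀ y i, ‖a y i‖ ≤ K) → (∀ i, MemL2 (x i)) →
      (∀ᵐ y ∂chan, f y = p (a y) (fun i => x i y)) → l2 f ≤ C * ∑ i, l2 (x i) := by
  obtain ⟨C, hC0, hC⟩ := exists_bound_of_homogeneous p hp hom K
  refine ⟨C, hC0, fun a x f ha hx hf => l2_le_sum hC0 hx ?_⟩
  filter_upwards [hf] with y hy
  rw [hy]
  exact hC _ _ (ha y)

theorem exists_sup_bound {n r : ℕ} (p : (Fin n → ℂ) → (Fin r → ℂ) → ℂ)
    (hp : Continuous fun z : (Fin n → ℂ) × (Fin r → ℂ) => p z.1 z.2)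
    (hom : ∀ a x (t : ℂ), p a (t • x) = t * p a x) (K : ℝ) :
    ∃ C : ℝ, 0 ≤ C ∧ ∀ (a : ℝ → Fin n → ℂ) (x : Fin r → ℝ →ᵇ ℂ) (f : ℝ →ᵇ ℂ),
      (∀ y i, ‖a y i‖ ≤ K) → (∀ y, f y = p (a y) (fun i => x i y)) → ‖f‖ ≤ C * ∑ i, ‖x i‖ := by
  obtain ⟨C, hC0, hC⟩ := exists_bound_of_homogeneous p hp hom K
  refine ⟨C, hC0, fun a x f ha hf => (BoundedContinuousFunction.norm_le (by positivity)).2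
    fun y => ?_⟩
  rw [hf]
  refine (hC _ _ (ha y)).trans ?_
  gcongr with i
  exact (x i).norm_coe_le_norm y

/-- The asymptotic regime, with one constant `K` for all bounds. -/
structure Regime (K δ : ℝ) (B : Background) (P : Params) (c : ℂ) : Prop where
  valid : B.Valid
  K_one : 1 ≤ K
  δ_pos : 0 < δ
  δ_le : δ ≤ 1
  ε_eq : P.ε = δ ^ 7
  k_lo : δ ≤ K * P.k
  k_hi : P.k ≤ K * δ
  c_hi : ‖c‖ ≤ K * δ ^ 2
  im_lo : δ ^ 2 ≤ K * c.im
  m_pos : 0 < P.m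
  m_le : P.m ≤ 1
  lam_nonneg : 0 ≤ P.lam
  lam_le : P.lam ≤ K
  U_le : ‖B.U‖ ≤ K
  U1_le : ‖B.U1‖ ≤ K
  U2_le : ‖B.U2‖ ≤ K
  U3_le : ‖B.U3‖ ≤ K
  L_le : ‖B.L‖ ≤ K
  L1_le : ‖B.L1‖ ≤ K
  A_lo : ∀ y, 1 ≤ K * ‖AA B P c y‖
  Ab_lo : 1 ≤ K * ‖Ab P c‖
  ei_l2 : δ * l2 (ei B c) ≤ K
  near : ∀ y, ‖1 - B.L y * B.U1 y‖ ≤ K * ‖ee B c y‖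
  disp_lo : δ ^ 2 ≤ K * ‖disp B P c‖

/-- The bounded coefficients. -/
def coefs (B : Background) (P : Params) (c : ℂ) (y : ℝ) : Fin 13 → ℂ :=
  ![B.U1 y, B.U2 y, B.U3 y, B.L y, B.L1 y, ee B c y, AA B P c y, P.m, P.k, P.lam, P.ε,
    Complex.I, c]

variable {K δ : ℝ} {B : Background} {P : Params} {c : ℂ}

namespace Regime

variable (h : Regime K δ B P c)
include h

theorem K_pos : 0 < K := by linarith [h.K_one]

theorem k_pos : 0 < P.k := by
  have h1 := h.δ_pos
  have h2 := h.k_lo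
  have h3 := h.K_pos
  by_contra h4
  nlinarith

theorem im_pos : 0 < c.im := by
  have h1 : 0 < δ ^ 2 := pow_pos h.δ_pos 2
  have h2 := h.im_lo
  have h3 := h.K_pos
  by_contra h4
  nlinarith

theorem nondeg : Nondeg B P c where
  valid := h.valid
  ε_pos := by rw [h.ε_eq]; exact pow_pos h.δ_pos 7
  k_pos := h.k_pos
  im_pos := h.im_pos
  m_pos := h.m_pos
  A_unit := isUnit_bcf (κ := K⁻¹) (inv_pos.2 h.K_pos) fun y => by
    rw [inv_le_iff_one_le_mul₀ h.K_pos, mul_comm]; exact h.A_lo y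
  Ab_ne := fun h0 => by have := h.Ab_lo; rw [h0, norm_zero] at this; linarith
  disp_ne := fun h0 => by
    have := h.disp_lo
    rw [h0, norm_zero] at this
    have h1 : 0 < δ ^ 2 := pow_pos h.δ_pos 2
    linarith

theorem pow_le_one (n : ℕ) : δ ^ n ≤ 1 := pow_le_one₀ h.δ_pos.le h.δ_le

theorem norm_ee_le (y : ℝ) : ‖ee B c y‖ ≤ 2 * K := by
  rw [ee_apply]
  have h1 := B.U.norm_coe_le_norm y
  have h2 := h.U_le
  have h3 := h.c_hi
  have h4 := mul_le_mul_of_nonneg_left (h.pow_le_one 2) h.K_pos.le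
  linarith [norm_sub_le (B.U y) c]

theorem norm_AA_le (y : ℝ) : ‖AA B P c y‖ ≤ 1 + 4 * K ^ 2 := by
  rw [AA_apply]
  refine (norm_sub_le _ _).trans ?_
  rw [norm_one, norm_mul, norm_pow, norm_pow, Complex.norm_real,
    Real.norm_of_nonneg h.m_pos.le]
  have h1 := h.norm_ee_le y
  have h2 : P.m ^ 2 ≤ 1 := pow_le_one₀ h.m_pos.le h.m_le
  have h3 : ‖ee B c y‖ ^ 2 ≤ (2 * K) ^ 2 := pow_le_pow_left₀ (norm_nonneg _) h1 2
  nlinarith [sq_nonneg ‖ee B c y‖]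

theorem coefs_le (y : ℝ) (i : Fin 13) : ‖coefs B P c y i‖ ≤ 5 * K ^ 2 := by
  have hK := h.K_one
  have hK2 : K ≤ K ^ 2 := by nlinarith
  have e : ∀ {b : ℝ →ᵇ ℂ}, ‖b‖ ≤ K → ‖b y‖ ≤ 5 * K ^ 2 := fun hb => by
    have := (BoundedContinuousFunction.norm_coe_le_norm _ y).trans hb
    linarith
  have hr : ∀ {t : ℝ}, 0 ≤ t → t ≤ K → ‖(t : ℂ)‖ ≤ 5 * K ^ 2 := fun h0 ht => by
    rw [Complex.norm_real, Real.norm_of_nonneg h0]; linarith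
  have hkd : P.k ≤ K := h.k_hi.trans (by nlinarith [h.δ_le, h.K_pos])
  have hε : P.ε ≤ K := by rw [h.ε_eq]; linarith [h.pow_le_one 7]
  have hcK : ‖c‖ ≤ K := h.c_hi.trans (by nlinarith [h.pow_le_one 2, h.K_pos])
  have hε0 := h.nondeg.ε_pos.le
  fin_cases i
  · exact e h.U1_le
  · exact e h.U2_le
  · exact e h.U3_le
  · exact e h.L_le
  · exact e h.L1_le
  · have := h.norm_ee_le y
    show ‖ee B c y‖ ≤ _
    linarith
  · have := h.norm_AA_le y
    show ‖AA B P c y‖ ≤ _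
    linarith
  · exact hr h.m_pos.le (h.m_le.trans hK)
  · exact hr h.k_pos.le hkd
  · exact hr h.lam_nonneg h.lam_le
  · exact hr hε0 hε
  · show ‖Complex.I‖ ≤ _
    rw [Complex.norm_I]; linarith
  · show ‖c‖ ≤ _
    linarith

theorem norm_ei_le (y : ℝ) : δ ^ 2 * ‖ei B c y‖ ≤ K := by
  rw [h.nondeg.ei_apply, norm_inv]
  have h1 := h.nondeg.norm_ee y
  have h2 := h.im_lo
  have h3 := h.K_pos
  have h4 : 0 < ‖ee B c y‖ := h.im_pos.trans_le h1
  rw [← div_eq_mul_inv, div_le_iff₀ h4]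
  nlinarith

theorem norm_Ai_le (y : ℝ) : ‖Ai B P c y‖ ≤ K := by
  rw [h.nondeg.Ai_apply, norm_inv]
  have h4 : 0 < ‖AA B P c y‖ := norm_pos_iff.2 (h.nondeg.AA_ne y)
  rw [inv_le_iff_one_le_mul₀ h4]
  exact h.A_lo y

end Regime

/-- The norms of a pressure that control the inviscid part. -/
structure PSize (B : Background) (c : ℂ) (δ : ℝ) (p : ℝ →ᵇ ℂ) (N : ℝ) : Prop where
  l2_le : l2 p ≤ N
  l2_ei : δ * l2 (p * ei B c : ℝ →ᵇ ℂ) ≤ N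
  l2_ei2 : δ ^ 3 * l2 (p * ei B c ^ 2 : ℝ →ᵇ ℂ) ≤ N
  l1_ei2 : δ ^ 2 * ∫ y, ‖(p * ei B c ^ 2 : ℝ →ᵇ ℂ) y‖ ∂chan ≤ N

theorem PSize.mono {p : ℝ →ᵇ ℂ} {N N' : ℝ} (hp : PSize B c δ p N) (hN : N ≤ N') :
    PSize B c δ p N' :=
  ⟨hp.1.trans hN, hp.2.trans hN, hp.3.trans hN, hp.4.trans hN⟩

theorem PSize.add {p p' : ℝ →ᵇ ℂ} {N N' : ℝ} (hδ : 0 < δ) (hp : PSize B c δ p N)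
    (hp' : PSize B c δ p' N') : PSize B c δ (p + p') (N + N') := by
  have key : ∀ b b' : ℝ →ᵇ ℂ, l2 (b + b' : ℝ →ᵇ ℂ) ≤ l2 b + l2 b' := fun b b' =>
    l2_add_le (memL2_bcf b) (memL2_bcf b')
  have k2 : ∀ b b' : ℝ →ᵇ ℂ, ∫ y, ‖(b + b' : ℝ →ᵇ ℂ) y‖ ∂chan
      ≤ ∫ y, ‖b y‖ ∂chan + ∫ y, ‖b' y‖ ∂chan := fun b b' => by
    rw [← integral_add (memL2_bcf b).integrable.norm (memL2_bcf b').integrable.norm]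
    exact integral_mono (memL2_bcf (b + b')).integrable.norm
      ((memL2_bcf b).integrable.norm.add (memL2_bcf b').integrable.norm) fun y => norm_add_le _ _
  refine ⟨(key _ _).trans (add_le_add hp.1 hp'.1), ?_, ?_, ?_⟩ <;> rw [add_mul]
  · have := mul_le_mul_of_nonneg_left (key (p * ei B c) (p' * ei B c)) hδ.le
    linarith [hp.2, hp'.2]
  · have := mul_le_mul_of_nonneg_left (key (p * ei B c ^ 2) (p' * ei B c ^ 2)) (pow_pos hδ 3).le
    linarith [hp.3, hp'.3]
  · have := mul_le_mul_of_nonneg_left (k2 (p * ei B c ^ 2) (p' * ei B c ^ 2)) (pow_pos hδ 2).le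
    linarith [hp.4, hp'.4]

/-- A bounded part of p is paired with ‖1/e‖_{L²} ≤ K/δ, a merely square integrable part with sup
|1/e| ≤ K/δ². The two lead to the same powers of δ exactly when the L² part is smaller by a factor
δ, which is the form of the hypotheses. -/
theorem Regime.psize (h : Regime K δ B P c) {p pb : ℝ →ᵇ ℂ} {pa : ℝ → ℂ} {N : ℝ}
    (hpa : MemL2 pa) (hp : ∀ᵐ y ∂chan, p y = pa y + pb y) (ha : l2 pa ≤ δ * N)
    (hb : ‖pb‖ ≤ N) : PSize B c δ p (3 * K ^ 2 * N) := by
  have hδ := h.δ_pos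
  have hδ1 := h.δ_le
  have hK := h.K_one
  have hN : 0 ≤ N := (norm_nonneg _).trans hb
  have hK2 : K ≤ K ^ 2 := by nlinarith
  set z := l2 (ei B c) with hz
  have hz0 : 0 ≤ z := l2_nonneg _
  have hzK : δ * z ≤ K := h.ei_l2
  have hei := h.norm_ei_le
  have hpbN : ∀ y, ‖pb y‖ ≤ N := fun y => (pb.norm_coe_le_norm y).trans hb
  have hE : ∀ y, ‖ei B c y‖ ≤ K / δ ^ 2 := fun y => by
    rw [le_div_iff₀ (by positivity), mul_comm]; exact hei y
  have hKN : K * N ≤ K ^ 2 * N := mul_le_mul_of_nonneg_right hK2 hN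
  have hNK : N ≤ K ^ 2 * N := by nlinarith
  have a0 : l2 pa ≤ N := ha.trans (by nlinarith)
  have l2e2 : l2 (ei B c ^ 2 : ℝ →ᵇ ℂ) ≤ K / δ ^ 2 * z := by
    refine l2_le_mul (by positivity) (memL2_bcf _) (.of_forall fun y => ?_)
    simp only [BoundedContinuousFunction.coe_pow, Pi.pow_apply, norm_pow]
    rw [sq]
    exact mul_le_mul_of_nonneg_right (hE y) (norm_nonneg _)
  have hzd : z ≤ K / δ := by rw [le_div_iff₀ hδ]; linarith
  refine ⟨?_, ?_, ?_, ?_⟩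
  · have := l2_le_sum (n := 2) (f := p) (g := ![pa, pb]) zero_le_one
      (by intro i; fin_cases i; exacts [hpa, memL2_bcf pb]) (by
        filter_upwards [hp] with y hy
        rw [hy]; simpa using norm_add_le (pa y) (pb y))
    simp only [Fin.sum_univ_two, Matrix.cons_val_zero, Matrix.cons_val_one, one_mul] at this
    have h2 := l2_bcf_le pb
    linarith
  · have h1 : l2 (p * ei B c : ℝ →ᵇ ℂ) ≤ 1 * ∑ i, l2 ((![fun y => ((K / δ ^ 2 : ℝ) : ℂ) * pa y,
        fun y => (N : ℂ) * ei B c y] : Fin 2 → ℝ → ℂ) i) := by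
      refine l2_le_sum zero_le_one ?_ ?_
      · intro i; fin_cases i
        exacts [hpa.const_mul _, (memL2_bcf (ei B c)).const_mul _]
      · filter_upwards [hp] with y hy
        simp only [BoundedContinuousFunction.coe_mul, Pi.mul_apply, hy, Fin.sum_univ_two,
          Matrix.cons_val_zero, Matrix.cons_val_one, one_mul, norm_mul, Complex.norm_real,
          Real.norm_of_nonneg hN, Real.norm_of_nonneg (show 0 ≤ K / δ ^ 2 by positivity)]
        refine (mul_le_mul_of_nonneg_right (norm_add_le _ _) (norm_nonneg _)).trans ?_
        rw [add_mul]
        refine add_le_add ?_ (mul_le_mul_of_nonneg_right (hpbN y) (norm_nonneg _))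
        rw [mul_comm]
        exact mul_le_mul_of_nonneg_right (hE y) (norm_nonneg _)
    simp only [Fin.sum_univ_two, Matrix.cons_val_zero, Matrix.cons_val_one, one_mul] at h1
    have h2 : l2 (fun y => ((K / δ ^ 2 : ℝ) : ℂ) * pa y) ≤ K / δ ^ 2 * l2 pa :=
      l2_le_mul (by positivity) hpa (.of_forall fun y => by
        rw [norm_mul, Complex.norm_real, Real.norm_of_nonneg (by positivity)])
    have h3 : l2 (fun y => (N : ℂ) * ei B c y) ≤ N * z :=
      l2_le_mul hN (memL2_bcf _) (.of_forall fun y => by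
        rw [norm_mul, Complex.norm_real, Real.norm_of_nonneg hN])
    have h4 : K / δ ^ 2 * l2 pa ≤ K / δ ^ 2 * (δ * N) := mul_le_mul_of_nonneg_left ha (by positivity)
    have h5 : δ * (K / δ ^ 2 * (δ * N)) = K * N := by field_simp
    calc δ * l2 (p * ei B c : ℝ →ᵇ ℂ) ≤ δ * (K / δ ^ 2 * (δ * N) + N * z) := by
          gcongr; linarith
      _ = K * N + N * (δ * z) := by rw [mul_add, h5]; ring
      _ ≤ K * N + N * K := by gcongr
      _ ≤ 3 * K ^ 2 * N := by nlinarith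
  · have h1 : l2 (p * ei B c ^ 2 : ℝ →ᵇ ℂ) ≤ 1 * ∑ i, l2 ((![fun y => (((K / δ ^ 2) ^ 2 : ℝ) : ℂ) * pa y,
        fun y => (N : ℂ) * (ei B c ^ 2 : ℝ →ᵇ ℂ) y] : Fin 2 → ℝ → ℂ) i) := by
      refine l2_le_sum zero_le_one ?_ ?_
      · intro i; fin_cases i
        exacts [hpa.const_mul _, (memL2_bcf (ei B c ^ 2)).const_mul _]
      · filter_upwards [hp] with y hy
        simp only [BoundedContinuousFunction.coe_mul, Pi.mul_apply, hy, Fin.sum_univ_two,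
          Matrix.cons_val_zero, Matrix.cons_val_one, one_mul, norm_mul, Complex.norm_real,
          Real.norm_of_nonneg hN, Real.norm_of_nonneg (show 0 ≤ (K / δ ^ 2) ^ 2 by positivity),
          BoundedContinuousFunction.coe_pow, Pi.pow_apply, norm_pow]
        refine (mul_le_mul_of_nonneg_right (norm_add_le _ _) (by positivity)).trans ?_
        rw [add_mul]
        refine add_le_add ?_ (mul_le_mul_of_nonneg_right (hpbN y) (by positivity))
        rw [mul_comm]
        exact mul_le_mul_of_nonneg_right (pow_le_pow_left₀ (norm_nonneg _) (hE y) 2) (norm_nonneg _)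
    simp only [Fin.sum_univ_two, Matrix.cons_val_zero, Matrix.cons_val_one, one_mul] at h1
    have h2 : l2 (fun y => (((K / δ ^ 2) ^ 2 : ℝ) : ℂ) * pa y) ≤ (K / δ ^ 2) ^ 2 * l2 pa :=
      l2_le_mul (by positivity) hpa (.of_forall fun y => by
        rw [norm_mul, Complex.norm_real, Real.norm_of_nonneg (by positivity)])
    have h3 : l2 (fun y => (N : ℂ) * (ei B c ^ 2 : ℝ →ᵇ ℂ) y) ≤ N * l2 (ei B c ^ 2 : ℝ →ᵇ ℂ) :=
      l2_le_mul hN (memL2_bcf _) (.of_forall fun y => by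
        rw [norm_mul, Complex.norm_real, Real.norm_of_nonneg hN])
    have h4 : (K / δ ^ 2) ^ 2 * l2 pa ≤ (K / δ ^ 2) ^ 2 * (δ * N) :=
      mul_le_mul_of_nonneg_left ha (by positivity)
    have h5 : δ ^ 3 * ((K / δ ^ 2) ^ 2 * (δ * N)) = K ^ 2 * N := by field_simp
    have h6 : δ ^ 3 * (N * (K / δ ^ 2 * (K / δ))) = K ^ 2 * N := by field_simp
    have h7 : l2 (ei B c ^ 2 : ℝ →ᵇ ℂ) ≤ K / δ ^ 2 * (K / δ) := l2e2.trans (by gcongr)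
    calc δ ^ 3 * l2 (p * ei B c ^ 2 : ℝ →ᵇ ℂ)
        ≤ δ ^ 3 * ((K / δ ^ 2) ^ 2 * (δ * N) + N * (K / δ ^ 2 * (K / δ))) := by
          gcongr
          have := mul_le_mul_of_nonneg_left h7 hN
          linarith
      _ = K ^ 2 * N + K ^ 2 * N := by rw [mul_add, h5, h6]
      _ ≤ 3 * K ^ 2 * N := by nlinarith
  · have h1 : ∫ y, ‖(p * ei B c ^ 2 : ℝ →ᵇ ℂ) y‖ ∂chan
        ≤ ∫ y, ‖pa y * (ei B c ^ 2 : ℝ →ᵇ ℂ) y‖ ∂chan + N * ∫ y, ‖ei B c y * ei B c y‖ ∂chan := by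
      have i1 : Integrable (fun y => ‖pa y * (ei B c ^ 2 : ℝ →ᵇ ℂ) y‖) chan := by
        have : MemL2 fun y => (ei B c ^ 2 : ℝ →ᵇ ℂ) y * MemLp.toLp pa hpa y :=
          memL2_mul _ _
        refine (this.integrable.congr ?_).norm
        filter_upwards [MemLp.coeFn_toLp hpa] with y hy
        rw [hy, mul_comm]
      have i2 : Integrable (fun y => N * ‖ei B c y * ei B c y‖) chan :=
        ((memL2_bcf (ei B c * ei B c)).integrable.norm.const_mul N)
      rw [← integral_const_mul, ← integral_add i1 i2]
      refine integral_mono_ae (memL2_bcf _).integrable.norm (i1.add i2) ?_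
      filter_upwards [hp] with y hy
      simp only [BoundedContinuousFunction.coe_mul, Pi.mul_apply, hy, norm_mul,
        BoundedContinuousFunction.coe_pow, Pi.pow_apply, norm_pow]
      rw [← sq, ← add_mul]
      refine mul_le_mul_of_nonneg_right ?_ (by positivity)
      exact (norm_add_le _ _).trans (by linarith [hpbN y])
    have h2 := integral_norm_mul_le hpa (memL2_bcf (ei B c ^ 2))
    have h3 := integral_norm_mul_le (memL2_bcf (ei B c)) (memL2_bcf (ei B c))
    have h4 : l2 pa * l2 (ei B c ^ 2 : ℝ →ᵇ ℂ) ≤ (δ * N) * (K / δ ^ 2 * (K / δ)) :=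
      mul_le_mul ha (l2e2.trans (by gcongr)) (l2_nonneg _) (by positivity)
    have h5 : δ ^ 2 * ((δ * N) * (K / δ ^ 2 * (K / δ))) = K ^ 2 * N := by field_simp
    have h6 : z * z ≤ K / δ * (K / δ) := mul_le_mul hzd hzd hz0 (by positivity)
    have h7 : δ ^ 2 * (N * (K / δ * (K / δ))) = K ^ 2 * N := by field_simp
    calc δ ^ 2 * ∫ y, ‖(p * ei B c ^ 2 : ℝ →ᵇ ℂ) y‖ ∂chan
        ≤ δ ^ 2 * ((δ * N) * (K / δ ^ 2 * (K / δ)) + N * (K / δ * (K / δ))) := by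
          gcongr
          have := mul_le_mul_of_nonneg_left (h3.trans h6) hN
          linarith
      _ = K ^ 2 * N + K ^ 2 * N := by rw [mul_add, h5, h7]
      _ ≤ 3 * K ^ 2 * N := by nlinarith

theorem Regime.psize_bcf (h : Regime K δ B P c) (q : ℝ →ᵇ ℂ) :
    PSize B c δ q (3 * K ^ 2 * ‖q‖) := by
  refine h.psize (pa := 0) (pb := q) (MemLp.zero) (.of_forall fun y => by simp) ?_ le_rfl
  have : l2 0 = 0 := by simp [l2]
  rw [this]
  exact mul_nonneg h.δ_pos.le (norm_nonneg _)

end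

/-! ### Bounds for the inviscid part. -/

section

theorem norm_primL_toL2_le (b : ℝ →ᵇ ℂ) : ‖primL (toL2 b)‖ ≤ 4 * ‖b‖ := by
  have h1 := norm_primL_le (toL2 b)
  rw [norm_toL2] at h1
  linarith [l2_bcf_le b]

theorem norm_smul_one (z : ℂ) : ‖z • (1 : ℝ →ᵇ ℂ)‖ = ‖z‖ := by
  rw [norm_smul, norm_one, mul_one]

theorem l2_mul_le_norm_mul (q b : ℝ →ᵇ ℂ) : l2 (q * b : ℝ →ᵇ ℂ) ≤ ‖q‖ * l2 b :=
  l2_le_mul (norm_nonneg _) (memL2_bcf b) (.of_forall fun y => by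
    rw [BoundedContinuousFunction.coe_mul, Pi.mul_apply, norm_mul]
    exact mul_le_mul_of_nonneg_right (q.norm_coe_le_norm y) (norm_nonneg _))

theorem l2_smul_bcf (z : ℂ) (b : ℝ →ᵇ ℂ) : l2 (z • b : ℝ →ᵇ ℂ) ≤ ‖z‖ * l2 b :=
  l2_le_mul (norm_nonneg _) (memL2_bcf b) (.of_forall fun y => by
    rw [BoundedContinuousFunction.coe_smul, norm_smul])

/-- An expression which is linear in `x`, with coefficients polynomial in the background. -/
theorem exists_coefs_bound {r : ℕ} (p : (Fin 13 → ℂ) → (Fin r → ℂ) → ℂ)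
    (hp : Continuous fun z : (Fin 13 → ℂ) × (Fin r → ℂ) => p z.1 z.2)
    (hom : ∀ a x (t : ℂ), p a (t • x) = t * p a x) (K : ℝ) :
    ∃ C : ℝ, 0 ≤ C ∧ ∀ {δ : ℝ} {B : Background} {P : Params} {c : ℂ}, Regime K δ B P c →
      ∀ (x : Fin r → ℝ →ᵇ ℂ) (f : ℝ →ᵇ ℂ), (∀ y, f y = p (coefs B P c y) (fun i => x i y)) →
        l2 f ≤ C * ∑ i, l2 (x i) ∧ ‖f‖ ≤ C * ∑ i, ‖x i‖ := by
  obtain ⟨C1, hC1, h1⟩ := exists_l2_bound p hp hom (5 * K ^ 2)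
  obtain ⟨C2, hC2, h2⟩ := exists_sup_bound p hp hom (5 * K ^ 2)
  refine ⟨C1 + C2, by positivity, fun {δ B P c} h x f hf => ⟨?_, ?_⟩⟩
  · refine (h1 (coefs B P c) (fun i => x i) f h.coefs_le (fun i => memL2_bcf _)
      (.of_forall hf)).trans ?_
    exact mul_le_mul_of_nonneg_right (by linarith) (Finset.sum_nonneg fun i _ => l2_nonneg _)
  · refine (h2 (coefs B P c) x f h.coefs_le hf).trans ?_
    exact mul_le_mul_of_nonneg_right (by linarith) (Finset.sum_nonneg fun i _ => norm_nonneg _)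

variable {K : ℝ}

theorem exists_bound_rr (K : ℝ) : ∃ C : ℝ, 0 ≤ C ∧ ∀ {δ : ℝ} {B : Background} {P : Params} {c : ℂ},
    Regime K δ B P c → ∀ γ σ, ‖rr B P c γ σ‖ ≤ C * (δ ^ 2 * (‖γ‖ + ‖σ‖)) := by
  -- Here and below the numeric indices of a are positions in `coefs`: 0 to 4 are U', U'', U''', L,
  -- L', then 5 is e, 6 is A, and 7 to 12 are m, k, λ, ε, i, c.
  obtain ⟨C, hC0, hC⟩ := exists_coefs_bound (r := 2)
    (fun a x => x 0 - (1 - a 7 ^ 2 * a 12 ^ 2) * x 1 * a 5 ^ 2) (by fun_prop)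
    (by intro a x t; simp; ring) K
  refine ⟨K ^ 2 * C, by positivity, fun {δ B P c} h γ σ => ?_⟩
  have h1 := (hC h ![σ, γ • 1] (σ - (Ab P c * γ) • ee B c ^ 2)
    (by intro y; simp [coefs, Ab])).2
  simp only [Fin.sum_univ_two, Matrix.cons_val_zero, Matrix.cons_val_one, norm_smul_one] at h1
  rw [rr, norm_smul, norm_pow, Complex.norm_real, Real.norm_of_nonneg h.k_pos.le]
  have h2 : P.k ^ 2 ≤ (K * δ) ^ 2 := pow_le_pow_left₀ h.k_pos.le h.k_hi 2
  calc P.k ^ 2 * ‖σ - (Ab P c * γ) • ee B c ^ 2‖ ≤ (K * δ) ^ 2 * (C * (‖σ‖ + ‖γ‖)) := by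
        gcongr
    _ = _ := by ring

theorem exists_bound_qq (K : ℝ) : ∃ C : ℝ, 0 ≤ C ∧ ∀ {δ : ℝ} {B : Background} {P : Params} {c : ℂ},
    Regime K δ B P c → ∀ γ σ, ‖qq B P c γ σ‖ ≤ C * (δ ^ 2 * (‖γ‖ + ‖σ‖)) := by
  obtain ⟨C, hC0, hC⟩ := exists_bound_rr K
  refine ⟨K ^ 2 + 4 * C, by positivity, fun {δ B P c} h γ σ => ?_⟩
  have h1 := hC h γ σ
  have h2 := norm_primL_toL2_le (rr B P c γ σ)
  have h3 : ‖c * γ * B.U1 (-1)‖ ≤ K * δ ^ 2 * ‖γ‖ * K := by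
    rw [norm_mul, norm_mul]
    have := (B.U1.norm_coe_le_norm (-1)).trans h.U1_le
    have := h.c_hi
    have := h.K_pos
    gcongr
  rw [qq]
  refine (norm_add_le _ _).trans ?_
  rw [norm_smul_one]
  have : K * δ ^ 2 * ‖γ‖ * K ≤ K ^ 2 * (δ ^ 2 * (‖γ‖ + ‖σ‖)) := by
    have : 0 ≤ K ^ 2 * δ ^ 2 * ‖σ‖ := by positivity
    linarith
  linarith

/-- The integrand is at worst q/e up to bounded factors, with q and q' of order δ². Since ‖1/e‖_{L²}
≤ K/δ, a factor δ remains, which makes the map for (γ, σ) contracting. -/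
theorem exists_bound_RR (hK : 1 ≤ K) : ∃ C : ℝ, 0 ≤ C ∧
    ∀ {δ : ℝ} {B : Background} {P : Params} {c : ℂ},
    Regime K δ B P c → ∀ γ σ, ‖RR B P c γ σ‖ ≤ C * (δ * (‖γ‖ + ‖σ‖)) := by
  obtain ⟨C1, hC10, hC1⟩ := exists_bound_rr K
  obtain ⟨C2, hC20, hC2⟩ := exists_bound_qq K
  obtain ⟨C, hC0, hC⟩ := exists_coefs_bound (r := 3)
    (fun a x => (-(2 * a 7 ^ 2 * (a 5 * a 0)) * a 3 + a 6 * a 4) * x 0 + a 6 * x 1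
      + a 6 * a 3 * x 2) (by fun_prop)
    (by intro a x t; simp; ring) K
  refine ⟨2 * (C * (C2 * K + K * (C2 * K) + C1 * K)), by positivity, fun {δ B P c} h γ σ => ?_⟩
  set Q := ‖γ‖ + ‖σ‖
  have hδ := h.δ_pos
  have hw := (hC h ![qq B P c γ σ * ei B c, (1 - B.L * B.U1) * ei B c * (qq B P c γ σ * ei B c),
    rr B P c γ σ * ei B c] (n1 B P c * qq B P c γ σ + n2 B P c * rr B P c γ σ) (by
      intro y; simp [coefs, n1, n2, dA_apply]; ring)).1
  simp only [Fin.sum_univ_three, Matrix.cons_val_zero, Matrix.cons_val_one, Matrix.cons_val_two,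
    Matrix.head_cons, Matrix.tail_cons] at hw
  have hei : l2 (ei B c) ≤ K / δ := by rw [le_div_iff₀ hδ, mul_comm]; exact h.ei_l2
  have e1 : ∀ b : ℝ →ᵇ ℂ, ∀ C', ‖b‖ ≤ C' * (δ ^ 2 * Q) → 
      l2 (b * ei B c : ℝ →ᵇ ℂ) ≤ C' * K * (δ * Q) := fun b C' hb => by
    refine (l2_mul_le_norm_mul _ _).trans ((mul_le_mul hb hei (l2_nonneg _)
      ((norm_nonneg _).trans hb)).trans_eq ?_)
    field_simp
  -- The term with e⁻² is split as ((1 - LU')/e)(q/e), whose first factor is bounded by K.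
  have e2 : l2 ((1 - B.L * B.U1) * ei B c * (qq B P c γ σ * ei B c) : ℝ →ᵇ ℂ)
      ≤ K * l2 (qq B P c γ σ * ei B c : ℝ →ᵇ ℂ) := by
    refine (l2_mul_le_norm_mul _ _).trans (mul_le_mul_of_nonneg_right ?_ (l2_nonneg _))
    refine (BoundedContinuousFunction.norm_le (by positivity)).2 fun y => ?_
    have h1 := h.near y
    have h2 : 0 < ‖ee B c y‖ := norm_pos_iff.2 (h.nondeg.ee_ne y)
    simp only [BoundedContinuousFunction.coe_mul, Pi.mul_apply, norm_mul, h.nondeg.ei_apply,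
      norm_inv, BoundedContinuousFunction.coe_sub, Pi.sub_apply, BoundedContinuousFunction.coe_one,
      Pi.one_apply]
    rwa [← div_eq_mul_inv, div_le_iff₀ h2]
  have f1 := e1 _ _ (hC2 h γ σ)
  have f2 := e1 _ _ (hC1 h γ σ)
  rw [RR]
  refine (norm_primL_le _).trans ?_
  rw [norm_toL2]
  have f3 := mul_le_mul_of_nonneg_left f1 (show 0 ≤ K by positivity)
  calc _ ≤ 2 * (C * (C2 * K * (δ * Q) + K * (C2 * K * (δ * Q)) + C1 * K * (δ * Q))) := by
        refine mul_le_mul_of_nonneg_left (hw.trans ?_) (by norm_num)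
        gcongr
        exact e2.trans f3
    _ = _ := by ring

theorem exists_bound_SS (hK : 1 ≤ K) : ∃ C : ℝ, 0 ≤ C ∧
    ∀ {δ : ℝ} {B : Background} {P : Params} {c : ℂ},
    Regime K δ B P c → ∀ γ σ, ‖SS B P c γ σ‖ ≤ C * (δ * (‖γ‖ + ‖σ‖)) := by
  obtain ⟨C1, hC10, hC1⟩ := exists_bound_RR hK
  obtain ⟨C2, hC20, hC2⟩ := exists_bound_qq K
  obtain ⟨C, hC0, hC⟩ := exists_coefs_bound (r := 2)
    (fun a x => a 6 * a 3 * x 0 - a 5 * x 1) (by fun_prop)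
    (by intro a x t; simp; ring) K
  refine ⟨C * (C2 + C1), by positivity, fun {δ B P c} h γ σ => ?_⟩
  set Q := ‖γ‖ + ‖σ‖ with hQ
  have hQ0 : 0 ≤ Q := by positivity
  have hδ := h.δ_pos
  have h1 := (hC h ![qq B P c γ σ, RR B P c γ σ] (SS B P c γ σ) (by
      intro y; simp [coefs, SS])).2
  simp only [Fin.sum_univ_two, Matrix.cons_val_zero, Matrix.cons_val_one] at h1
  have h2 : δ ^ 2 * Q ≤ δ * Q := by nlinarith [mul_nonneg hδ.le hQ0, h.δ_le]
  calc _ ≤ C * (C2 * (δ * Q) + C1 * (δ * Q)) := by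
        refine h1.trans ?_
        gcongr
        · exact (hC2 h γ σ).trans (by gcongr)
        · exact hC1 h γ σ
    _ = _ := by ring

theorem Regime.norm_Ph_le {δ : ℝ} {B : Background} {P : Params} {c : ℂ} (h : Regime K δ B P c)
    {F : HilbertL2} {N : ℝ} (hN : PSize B c δ (pp B P c F) N) :
    δ ^ 2 * ‖Ph B P c F‖ ≤ (1 + 4 * K ^ 2) * N := by
  have h2 : ‖Ph B P c F‖ ≤ (1 + 4 * K ^ 2)
      * ∫ y, ‖(pp B P c F * ei B c ^ 2 : ℝ →ᵇ ℂ) y‖ ∂chan := by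
    refine (BoundedContinuousFunction.norm_le
      (mul_nonneg (by positivity) (integral_nonneg fun _ => norm_nonneg _))).2 fun y => ?_
    rw [Ph, primL_toL2_apply]
    refine (norm_prim_le (memL2_bcf _).integrable y).trans ?_
    rw [← integral_const_mul]
    refine integral_mono (memL2_bcf _).integrable.norm ((memL2_bcf _).integrable.norm.const_mul _)
      fun y => ?_
    have h3 := h.norm_AA_le y
    simp only [BoundedContinuousFunction.coe_mul, Pi.mul_apply, norm_mul]
    calc _ = ‖AA B P c y‖ * (‖pp B P c F y‖ * ‖(ei B c ^ 2 : ℝ →ᵇ ℂ) y‖) := by ring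
      _ ≤ _ := by gcongr
  have h3 := hN.l1_ei2
  calc _ ≤ δ ^ 2 * ((1 + 4 * K ^ 2) * ∫ y, ‖(pp B P c F * ei B c ^ 2 : ℝ →ᵇ ℂ) y‖ ∂chan) := by
        gcongr
    _ = (1 + 4 * K ^ 2) * (δ ^ 2 * ∫ y, ‖(pp B P c F * ei B c ^ 2 : ℝ →ᵇ ℂ) y‖ ∂chan) := by ring
    _ ≤ _ := by gcongr

/-- Both k² and c are O(δ²), which offsets 1/`disp` = O(δ⁻²) exactly. What remains is `RR` and `SS`,
carrying a factor δ, and the viscous source `Ph`. -/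
theorem exists_bound_new (hK : 1 ≤ K) : ∃ C : ℝ, 0 ≤ C ∧
    ∀ {δ : ℝ} {B : Background} {P : Params} {c : ℂ},
    Regime K δ B P c → ∀ F γ σ, ‖newγ B P c F γ σ‖ + ‖newσ B P c F γ σ‖
      ≤ C * (δ * (‖γ‖ + ‖σ‖) + ‖Ph B P c F‖) := by
  obtain ⟨C1, hC10, hC1⟩ := exists_bound_RR hK
  obtain ⟨C2, hC20, hC2⟩ := exists_bound_SS hK
  obtain ⟨C, hC0, hC⟩ := exists_coefs_bound (r := 2)
    (fun a x => a 5 * x 0 - a 5 ^ 2 * x 1) (by fun_prop)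
    (by intro a x t; simp; ring) K
  refine ⟨K * (K ^ 2 * (4 * (C * (C2 + 1)))) + K * (K * K * K * (C1 + 1)) + C * (C2 + 1),
    by positivity, fun {δ B P c} h F γ σ => ?_⟩
  have hδ := h.δ_pos
  set Q := ‖γ‖ + ‖σ‖ with hQ
  set T := δ * Q + ‖Ph B P c F‖ with hT
  have hQ0 : 0 ≤ δ * Q := by positivity
  have hP0 : 0 ≤ ‖Ph B P c F‖ := norm_nonneg _
  have hT0 : 0 ≤ T := by positivity
  set w := ee B c * SS B P c γ σ - ee B c ^ 2 * Ph B P c F with hw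
  have h1 := (hC h ![SS B P c γ σ, Ph B P c F] w (by intro y; simp [coefs, hw])).2
  simp only [Fin.sum_univ_two, Matrix.cons_val_zero, Matrix.cons_val_one] at h1
  have h2 : ‖w‖ ≤ C * (C2 + 1) * T := by
    refine h1.trans ?_
    rw [mul_assoc]
    gcongr
    have := hC2 h γ σ
    nlinarith
  have hσ : newσ B P c F γ σ = -w := by rw [hw, newσ]; abel
  have h3 : ‖primL (toL2 w) 1‖ ≤ 4 * (C * (C2 + 1) * T) :=
    ((BoundedContinuousFunction.norm_coe_le_norm _ _).trans (norm_primL_toL2_le w)).trans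
      (by gcongr)
  have h4 : ‖RR B P c γ σ 1 + Ph B P c F 1‖ ≤ (C1 + 1) * T := by
    refine (norm_add_le _ _).trans ?_
    have := (BoundedContinuousFunction.norm_coe_le_norm (RR B P c γ σ) 1).trans (hC1 h γ σ)
    have := BoundedContinuousFunction.norm_coe_le_norm (Ph B P c F) 1
    nlinarith
  have hd : δ ^ 2 * ‖(disp B P c)⁻¹‖ ≤ K := by
    have h5 : 0 < ‖disp B P c‖ := norm_pos_iff.2 h.nondeg.disp_ne
    rw [norm_inv, ← div_eq_mul_inv, div_le_iff₀ h5]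
    exact h.disp_lo
  have hA : ‖(Ab P c)⁻¹‖ ≤ K := by
    have h5 : 0 < ‖Ab P c‖ := norm_pos_iff.2 h.nondeg.Ab_ne
    rw [norm_inv, inv_le_iff_one_le_mul₀ h5]
    exact h.Ab_lo
  have hk : ‖(P.k : ℂ) ^ 2‖ ≤ K ^ 2 * δ ^ 2 := by
    rw [norm_pow, Complex.norm_real, Real.norm_of_nonneg h.k_pos.le, ← mul_pow]
    exact pow_le_pow_left₀ h.k_pos.le h.k_hi 2
  have hγ : ‖newγ B P c F γ σ‖ ≤ ‖(disp B P c)⁻¹‖ * (K ^ 2 * δ ^ 2 * (4 * (C * (C2 + 1) * T))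
      + K * δ ^ 2 * K * K * ((C1 + 1) * T)) := by
    rw [newγ, norm_mul]
    gcongr
    refine (norm_sub_le _ _).trans ?_
    rw [norm_mul, norm_mul, norm_mul, norm_mul]
    have := h.c_hi
    have := (B.U1.norm_coe_le_norm 1).trans h.U1_le
    have := h.K_pos
    gcongr
  rw [hσ, norm_neg]
  have : ‖(disp B P c)⁻¹‖ * (K ^ 2 * δ ^ 2 * (4 * (C * (C2 + 1) * T))
      + K * δ ^ 2 * K * K * ((C1 + 1) * T)) = (δ ^ 2 * ‖(disp B P c)⁻¹‖) *
      (K ^ 2 * (4 * (C * (C2 + 1) * T)) + K * K * K * ((C1 + 1) * T)) := by ring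
  calc _ ≤ K * (K ^ 2 * (4 * (C * (C2 + 1) * T)) + K * K * K * ((C1 + 1) * T))
        + C * (C2 + 1) * T := by
        refine add_le_add (hγ.trans ?_) h2
        rw [this]
        gcongr
    _ = _ := by ring

theorem exists_bound_Phi (hK : 1 ≤ K) : ∃ C : ℝ, 0 ≤ C ∧
    ∀ {δ : ℝ} {B : Background} {P : Params} {c : ℂ},
    Regime K δ B P c → ∀ F γ σ, ‖Phi B P c F γ σ‖ ≤ C * (‖γ‖ + ‖σ‖ + ‖Ph B P c F‖) := by
  obtain ⟨C1, hC10, hC1⟩ := exists_bound_RR hK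
  obtain ⟨C2, hC20, hC2⟩ := exists_bound_qq K
  obtain ⟨C, hC0, hC⟩ := exists_coefs_bound (r := 4)
    (fun a x => -((1 - a 7 ^ 2 * a 12 ^ 2) * x 0) - a 6 * a 3 * x 1 + x 2 + x 3) (by fun_prop)
    (by intro a x t; simp; ring) K
  refine ⟨C * (1 + C2 * K + C1 + 1), by positivity, fun {δ B P c} h F γ σ => ?_⟩
  have hδ := h.δ_pos
  set Q := ‖γ‖ + ‖σ‖ with hQ
  have hQ0 : 0 ≤ Q := by positivity
  have hP0 : 0 ≤ ‖Ph B P c F‖ := norm_nonneg _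
  have h1 := (hC h ![γ • 1, qq B P c γ σ * ei B c, RR B P c γ σ, Ph B P c F] (Phi B P c F γ σ)
    (by intro y; simp [coefs, Phi, Ab]; ring)).2
  simp only [Fin.sum_univ_four, Matrix.cons_val_zero, Matrix.cons_val_one, Matrix.cons_val,
    norm_smul_one] at h1
  -- The wall term is of order one, not small: q = O(δ²) against sup |1/e| = O(δ⁻²).
  have h2 : ‖qq B P c γ σ * ei B c‖ ≤ C2 * K * Q := by
    refine (BoundedContinuousFunction.norm_le (by positivity)).2 fun y => ?_
    have h3 := ((qq B P c γ σ).norm_coe_le_norm y).trans (hC2 h γ σ)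
    have h4 := h.norm_ei_le y
    rw [BoundedContinuousFunction.coe_mul, Pi.mul_apply, norm_mul]
    calc _ ≤ C2 * (δ ^ 2 * Q) * ‖ei B c y‖ := by gcongr
      _ = C2 * (δ ^ 2 * ‖ei B c y‖) * Q := by ring
      _ ≤ _ := by gcongr
  have h3 : ‖RR B P c γ σ‖ ≤ C1 * Q := (hC1 h γ σ).trans (by
    gcongr; exact mul_le_of_le_one_left hQ0 h.δ_le)
  have h4 : ‖γ‖ ≤ Q := by rw [hQ]; linarith [norm_nonneg σ]
  calc _ ≤ C * (Q + C2 * K * Q + C1 * Q + ‖Ph B P c F‖) := h1.trans (by gcongr)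
    _ ≤ C * ((1 + C2 * K + C1 + 1) * (Q + ‖Ph B P c F‖)) := by
        gcongr
        have : 0 ≤ (C2 * K + C1 + 1) * ‖Ph B P c F‖ := by positivity
        nlinarith
    _ = _ := by ring

end

/-! ### Bounds for the viscous vorticity. -/

section

variable {K δ : ℝ} {B : Background} {P : Params} {c : ℂ}

/-- Bounds of size `S` for the viscous vorticity generated by `F`. -/
structure ViscSize (B : Background) (P : Params) (c : ℂ) (δ : ℝ) (F : HilbertL2) (S : ℝ) :
    Prop where
  pp_size : PSize B c δ (pp B P c F) (δ ^ 2 * S)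
  om_le : l2 (om B P c F) ≤ S
  th_le : δ ^ 2 * ‖th B P c F‖ ≤ S

theorem ViscSize.mono {F : HilbertL2} {S S' : ℝ} (h : ViscSize B P c δ F S) (hS : S ≤ S') :
    ViscSize B P c δ F S' :=
  ⟨h.1.mono (mul_le_mul_of_nonneg_left hS (sq_nonneg _)), h.2.trans hS, h.3.trans hS⟩

theorem th_add (F G : HilbertL2) : th B P c (F + G) = th B P c F + th B P c G := map_add _ _ _

theorem om_add (F G : HilbertL2) : om B P c (F + G) = om B P c F + om B P c G := by
  rw [om, th_add, map_add, om, om]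

theorem pp_add (F G : HilbertL2) : pp B P c (F + G) = pp B P c F + pp B P c G := by
  rw [pp, om_add, mul_add, map_add, map_add, pp, pp]

theorem ViscSize.add {F G : HilbertL2} {S T : ℝ} (hδ : 0 < δ) (h : ViscSize B P c δ F S)
    (h' : ViscSize B P c δ G T) : ViscSize B P c δ (F + G) (S + T) := by
  refine ⟨?_, ?_, ?_⟩
  · rw [pp_add, mul_add]; exact h.1.add hδ h'.1
  · rw [om_add]
    exact (l2_add_le (memL2_bcf _) (memL2_bcf _)).trans (add_le_add h.2 h'.2)
  · rw [th_add]
    have := mul_le_mul_of_nonneg_left (norm_add_le (th B P c F) (th B P c G)) (sq_nonneg δ)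
    linarith [h.3, h'.3]

namespace Regime

variable (h : Regime K δ B P c)
include h

theorem visc_lo : δ ^ 6 ≤ K * (P.ε / P.k) := by
  have := h.k_pos
  have h1 : P.ε / P.k * P.k = δ ^ 7 := by rw [div_mul_cancel₀ _ this.ne', h.ε_eq]
  have h2 := h.k_hi
  have hδ := h.δ_pos
  have h3 : P.ε / P.k * P.k ≤ P.ε / P.k * (K * δ) :=
    mul_le_mul_of_nonneg_left h2 h.nondeg.ν_pos.le
  have h4 : δ ^ 6 * δ ≤ K * (P.ε / P.k) * δ := by nlinarith
  exact le_of_mul_le_mul_right h4 hδ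

theorem visc_hi : P.ε / P.k ≤ K * δ ^ 6 := by
  rw [div_le_iff₀ h.k_pos, h.ε_eq]
  have h1 := h.k_lo
  have h2 : 0 ≤ δ ^ 6 := pow_nonneg h.δ_pos.le 6
  nlinarith

/-- With ν ~ δ⁶ and ν Im c ~ δ⁸, the energy bounds give ‖θ‖ ≲ δ⁻⁶‖F‖ and ‖ω‖ ≲ δ⁻⁴‖F‖. The pressure
iνθ - F is only square integrable, of size ‖F‖, so it enters `Regime.psize` entirely as the L² part.
-/
theorem viscSize (F : HilbertL2) : ViscSize B P c δ F (6 * K ^ 3 * ((δ ^ 4)⁻¹ * ‖F‖)) := by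
  have hδ := h.δ_pos
  have hν := h.nondeg.ν_pos
  have hs := h.im_pos
  have hK := h.K_one
  have b1 : P.ε / P.k * ‖th B P c F‖ ≤ ‖F‖ :=
    norm_viscInv_le hν hs.le (ee_im h.valid) F
  have b2 : P.ε / P.k * c.im * l2 (om B P c F) ^ 2 ≤ ‖F‖ ^ 2 :=
    l2_prim_viscInv_le hν hs.le (ee_im h.valid) F
  have hK3 : K ≤ K ^ 3 := by nlinarith [sq_nonneg K]
  have hK23 : K ^ 2 ≤ K ^ 3 := by nlinarith [sq_nonneg K]
  set M := (δ ^ 4)⁻¹ * ‖F‖ with hM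
  have hM0 : 0 ≤ M := by positivity
  have hF : ‖F‖ = δ ^ 4 * M := by rw [hM]; field_simp
  refine ⟨?_, ?_, ?_⟩
  · have hp := h.psize (p := pp B P c F) (pb := 0)
      (pa := fun y => Complex.I * ((P.ε / P.k : ℝ) : ℂ) * th B P c F y + -F y)
      (N := 2 * δ ^ 3 * M)
      (((memL2_coe (th B P c F)).const_mul _).add (memL2_coe F).neg) (by
        filter_upwards [h.nondeg.visc_eq F] with y hy
        rw [hy]; simp) (by
        refine (l2_add_le ((memL2_coe (th B P c F)).const_mul _) (memL2_coe F).neg).trans ?_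
        have h1 := l2_le_mul (f := fun y => Complex.I * ((P.ε / P.k : ℝ) : ℂ) * th B P c F y)
          hν.le (memL2_coe (th B P c F)) (.of_forall fun y => by
            rw [norm_mul, norm_mul, Complex.norm_I, one_mul, Complex.norm_real,
              Real.norm_of_nonneg hν.le])
        have h2 := l2_le_mul (f := fun y => -F y) zero_le_one (memL2_coe F)
          (.of_forall fun y => by rw [norm_neg, one_mul])
        rw [l2_coe] at h1 h2
        rw [hF] at b1 h2
        change _ + l2 (fun y => -F y) ≤ _
        linarith) (by rw [norm_zero]; positivity)
    refine hp.mono ?_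
    have : 3 * K ^ 2 * (2 * δ ^ 3 * M) = (6 * (δ ^ 2 * M)) * (K ^ 2 * δ) := by ring
    rw [this]
    have h1 : K ^ 2 * δ ≤ K ^ 3 := by nlinarith [h.δ_le, sq_nonneg K]
    calc _ ≤ (6 * (δ ^ 2 * M)) * K ^ 3 := by gcongr
      _ = _ := by ring
  · have h1 : (δ ^ 4 * l2 (om B P c F)) ^ 2 ≤ (K * ‖F‖) ^ 2 := by
      have h3 : δ ^ 6 * δ ^ 2 ≤ (K * (P.ε / P.k)) * (K * c.im) :=
        mul_le_mul h.visc_lo h.im_lo (by positivity) (by positivity)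
      calc (δ ^ 4 * l2 (om B P c F)) ^ 2 = δ ^ 6 * δ ^ 2 * l2 (om B P c F) ^ 2 := by ring
        _ ≤ (K * (P.ε / P.k)) * (K * c.im) * l2 (om B P c F) ^ 2 := by gcongr
        _ = K ^ 2 * (P.ε / P.k * c.im * l2 (om B P c F) ^ 2) := by ring
        _ ≤ K ^ 2 * ‖F‖ ^ 2 := by gcongr
        _ = _ := by ring
    have h2 := le_of_abs_le (abs_le_of_sq_le_sq h1 (by positivity))
    rw [hF] at h2
    have h3 : l2 (om B P c F) ≤ K * M :=
      le_of_mul_le_mul_left (by linarith) (pow_pos hδ 4)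
    nlinarith
  · have h1 : δ ^ 6 * ‖th B P c F‖ ≤ K * ‖F‖ := by
      calc _ ≤ K * (P.ε / P.k) * ‖th B P c F‖ := by gcongr; exact h.visc_lo
        _ = K * (P.ε / P.k * ‖th B P c F‖) := by ring
        _ ≤ _ := by gcongr
    rw [hF] at h1
    have h3 : δ ^ 2 * ‖th B P c F‖ ≤ K * M :=
      le_of_mul_le_mul_left (by linarith) (pow_pos hδ 4)
    nlinarith

/-- Now ‖ω‖ ≲ δ⁻²‖W‖ and ‖θ‖ ≲ δ⁻⁴‖W‖. The forcing itself is bounded, so in p = iνθ - F only the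
small term iνθ, of size δ²‖W‖, has to be treated as an L² part. -/
theorem viscSize_coprim (W : HilbertL2) :
    ViscSize B P c δ (-toL2 (coprimL W)) (12 * K ^ 4 * ((δ ^ 2)⁻¹ * ‖W‖)) := by
  have hδ := h.δ_pos
  have hν := h.nondeg.ν_pos
  have hs := h.im_pos
  have hK := h.K_one
  set F := -toL2 (coprimL W) with hFd
  obtain ⟨b1, b2⟩ := visc_energy_coprim hν hs.le (ee_im h.valid) W
  change c.im * l2 (om B P c F) ≤ ‖W‖ at b1
  change P.ε / P.k * c.im * ‖th B P c F‖ ^ 2 ≤ ‖W‖ ^ 2 at b2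
  have hK2 : K ≤ K ^ 2 := by nlinarith
  have hK4 : K ^ 2 ≤ K ^ 4 := by nlinarith [sq_nonneg (K ^ 2)]
  set M := (δ ^ 2)⁻¹ * ‖W‖ with hM
  have hM0 : 0 ≤ M := by positivity
  have hW : ‖W‖ = δ ^ 2 * M := by rw [hM]; field_simp
  have hKM : K * M ≤ 12 * K ^ 4 * M := by
    have := mul_le_mul_of_nonneg_right (hK2.trans hK4) hM0
    nlinarith
  have hθ : δ ^ 4 * ‖th B P c F‖ ≤ K * ‖W‖ := by
    refine le_of_abs_le (abs_le_of_sq_le_sq ?_ (by positivity))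
    have h3 : δ ^ 6 * δ ^ 2 ≤ (K * (P.ε / P.k)) * (K * c.im) :=
      mul_le_mul h.visc_lo h.im_lo (by positivity) (by positivity)
    calc (δ ^ 4 * ‖th B P c F‖) ^ 2 = δ ^ 6 * δ ^ 2 * ‖th B P c F‖ ^ 2 := by ring
      _ ≤ (K * (P.ε / P.k)) * (K * c.im) * ‖th B P c F‖ ^ 2 := by gcongr
      _ = K ^ 2 * (P.ε / P.k * c.im * ‖th B P c F‖ ^ 2) := by ring
      _ ≤ K ^ 2 * ‖W‖ ^ 2 := by gcongr
      _ = _ := by ring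
  refine ⟨?_, ?_, ?_⟩
  · have hp := h.psize (p := pp B P c F) (pb := coprimL W)
      (pa := fun y => Complex.I * ((P.ε / P.k : ℝ) : ℂ) * th B P c F y)
      (N := 4 * K ^ 2 * ‖W‖)
      ((memL2_coe (th B P c F)).const_mul _) (by
        have e1 := Lp.coeFn_neg (toL2 (coprimL W))
        filter_upwards [h.nondeg.visc_eq F, e1, coeFn_toL2 (coprimL W)] with y hy h1 h2
        rw [hy, hFd, h1, Pi.neg_apply, h2]; ring) (by
        have h1 := l2_le_mul (f := fun y => Complex.I * ((P.ε / P.k : ℝ) : ℂ) * th B P c F y)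
          hν.le (memL2_coe (th B P c F)) (.of_forall fun y => by
            rw [norm_mul, norm_mul, Complex.norm_I, one_mul, Complex.norm_real,
              Real.norm_of_nonneg hν.le])
        rw [l2_coe] at h1
        refine h1.trans ?_
        calc _ ≤ K * δ ^ 6 * ‖th B P c F‖ := by gcongr; exact h.visc_hi
          _ = K * δ ^ 2 * (δ ^ 4 * ‖th B P c F‖) := by ring
          _ ≤ K * δ ^ 2 * (K * ‖W‖) := by gcongr
          _ = δ * (δ * (K ^ 2 * ‖W‖)) := by ring
          _ ≤ δ * (1 * (K ^ 2 * ‖W‖)) := by gcongr; exact h.δ_le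
          _ ≤ _ := by
            have : 0 ≤ δ * (K ^ 2 * ‖W‖) := by positivity
            linarith) (by
        refine (norm_coprimL_le W).trans ?_
        gcongr
        nlinarith)
    refine hp.mono (le_of_eq ?_)
    rw [hW]; ring
  · have h1 : δ ^ 2 * l2 (om B P c F) ≤ K * ‖W‖ := by
      calc _ ≤ K * c.im * l2 (om B P c F) := by
            gcongr
            · exact l2_nonneg _
            · exact h.im_lo
        _ = K * (c.im * l2 (om B P c F)) := by ring
        _ ≤ _ := by gcongr
    rw [hW] at h1
    exact (le_of_mul_le_mul_left (by linarith) (pow_pos hδ 2)).trans hKM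
  · rw [hW] at hθ
    have h3 : δ ^ 2 * ‖th B P c F‖ ≤ K * M :=
      le_of_mul_le_mul_left (by linarith) (pow_pos hδ 2)
    exact h3.trans hKM

end Regime

end

/-! ### Bounds for the building blocks of the fields. -/

section

variable {K : ℝ}

theorem exists_coefs_l2_bound {r : ℕ} (p : (Fin 13 → ℂ) → (Fin r → ℂ) → ℂ)
    (hp : Continuous fun z : (Fin 13 → ℂ) × (Fin r → ℂ) => p z.1 z.2)
    (hom : ∀ a x (t : ℂ), p a (t • x) = t * p a x) (K : ℝ) :
    ∃ C : ℝ, 0 ≤ C ∧ ∀ {δ : ℝ} {B : Background} {P : Params} {c : ℂ}, Regime K δ B P c →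
      ∀ (x : Fin r → ℝ → ℂ) (f : ℝ → ℂ), (∀ i, MemL2 (x i)) →
        (∀ y, f y = p (coefs B P c y) (fun i => x i y)) → l2 f ≤ C * ∑ i, l2 (x i) := by
  obtain ⟨C, hC, h1⟩ := exists_l2_bound p hp hom (5 * K ^ 2)
  exact ⟨C, hC, fun {δ B P c} h x f hx hf =>
    h1 (coefs B P c) x f h.coefs_le hx (.of_forall hf)⟩

theorem norm_mulL2_le (b : ℝ →ᵇ ℂ) (g : HilbertL2) : ‖mulL2 b g‖ ≤ ‖b‖ * ‖g‖ := by
  rw [← l2_coe, ← l2_coe, l2_congr (coeFn_mulL2 b g)]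
  refine l2_le_mul (norm_nonneg _) (memL2_coe g) (.of_forall fun y => ?_)
  rw [norm_mul]
  gcongr
  exact b.norm_coe_le_norm y

/-- Bounds for all unknowns. -/
structure Unknowns.Size (B : Background) (P : Params) (c : ℂ) (δ : ℝ) (X : Unknowns)
    (S r Y : ℝ) : Prop where
  visc : ViscSize B P c δ X.F S
  invisc : ‖X.γ‖ + ‖X.σ‖ ≤ S
  data : ‖X.α‖ + ‖X.g0‖ ≤ r
  forcing : ‖X.gt‖ ≤ Y

/-- Bounds for the building blocks of the solution. -/
structure Unknowns.Parts (B : Background) (P : Params) (c : ℂ) (δ : ℝ) (X : Unknowns)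
    (S r Y : ℝ) : Prop where
  S0 : 0 ≤ S
  r0 : 0 ≤ r
  Y0 : 0 ≤ Y
  hΦ : l2 (ΦΦ B P c X) ≤ S
  hq : l2 (qX B P c X) ≤ S
  hqp : l2 (qp B P c X) ≤ S
  hqe : l2 (qp B P c X * ei B c : ℝ →ᵇ ℂ) ≤ S
  hΦ1 : δ * l2 (Φ1 B P c X) ≤ S
  ho : l2 (oX B P c X) ≤ S
  hth : δ ^ 2 * l2 (th B P c X.F) ≤ S
  hρ : l2 (ρ0 X) ≤ r
  hG : l2 (Gt X) ≤ Y
  hμ : ‖μμ B P c X‖ ≤ Y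
  hvr : l2 (vr B P c X) ≤ δ * Y
  hg0 : l2 X.g0 ≤ r
  hgt : l2 X.gt ≤ Y

/-- The pressure q + p has `PSize` of order δ²S, so dividing by e costs nothing relative to S and
dividing by e² costs 1/δ. Thus Φ' and θ are the only blocks with a loss, 1/δ and 1/δ² respectively.
-/
theorem exists_parts (hK : 1 ≤ K) : ∃ C : ℝ, 1 ≤ C ∧
    ∀ {δ : ℝ} {B : Background} {P : Params} {c : ℂ}, Regime K δ B P c →
    ∀ {X : Unknowns} {S r Y : ℝ}, X.Size B P c δ S r Y → X.Parts B P c δ (C * S) (C * r) (C * Y) := by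
  obtain ⟨C1, hC10, hC1⟩ := exists_bound_Phi hK
  obtain ⟨C2, hC20, hC2⟩ := exists_bound_qq K
  set D := 1 + 4 * K ^ 2 with hD
  have hD1 : 1 ≤ D := by rw [hD]; nlinarith [sq_nonneg K]
  set E1 := 2 * (C1 * (1 + D)) with hE1
  set E2 := 3 * K ^ 2 * C2 + 1 with hE2
  set E3 := 8 * K with hE3
  set E4 := 2 * (K * (4 * (E3 + 2 * K * 2))) with hE4
  have k0 : 0 ≤ E1 := by positivity
  have k2 : 1 ≤ E2 := by rw [hE2]; linarith [show 0 ≤ 3 * K ^ 2 * C2 by positivity]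
  have k3 : 1 ≤ E3 := by rw [hE3]; linarith
  have k4 : 0 ≤ E4 := by positivity
  have k5 : 0 ≤ 2 * C2 := by positivity
  have k6 : E2 ≤ D * E2 := by nlinarith
  refine ⟨E1 + 2 * C2 + D * E2 + E3 + E4 + 4, by linarith,
    fun {δ B P c} h {X S r Y} hX => ?_⟩
  set C := E1 + 2 * C2 + D * E2 + E3 + E4 + 4 with hC
  have hδ := h.δ_pos
  have hδ1 := h.δ_le
  have hm := h.m_le
  have hm0 := h.m_pos
  have hS : 0 ≤ S := (add_nonneg (norm_nonneg _) (norm_nonneg _)).trans hX.invisc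
  have hr : 0 ≤ r := (add_nonneg (norm_nonneg _) (norm_nonneg _)).trans hX.data
  have hY : 0 ≤ Y := (norm_nonneg _).trans hX.forcing
  have hPh : ‖Ph B P c X.F‖ ≤ D * S := by
    have := h.norm_Ph_le hX.visc.pp_size
    exact le_of_mul_le_mul_left (by linarith) (pow_pos hδ 2)
  have hΦ : ‖ΦΦ B P c X‖ ≤ C1 * (1 + D) * S := by
    refine (hC1 h X.F X.γ X.σ).trans ?_
    rw [mul_assoc]
    gcongr
    linarith [hX.invisc]
  have hq : ‖qX B P c X‖ ≤ C2 * (δ ^ 2 * S) := (hC2 h X.γ X.σ).trans (by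
    gcongr; exact hX.invisc)
  have hqp : PSize B c δ (qp B P c X) (E2 * (δ ^ 2 * S)) := by
    have h1 := (h.psize_bcf (qX B P c X)).mono (N' := 3 * K ^ 2 * (C2 * (δ ^ 2 * S))) (by gcongr)
    refine (h1.add hδ hX.visc.pp_size).mono (le_of_eq ?_)
    rw [hE2]; ring
  have hd2 : δ ^ 2 * S ≤ S := mul_le_of_le_one_left hS (h.pow_le_one 2)
  have cle : ∀ {a T : ℝ}, 0 ≤ T → a ≤ C → a * T ≤ C * T := fun hT ha =>
    mul_le_mul_of_nonneg_right ha hT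
  have hG : ‖Gt X‖ ≤ 2 * Y := (norm_primL_le _).trans (by linarith [hX.forcing])
  have hε : ‖ee B c‖ ≤ 2 * K :=
    (BoundedContinuousFunction.norm_le (by positivity)).2 h.norm_ee_le
  have hm2 : P.m ^ 2 ≤ 1 := pow_le_one₀ hm0.le hm
  have hmn : ‖(P.m : ℂ) ^ 2‖ ≤ 1 := by
    rw [norm_pow, Complex.norm_real, Real.norm_of_nonneg hm0.le]; exact hm2
  have heG : ‖ee B c * Gt X‖ ≤ 2 * K * (2 * Y) := (norm_mul_le _ _).trans (by gcongr)
  have hμ : ‖μμ B P c X‖ ≤ E3 * Y := by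
    rw [μμ, norm_neg, norm_mul, norm_mul]
    have h1 := ((primL (toL2 (ee B c * Gt X))).norm_coe_le_norm 1).trans (norm_primL_toL2_le _)
    have h2 : ‖(1 / 2 : ℂ)‖ = 1 / 2 := by norm_num
    rw [h2]
    calc _ ≤ 1 / 2 * 1 * (4 * (2 * K * (2 * Y))) := by
          gcongr
          linarith
      _ = _ := by rw [hE3]; ring
  have hvr : ‖vr B P c X‖ ≤ K * δ * (4 * (E3 * Y + 2 * K * (2 * Y))) := by
    rw [vr, norm_neg, norm_smul, norm_mul, Complex.norm_I, one_mul, Complex.norm_real,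
      Real.norm_of_nonneg h.k_pos.le]
    refine mul_le_mul h.k_hi ((norm_primL_toL2_le _).trans ?_) (norm_nonneg _) (by positivity)
    gcongr
    refine (norm_add_le _ _).trans ?_
    rw [norm_smul_one, norm_smul]
    have : ‖(P.m : ℂ) ^ 2‖ * ‖ee B c * Gt X‖ ≤ 1 * (2 * K * (2 * Y)) := by gcongr
    linarith
  have hρ : ‖ρ0 X‖ ≤ 2 * r := by
    refine (norm_add_le _ _).trans ?_
    rw [norm_smul_one]
    linarith [norm_primL_le X.g0, hX.data, norm_nonneg X.α]
  refine ⟨by positivity, by positivity, by positivity, ?_, ?_, ?_, ?_, ?_, ?_, ?_, ?_, ?_, ?_, ?_, ?_, ?_⟩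
  · refine (l2_bcf_le _).trans (le_trans (b := E1 * S) ?_ (cle hS (by linarith)))
    rw [hE1]; linarith
  · refine (l2_bcf_le _).trans (le_trans (b := 2 * C2 * S) ?_ (cle hS (by linarith)))
    have := mul_le_mul_of_nonneg_left hd2 hC20
    linarith
  · refine hqp.l2_le.trans (le_trans (b := E2 * S) (by gcongr) (cle hS (by linarith)))
  · have h1 : δ * l2 (qp B P c X * ei B c : ℝ →ᵇ ℂ) ≤ δ * (E2 * (δ * S)) := by
      have := hqp.l2_ei; linarith
    have h2 := le_of_mul_le_mul_left h1 hδ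
    refine h2.trans (le_trans (b := E2 * S) ?_ (cle hS (by linarith)))
    gcongr
    exact mul_le_of_le_one_left hS hδ1
  · have h1 : l2 (Φ1 B P c X) ≤ D * l2 (qp B P c X * ei B c ^ 2 : ℝ →ᵇ ℂ) := by
      refine l2_le_mul (by positivity) (memL2_bcf _) (.of_forall fun y => ?_)
      have := h.norm_AA_le y
      simp only [Φ1, BoundedContinuousFunction.coe_mul, Pi.mul_apply, norm_mul, mul_assoc]
      gcongr
    have h2 : δ ^ 2 * (δ * l2 (qp B P c X * ei B c ^ 2 : ℝ →ᵇ ℂ)) ≤ δ ^ 2 * (E2 * S) := by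
      have := hqp.l2_ei2; linarith
    have h3 := le_of_mul_le_mul_left h2 (pow_pos hδ 2)
    calc _ ≤ δ * (D * l2 (qp B P c X * ei B c ^ 2 : ℝ →ᵇ ℂ)) := by gcongr
      _ = D * (δ * l2 (qp B P c X * ei B c ^ 2 : ℝ →ᵇ ℂ)) := by ring
      _ ≤ D * (E2 * S) := by gcongr
      _ = D * E2 * S := by ring
      _ ≤ _ := cle hS (by linarith)
  · exact hX.visc.om_le.trans (by nlinarith)
  · rw [l2_coe]; exact hX.visc.th_le.trans (by nlinarith)
  · exact (l2_bcf_le _).trans (le_trans (b := 4 * r) (by linarith) (cle hr (by linarith)))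
  · exact (l2_bcf_le _).trans (le_trans (b := 4 * Y) (by linarith) (cle hY (by linarith)))
  · exact hμ.trans (cle hY (by linarith))
  · refine (l2_bcf_le _).trans (le_trans (b := δ * (E4 * Y)) ?_ ?_)
    · rw [hE4]
      linarith
    · exact mul_le_mul_of_nonneg_left (cle hY (by linarith)) hδ.le
  · rw [l2_coe]
    have : 1 * r ≤ C * r := cle hr (by linarith)
    linarith [hX.data, norm_nonneg X.α]
  · rw [l2_coe]
    have : 1 * Y ≤ C * Y := cle hY (by linarith)
    linarith [hX.forcing]

end

/-! ### Bounds for the solution, its derivatives and the residual. -/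

section

variable {K : ℝ}

/-- Bounds for the derivatives of the stream function. -/
theorem exists_bound_stream (K : ℝ) : ∃ C : ℝ, 0 ≤ C ∧
    ∀ {δ : ℝ} {B : Background} {P : Params} {c : ℂ}, Regime K δ B P c →
    ∀ {X : Unknowns} {S r Y : ℝ}, X.Parts B P c δ S r Y →
      l2 (Psi1 B P c X) ≤ C * S ∧ l2 (Psi2 B P c X) ≤ C * S ∧ δ * l2 (Z0 B P c X) ≤ C * S ∧
      δ * l2 (X2 B P c X) ≤ C * (S + δ * r) := by
  obtain ⟨C1, hC10, hC1⟩ := exists_coefs_bound (r := 2)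
    (fun a x => -(a 0 * x 0) - a 6 * x 1) (by fun_prop) (by intro a x t; simp; ring) K
  obtain ⟨C2, hC20, hC2⟩ := exists_coefs_bound (r := 3)
    (fun a x => -(a 1 * x 0) + 2 * a 7 ^ 2 * (a 0 * x 1) - a 8 ^ 2 * (a 6 * a 5 * x 0) + a 6 * x 2)
    (by fun_prop) (by intro a x t; simp; ring) K
  obtain ⟨C3, hC30, hC3⟩ := exists_coefs_bound (r := 4)
    (fun a x => -(a 2 * x 0) - a 1 * x 1 + 2 * a 7 ^ 2 * (a 1 * x 2)
      + 2 * a 7 ^ 2 * (a 0 * (a 8 ^ 2 * (a 5 ^ 2 * x 0) - a 5 * x 3))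
      - a 8 ^ 2 * ((-(2 * a 7 ^ 2 * (a 5 * a 0)) * a 5 + a 6 * a 0) * x 0 + a 6 * a 5 * x 1)
      + -(2 * a 7 ^ 2 * (a 5 * a 0)) * x 3)
    (by fun_prop) (by intro a x t; simp; ring) K
  obtain ⟨C4, hC40, hC4⟩ := exists_coefs_bound (r := 4)
    (fun a x => a 1 * (x 0 + x 1) + a 8 ^ 2 * (4 * (a 0 * a 5 ^ 2 * x 2) + a 5 ^ 3 * x 3))
    (by fun_prop) (by intro a x t; simp; ring) K
  refine ⟨2 * C1 + 3 * C2 + 4 * C3 + 3 * C4, by positivity, fun {δ B P c} h {X S r Y} hX => ?_⟩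
  have hS := hX.S0
  have hr := hX.r0
  have hδ := h.δ_pos
  have hd : ∀ {a : ℝ}, a ≤ S → δ * a ≤ S := fun {a} ha =>
    (mul_le_mul_of_nonneg_left ha hδ.le).trans (mul_le_of_le_one_left hS h.δ_le)
  have p1 : 0 ≤ C1 * S := by positivity
  have p2 : 0 ≤ C2 * S := by positivity
  have p3 : 0 ≤ C3 * S := by positivity
  have p4 : 0 ≤ C4 * S := by positivity
  refine ⟨?_, ?_, ?_, ?_⟩
  · have := (hC1 h ![ΦΦ B P c X, qp B P c X * ei B c] (Psi1 B P c X)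
      (by intro y; simp [coefs, Psi1]; ring)).1
    simp only [Fin.sum_univ_succ, Fin.sum_univ_zero, Matrix.cons_val_zero, Matrix.cons_val_succ] at this
    have h2 := mul_le_mul_of_nonneg_left (add_le_add hX.hΦ hX.hqe) hC10
    linarith
  · have := (hC2 h ![ΦΦ B P c X, qp B P c X, oX B P c X] (Psi2 B P c X)
      (by intro y; simp [coefs, Psi2])).1
    simp only [Fin.sum_univ_succ, Fin.sum_univ_zero, Matrix.cons_val_zero, Matrix.cons_val_succ] at this
    have h2 := mul_le_mul_of_nonneg_left (add_le_add hX.hΦ (add_le_add hX.hqp hX.ho)) hC20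
    linarith
  · have := (hC3 h ![ΦΦ B P c X, Φ1 B P c X, qp B P c X, oX B P c X] (Z0 B P c X)
      (by intro y; simp [coefs, Z0, dA_apply]; ring)).1
    simp only [Fin.sum_univ_succ, Fin.sum_univ_zero, Matrix.cons_val_zero, Matrix.cons_val_succ] at this
    have h2 := mul_le_mul_of_nonneg_left (add_le_add (hd hX.hΦ) (add_le_add hX.hΦ1
      (add_le_add (hd hX.hqp) (hd hX.ho)))) hC30
    have h3 := mul_le_mul_of_nonneg_left this hδ.le
    linarith
  · have := (hC4 h ![qX B P c X, ρ0 X, ΦΦ B P c X, Φ1 B P c X] (X2 B P c X)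
      (by intro y; simp [coefs, X2]; ring)).1
    simp only [Fin.sum_univ_succ, Fin.sum_univ_zero, Matrix.cons_val_zero, Matrix.cons_val_succ] at this
    have h2 := mul_le_mul_of_nonneg_left (add_le_add (hd hX.hq)
      (add_le_add (mul_le_mul_of_nonneg_left hX.hρ hδ.le) (add_le_add (hd hX.hΦ) hX.hΦ1))) hC40
    have h3 := mul_le_mul_of_nonneg_left this hδ.le
    have p5 : 0 ≤ C4 * (δ * r) := by positivity
    have p6 : 0 ≤ (2 * C1 + 3 * C2 + 4 * C3) * (δ * r) := by positivity
    linarith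

theorem exists_bound_sol (K : ℝ) : ∃ C : ℝ, 0 ≤ C ∧
    ∀ {δ : ℝ} {B : Background} {P : Params} {c : ℂ}, Regime K δ B P c →
    ∀ {X : Unknowns} {S r Y : ℝ}, X.Parts B P c δ S r Y →
      l2 (solρ B P c X) ≤ C * (S + r + Y) ∧ l2 (solu B P c X) ≤ C * (S + r + Y) ∧
      l2 (solv B P c X) ≤ C * (S + r + Y) ∧ l2 (solρ' B P c X) ≤ C * (S + r + Y) ∧
      l2 (solu' B P c X) ≤ C * (S + r + Y) ∧ l2 (solv' B P c X) ≤ C * (S + r + Y) ∧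
      δ ^ 2 * l2 (solu'' B P c X) ≤ C * (S + δ ^ 2 * (r + ‖X.g1‖ + Y)) ∧
      δ ^ 2 * l2 (solv'' B P c X) ≤ C * (S + δ ^ 2 * (r + ‖X.g1‖ + Y)) := by
  obtain ⟨D, hD0, hD⟩ := exists_bound_stream K
  obtain ⟨C1, hC10, hC1⟩ := exists_coefs_bound (r := 3)
    (fun a x => a 7 ^ 2 * (x 0 + x 1 + x 2)) (by fun_prop) (by intro a x t; simp; ring) K
  obtain ⟨C2, hC20, hC2⟩ := exists_coefs_bound (r := 4)
    (fun a x => x 0 - a 7 ^ 2 * (a 5 * (x 1 + x 2)) + x 3)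
    (by fun_prop) (by intro a x t; simp; ring) K
  obtain ⟨C3, hC30, hC3⟩ := exists_coefs_bound (r := 2)
    (fun a x => a 11 * a 8 * (a 5 * x 0) + x 1)
    (by fun_prop) (by intro a x t; simp; ring) K
  obtain ⟨C4, hC40, hC4⟩ := exists_coefs_l2_bound (r := 3)
    (fun a x => a 7 ^ 2 * (a 8 ^ 2 * a 5 ^ 2 * x 0 + x 1 + x 2))
    (by fun_prop) (by intro a x t; simp; ring) K
  obtain ⟨C5, hC50, hC5⟩ := exists_coefs_l2_bound (r := 5)
    (fun a x => x 0 - a 7 ^ 2 * (a 0 * (x 1 + x 2) + a 5 * (a 8 ^ 2 * a 5 ^ 2 * x 3 + x 4)))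
    (by fun_prop) (by intro a x t; simp; ring) K
  obtain ⟨C6, hC60, hC6⟩ := exists_coefs_bound (r := 3)
    (fun a x => -(a 11 * a 8 * (x 0 + x 1 + a 7 ^ 2 * (a 5 * x 2))))
    (by fun_prop) (by intro a x t; simp; ring) K
  obtain ⟨C7, hC70, hC7⟩ := exists_coefs_l2_bound (r := 5)
    (fun a x => a 6 * x 0 + x 1 - a 7 ^ 2 * (x 2 + 2 * a 0 * x 3 + a 5 * x 4))
    (by fun_prop) (by intro a x t; simp; ring) K
  obtain ⟨C8, hC80, hC8⟩ := exists_coefs_l2_bound (r := 3)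
    (fun a x => -(a 11 * a 8 * (x 0 + a 7 ^ 2 * (a 0 * x 1 + a 5 * x 2))))
    (by fun_prop) (by intro a x t; simp; ring) K
  refine ⟨C1 + C2 * (D + 3) + 2 * C3 + C4 + C5 * (D + 3) + C6 * (D + 3) + C7 * (2 * D + 3)
    + C8 * (D + 2), by positivity, fun {δ B P c} h {X S r Y} hX => ?_⟩
  obtain ⟨s1, s2, s3, s4⟩ := hD h hX
  have hS := hX.S0
  have hr := hX.r0
  have hY := hX.Y0
  have hδ := h.δ_pos
  have hg1 : 0 ≤ ‖X.g1‖ := norm_nonneg _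
  have hμ1 : l2 (μμ B P c X • 1 : ℝ →ᵇ ℂ) ≤ 2 * Y := by
    refine (l2_bcf_le _).trans ?_
    rw [norm_smul_one]; linarith [hX.hμ]
  have hδY : δ * Y ≤ Y := mul_le_of_le_one_left hY h.δ_le
  set T := S + r + Y with hT
  have hT0 : 0 ≤ T := by positivity
  set T2 := S + δ ^ 2 * (r + ‖X.g1‖ + Y) with hT2
  have hT20 : 0 ≤ T2 := by positivity
  set C := C1 + C2 * (D + 3) + 2 * C3 + C4 + C5 * (D + 3) + C6 * (D + 3) + C7 * (2 * D + 3)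
    + C8 * (D + 2) with hC
  have q2 : 0 ≤ C2 * (D + 3) := by positivity
  have q5 : 0 ≤ C5 * (D + 3) := by positivity
  have q6 : 0 ≤ C6 * (D + 3) := by positivity
  have q7 : 0 ≤ C7 * (2 * D + 3) := by positivity
  have q8 : 0 ≤ C8 * (D + 2) := by positivity
  have fin : ∀ {a C' E b t : ℝ}, a ≤ C' * b → b ≤ E * t → 0 ≤ C' → 0 ≤ t → C' * E ≤ C →
      a ≤ C * t := fun {a C' E b t} h1 h2 h3 h4 h5 => by
    have := mul_le_mul_of_nonneg_left h2 h3
    have := mul_le_mul_of_nonneg_right h5 h4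
    linarith
  have DS : D * S ≤ D * T := by gcongr; linarith
  have r2 : 0 ≤ δ ^ 2 * r := by positivity
  have r3 : 0 ≤ δ ^ 2 * Y := by positivity
  have r4 : 0 ≤ δ ^ 2 * ‖X.g1‖ := by positivity
  have DS2 : D * S ≤ D * T2 := by gcongr; linarith
  have sum3 : ∀ f : Fin 3 → ℝ, ∑ i, f i = f 0 + f 1 + f 2 := Fin.sum_univ_three
  have sum4 : ∀ f : Fin 4 → ℝ, ∑ i, f i = f 0 + f 1 + f 2 + f 3 := Fin.sum_univ_four
  have sum5 : ∀ f : Fin 5 → ℝ, ∑ i, f i = f 0 + f 1 + f 2 + f 3 + f 4 := Fin.sum_univ_five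
  have sum2 : ∀ f : Fin 2 → ℝ, ∑ i, f i = f 0 + f 1 := Fin.sum_univ_two
  have hd : ∀ {a b : ℝ}, a ≤ b → 0 ≤ b → δ ^ 2 * a ≤ b := fun {a b} ha hb =>
    (mul_le_mul_of_nonneg_left ha (sq_nonneg δ)).trans (mul_le_of_le_one_left hb (h.pow_le_one 2))
  have hδr : δ * (δ * r) = δ ^ 2 * r := by ring
  refine ⟨?_, ?_, ?_, ?_, ?_, ?_, ?_, ?_⟩
  · refine fin (E := 1) (hC1 h ![qX B P c X, ρ0 X, Gt X] (solρ B P c X)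
      (by intro y; simp [coefs, solρ]; ring)).1 ?_ hC10 hT0 (by linarith)
    rw [sum3]
    show l2 (qX B P c X) + l2 (ρ0 X) + l2 (Gt X) ≤ _
    linarith [hX.hq, hX.hρ, hX.hG]
  · refine fin (E := D + 3) (hC2 h ![Psi1 B P c X, qX B P c X, ρ0 X, μμ B P c X • 1] (solu B P c X)
      (by intro y; simp [coefs, solu])).1 ?_ hC20 hT0 (by linarith)
    rw [sum4]
    show l2 (Psi1 B P c X) + l2 (qX B P c X) + l2 (ρ0 X) + l2 (μμ B P c X • 1 : ℝ →ᵇ ℂ) ≤ _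
    linarith [hX.hq, hX.hρ]
  · refine fin (E := 2) (hC3 h ![ΦΦ B P c X, vr B P c X] (solv B P c X)
      (by intro y; simp [coefs, solv])).1 ?_ hC30 hT0 (by linarith)
    rw [sum2]
    show l2 (ΦΦ B P c X) + l2 (vr B P c X) ≤ _
    linarith [hX.hΦ, hX.hvr]
  · refine fin (E := 1) (hC4 h ![ΦΦ B P c X, X.g0, X.gt] (solρ' B P c X)
      (by intro i; fin_cases i; exacts [memL2_bcf _, memL2_coe _, memL2_coe _])
      (by intro y; simp [coefs, solρ'])) ?_ hC40 hT0 (by linarith)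
    rw [sum3]
    show l2 (ΦΦ B P c X) + l2 X.g0 + l2 X.gt ≤ _
    linarith [hX.hΦ, hX.hg0, hX.hgt]
  · refine fin (E := D + 3) (hC5 h ![Psi2 B P c X, qX B P c X, ρ0 X, ΦΦ B P c X, X.g0] (solu' B P c X)
      (by intro i; fin_cases i
          exacts [memL2_bcf _, memL2_bcf _, memL2_bcf _, memL2_bcf _, memL2_coe _])
      (by intro y; simp [coefs, solu'])) ?_ hC50 hT0 (by linarith)
    rw [sum5]
    show l2 (Psi2 B P c X) + l2 (qX B P c X) + l2 (ρ0 X) + l2 (ΦΦ B P c X) + l2 X.g0 ≤ _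
    linarith [hX.hΦ, hX.hg0, hX.hq, hX.hρ]
  · refine fin (E := D + 3) (hC6 h ![Psi1 B P c X, μμ B P c X • 1, Gt X] (solv' B P c X)
      (by intro y; simp [coefs, solv']; ring)).1 ?_ hC60 hT0 (by linarith)
    rw [sum3]
    show l2 (Psi1 B P c X) + l2 (μμ B P c X • 1 : ℝ →ᵇ ℂ) + l2 (Gt X) ≤ _
    linarith [hX.hG]
  · have := hC7 h ![th B P c X.F, Z0 B P c X, X2 B P c X, X.g0, X.g1] (solu'' B P c X)
      (by intro i; fin_cases i
          exacts [memL2_coe _, memL2_bcf _, memL2_bcf _, memL2_coe _, memL2_coe _])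
      (by intro y; simp [coefs, solu''])
    rw [sum5] at this
    change _ ≤ C7 * (l2 (th B P c X.F) + l2 (Z0 B P c X) + l2 (X2 B P c X) + l2 X.g0 + l2 X.g1)
      at this
    have h2 := mul_le_mul_of_nonneg_left this (sq_nonneg δ)
    refine fin (E := 2 * D + 3) (C' := C7) (b := δ ^ 2 * (l2 (th B P c X.F) + l2 (Z0 B P c X)
      + l2 (X2 B P c X) + l2 X.g0 + l2 X.g1)) (by linarith) ?_ hC70 hT20 (by linarith)
    have e1 : δ ^ 2 * l2 (Z0 B P c X) ≤ D * S := by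
      have := mul_le_mul_of_nonneg_left s3 hδ.le
      have := mul_le_of_le_one_left (show 0 ≤ D * S by positivity) h.δ_le
      nlinarith
    have e2 : δ ^ 2 * l2 (X2 B P c X) ≤ D * (S + δ ^ 2 * r) := by
      have := mul_le_mul_of_nonneg_left s4 hδ.le
      have := mul_le_of_le_one_left (show 0 ≤ D * S by positivity) h.δ_le
      nlinarith
    have e3 := mul_le_mul_of_nonneg_left hX.hg0 (sq_nonneg δ)
    have e4 : δ ^ 2 * l2 X.g1 = δ ^ 2 * ‖X.g1‖ := by rw [l2_coe]
    have e5 : D * (S + δ ^ 2 * r) ≤ D * T2 := by gcongr; linarith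
    linarith [hX.hth]
  · have := hC8 h ![Psi2 B P c X, Gt X, X.gt] (solv'' B P c X)
      (by intro i; fin_cases i
          exacts [memL2_bcf _, memL2_bcf _, memL2_coe _])
      (by intro y; simp [coefs, solv''])
    rw [sum3] at this
    change _ ≤ C8 * (l2 (Psi2 B P c X) + l2 (Gt X) + l2 X.gt) at this
    have h2 := mul_le_mul_of_nonneg_left this (sq_nonneg δ)
    refine fin (E := D + 2) (C' := C8) (b := δ ^ 2 * (l2 (Psi2 B P c X)
      + l2 (Gt X) + l2 X.gt)) (by linarith) ?_ hC80 hT20 (by linarith)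
    have e1 := hd s2 (by positivity)
    have e2 := mul_le_mul_of_nonneg_left hX.hG (sq_nonneg δ)
    have e3 := mul_le_mul_of_nonneg_left hX.hgt (sq_nonneg δ)
    linarith

/-- Every term containing S or the data carries ε = δ⁷, and at most one factor 1/δ is lost, through
Φ'; the top order term θ is absent because the vorticity equation accounts for it. The terms of
order k without ε come from the hydrostatic pressure only, whence δY. -/
theorem exists_bound_residual (hK : 1 ≤ K) : ∃ C : ℝ, 0 ≤ C ∧
    ∀ {δ : ℝ} {B : Background} {P : Params} {c : ℂ}, Regime K δ B P c →
    ∀ {X : Unknowns} {S r Y : ℝ}, X.Parts B P c δ S r Y →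
      ‖toL2 (Eub B P c X) + EuH B P c X‖ ≤ C * (δ ^ 6 * S + δ ^ 7 * (r + ‖X.g1‖) + δ * Y) ∧
      ‖toL2 (Evb B P c X) + EvH B P c X‖ ≤ C * (δ ^ 6 * S + δ ^ 7 * (r + ‖X.g1‖) + δ * Y) := by
  obtain ⟨D, hD0, hD⟩ := exists_bound_stream K
  obtain ⟨D', hD0', hD'⟩ := exists_bound_sol K
  obtain ⟨C1, hC10, hC1⟩ := exists_coefs_bound (r := 9)
    (fun a x => -x 0 + a 8 ^ 2 * x 1 + a 7 ^ 2 * (x 2 - (a 8 ^ 2 * (1 + a 9)) * (a 5 * (x 3 + x 4))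
      + a 1 * (x 3 + x 4)) + a 10 * a 8 * x 5 - a 9 * a 10 * a 8 * a 7 ^ 2 * (a 5 * x 6)
      + a 11 * (x 5 * a 5) + a 11 * x 6 + a 7 ^ 2 * (a 1 * x 8) + x 7 * a 0)
    (by fun_prop) (by intro a x t; simp; ring) K
  obtain ⟨C2, hC20, hC2⟩ := exists_coefs_bound (r := 6)
    (fun a x => a 11 * a 8 * (x 0 + a 7 ^ 2 * (a 0 * x 1)) + a 8 ^ 2 * x 2
      + a 9 * a 11 * a 8 * (a 0 * x 3 + a 7 ^ 2 * a 8 ^ 2 * (a 5 ^ 3 * x 4))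
      + a 11 * a 8 * (a 5 * x 5))
    (by fun_prop) (by intro a x t; simp; ring) K
  set E := D + D' + 2 * K + 1 with hE
  have hE0 : 0 ≤ E := by positivity
  refine ⟨C1 * (9 * E) + 4 * K + (C2 * (6 * E) + K * (2 * K * (1 + 2 * K))), by positivity,
    fun {δ B P c} h {X S r Y} hX => ?_⟩
  obtain ⟨s1, s2, s3, s4⟩ := hD h hX
  obtain ⟨t1, -, t3, -⟩ := hD' h hX
  have hS := hX.S0
  have hr := hX.r0
  have hY := hX.Y0
  have hδ := h.δ_pos
  have hδ1 := h.δ_le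
  have hg1 : 0 ≤ ‖X.g1‖ := norm_nonneg _
  have hm2 : P.m ^ 2 ≤ 1 := pow_le_one₀ h.m_pos.le h.m_le
  have hmn : ‖(P.m : ℂ) ^ 2‖ ≤ 1 := by
    rw [norm_pow, Complex.norm_real, Real.norm_of_nonneg h.m_pos.le]; exact hm2
  have hεn : ‖(P.ε : ℂ)‖ = δ ^ 7 := by
    rw [Complex.norm_real, Real.norm_of_nonneg h.nondeg.ε_pos.le, h.ε_eq]
  have hkn : ‖(P.k : ℂ)‖ ≤ K * δ := by
    rw [Complex.norm_real, Real.norm_of_nonneg h.k_pos.le]; exact h.k_hi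
  have hkK : K * δ ≤ K := mul_le_of_le_one_right (by linarith) hδ1
  set T := δ ^ 6 * S + δ ^ 7 * (r + ‖X.g1‖) + δ * Y with hT
  have a1 : 0 ≤ δ ^ 6 * S := by positivity
  have a2 : 0 ≤ δ ^ 7 * r := by positivity
  have a3 : 0 ≤ δ ^ 7 * ‖X.g1‖ := by positivity
  have a4 : 0 ≤ δ * Y := by positivity
  have hT0 : 0 ≤ T := by rw [hT, mul_add]; linarith
  have hST : δ ^ 6 * S ≤ T := by rw [hT, mul_add]; linarith
  have hrT : δ ^ 7 * r ≤ T := by rw [hT, mul_add]; linarith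
  have hgT : δ ^ 7 * (r + ‖X.g1‖) ≤ T := by rw [hT, mul_add]; linarith
  have hYT : δ * Y ≤ T := by rw [hT, mul_add]; linarith
  have hSr : δ ^ 6 * (S + δ * r) ≤ T := by rw [hT, mul_add, mul_add]; linarith
  have d76 : δ ^ 7 ≤ δ ^ 6 := pow_le_pow_of_le_one hδ.le hδ1 (by norm_num)
  have d71 : δ ^ 7 ≤ δ := by simpa using pow_le_pow_of_le_one hδ.le hδ1 (show 1 ≤ 7 by norm_num)
  have hSrY : δ ^ 7 * (S + r + Y) ≤ T := by
    have := mul_le_mul_of_nonneg_right d76 hS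
    have := mul_le_mul_of_nonneg_right d71 hY
    rw [hT, mul_add, mul_add, mul_add]; linarith
  have up : ∀ {a e : ℝ}, a ≤ e * T → e ≤ E → a ≤ E * T := fun ha he =>
    ha.trans (mul_le_mul_of_nonneg_right he hT0)
  have hK0 : 0 ≤ K := by linarith
  have e7 : ∀ {b : ℝ →ᵇ ℂ} {w e : ℝ}, l2 b ≤ e * w → 0 ≤ e → e ≤ E → δ ^ 7 * w ≤ T →
      l2 ((P.ε : ℂ) • b : ℝ →ᵇ ℂ) ≤ E * T := fun {b w e} hb he heE hw => by
    refine up (e := e) ((l2_smul_bcf _ _).trans ?_) heE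
    rw [hεn]
    calc _ ≤ δ ^ 7 * (e * w) := by gcongr
      _ = e * (δ ^ 7 * w) := by ring
      _ ≤ _ := by gcongr
  have e6 : ∀ {b : ℝ →ᵇ ℂ} {w : ℝ}, δ * l2 b ≤ D * w → δ ^ 6 * w ≤ T →
      l2 ((P.ε : ℂ) • b : ℝ →ᵇ ℂ) ≤ E * T := fun {b w} hb hw => by
    refine up (e := D) ((l2_smul_bcf _ _).trans ?_) (by rw [hE]; linarith)
    rw [hεn]
    calc δ ^ 7 * l2 b = δ ^ 6 * (δ * l2 b) := by ring
      _ ≤ δ ^ 6 * (D * w) := by gcongr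
      _ = D * (δ ^ 6 * w) := by ring
      _ ≤ _ := by gcongr
  have s7 : δ ^ 7 * S ≤ T := (mul_le_mul_of_nonneg_right d76 hS).trans hST
  have y7 : δ ^ 7 * Y ≤ T := (mul_le_mul_of_nonneg_right d71 hY).trans hYT
  have one : ∀ {a b : ℝ}, a ≤ b → a ≤ 1 * b := fun h => by rwa [one_mul]
  have hE1 : 1 ≤ E := by rw [hE]; linarith
  have hDE : D ≤ E := by rw [hE]; linarith
  have hDE' : D' ≤ E := by rw [hE]; linarith
  have hvr : l2 (vr B P c X) ≤ E * T := up (one (hX.hvr.trans hYT)) hE1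
  have hGε := e7 (one hX.hG) zero_le_one hE1 y7
  have hGk : l2 ((P.k : ℂ) • Gt X : ℝ →ᵇ ℂ) ≤ E * T := by
    refine up (e := K) ((l2_smul_bcf _ _).trans ?_) (by rw [hE]; linarith)
    calc _ ≤ K * δ * Y := mul_le_mul hkn hX.hG (l2_nonneg _) (by positivity)
      _ = K * (δ * Y) := by ring
      _ ≤ _ := by gcongr
  have hμk : l2 ((P.k * μμ B P c X) • 1 : ℝ →ᵇ ℂ) ≤ E * T := by
    refine up (e := 2 * K) ((l2_bcf_le _).trans ?_) (by rw [hE]; linarith)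
    rw [norm_smul_one, norm_mul]
    calc _ ≤ 2 * (K * δ * Y) := by
          gcongr
          exact hX.hμ
      _ = 2 * K * (δ * Y) := by ring
      _ ≤ _ := by gcongr
  have hLu : l2 (Eub B P c X) ≤ C1 * (9 * E) * T := by
    -- The small factors ε and k are attached to the functions, because the homogeneous bound
    -- estimates coefficients by constants and would lose them.
    have := (hC1 h ![(P.ε : ℂ) • Z0 B P c X, (P.ε : ℂ) • Psi1 B P c X, (P.ε : ℂ) • X2 B P c X,
      (P.ε : ℂ) • qX B P c X, (P.ε : ℂ) • ρ0 X, (P.k * μμ B P c X) • 1, (P.k : ℂ) • Gt X,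
      vr B P c X, (P.ε : ℂ) • Gt X] (Eub B P c X) (by intro y; simp [coefs, Eub]; ring)).1
    simp only [Fin.sum_univ_succ, Fin.sum_univ_zero, Matrix.cons_val_zero, Matrix.cons_val_succ]
      at this
    have h1 := e6 s3 hST
    have h2 := e7 s1 hD0 hDE s7
    have h3 := e6 s4 hSr
    have h4 := e7 (one hX.hq) zero_le_one hE1 s7
    have h5 := e7 (one hX.hρ) zero_le_one hE1 hrT
    refine this.trans ?_
    rw [mul_assoc]
    gcongr
    linarith
  have hLv : l2 (Evb B P c X) ≤ C2 * (6 * E) * T := by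
    have := (hC2 h ![(P.ε : ℂ) • Psi2 B P c X, (P.ε : ℂ) • Gt X, (P.ε : ℂ) • solv B P c X,
      (P.ε : ℂ) • solρ B P c X, (P.ε : ℂ) • ΦΦ B P c X, vr B P c X] (Evb B P c X)
      (by intro y; simp [coefs, Evb]; ring)).1
    simp only [Fin.sum_univ_succ, Fin.sum_univ_zero, Matrix.cons_val_zero, Matrix.cons_val_succ]
      at this
    have h1 := e7 s2 hD0 hDE s7
    have h2 := e7 t3 hD0' hDE' hSrY
    have h3 := e7 t1 hD0' hDE' hSrY
    have h4 := e7 (one hX.hΦ) zero_le_one hE1 s7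
    refine this.trans ?_
    rw [mul_assoc]
    gcongr
    linarith
  have hε2 : ‖ee B c‖ ≤ 2 * K :=
    (BoundedContinuousFunction.norm_le (by positivity)).2 h.norm_ee_le
  have hg0' := hX.hg0
  have hgt' := hX.hgt
  rw [l2_coe] at hg0' hgt'
  have hHu : ‖EuH B P c X‖ ≤ 4 * K * T := by
    rw [EuH, norm_smul, norm_mul, hεn]
    have h1 : ‖(2 : ℂ) • mulL2 B.U1 X.g0 + mulL2 (ee B c) X.g1‖ ≤ 4 * K * (r + ‖X.g1‖) := by
      refine (norm_add_le _ _).trans ?_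
      rw [norm_smul, Complex.norm_two]
      have h1 : ‖mulL2 B.U1 X.g0‖ ≤ K * r :=
        (norm_mulL2_le _ _).trans (mul_le_mul h.U1_le hg0' (norm_nonneg _) hK0)
      have h2 : ‖mulL2 (ee B c) X.g1‖ ≤ 2 * K * ‖X.g1‖ :=
        (norm_mulL2_le _ _).trans (by gcongr)
      have : 0 ≤ K * r := by positivity
      have : 0 ≤ K * ‖X.g1‖ := by positivity
      linarith
    calc _ ≤ δ ^ 7 * 1 * (4 * K * (r + ‖X.g1‖)) := by gcongr
      _ = 4 * K * (δ ^ 7 * (r + ‖X.g1‖)) := by ring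
      _ ≤ _ := by gcongr
  have hHv : ‖EvH B P c X‖ ≤ K * (2 * K * (1 + 2 * K)) * T := by
    rw [EvH, norm_smul, norm_mul, norm_mul, norm_mul, hεn, Complex.norm_I, one_mul]
    have h1 : ‖mulL2 (ee B c) ((1 + P.lam : ℂ) • X.gt + (P.lam : ℂ) • X.g0)‖
        ≤ 2 * K * ((1 + 2 * K) * (r + Y)) := by
      refine (norm_mulL2_le _ _).trans (mul_le_mul hε2 ((norm_add_le _ _).trans ?_)
        (norm_nonneg _) (by positivity))
      rw [norm_smul, norm_smul]
      have hl : ‖(P.lam : ℂ)‖ ≤ K := by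
        rw [Complex.norm_real, Real.norm_of_nonneg h.lam_nonneg]; exact h.lam_le
      have hl1 : ‖(1 + P.lam : ℂ)‖ ≤ 1 + K := (norm_add_le _ _).trans (by rw [norm_one]; linarith)
      have h1 : ‖(1 + P.lam : ℂ)‖ * ‖X.gt‖ ≤ (1 + K) * Y := by gcongr
      have h2 : ‖(P.lam : ℂ)‖ * ‖X.g0‖ ≤ K * r := by gcongr
      have : 0 ≤ K * r := by positivity
      have : 0 ≤ K * Y := by positivity
      linarith
    calc _ ≤ K * δ ^ 7 * 1 * (2 * K * ((1 + 2 * K) * (r + Y))) := by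
          gcongr
          exact hkn.trans hkK
      _ = K * (2 * K * (1 + 2 * K)) * (δ ^ 7 * r + δ ^ 7 * Y) := by ring
      _ ≤ _ := by
          gcongr
          have := mul_le_mul_of_nonneg_right d71 hY
          rw [hT, mul_add]; linarith
  have n1 : 0 ≤ (C1 * (9 * E) + 4 * K) * T := by positivity
  have n2 : 0 ≤ (C2 * (6 * E) + K * (2 * K * (1 + 2 * K))) * T := by positivity
  constructor
  · refine (norm_add_le _ _).trans ?_
    rw [norm_toL2]
    linarith
  · refine (norm_add_le _ _).trans ?_
    rw [norm_toL2]
    linarith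

end

section

/-! ### Linearity in the unknowns -/

/-- Every field and residual is linear in the unknowns. Compatibility with differences suffices,
since it reduces the contraction property to a bound for zero data. -/
instance : Sub Unknowns := ⟨fun X Y => ⟨X.F - Y.F, X.γ - Y.γ, X.σ - Y.σ, X.α - Y.α, X.g0 - Y.g0,
  X.g1 - Y.g1, X.gt - Y.gt⟩⟩

section Linear

variable {B : Background} {P : Params} {c : ℂ}

theorem th_sub (F G : HilbertL2) : th B P c (F - G) = th B P c F - th B P c G := map_sub _ _ _

theorem om_sub (F G : HilbertL2) : om B P c (F - G) = om B P c F - om B P c G := by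
  rw [om, th_sub, map_sub, om, om]

theorem pp_sub (F G : HilbertL2) : pp B P c (F - G) = pp B P c F - pp B P c G := by
  rw [pp, om_sub, mul_sub, map_sub, map_sub, pp, pp]

theorem Ph_sub (F G : HilbertL2) : Ph B P c (F - G) = Ph B P c F - Ph B P c G := by
  rw [Ph, pp_sub, mul_sub, map_sub, map_sub, Ph, Ph]

theorem rr_sub (γ γ' : ℂ) (σ σ' : ℝ →ᵇ ℂ) :
    rr B P c (γ - γ') (σ - σ') = rr B P c γ σ - rr B P c γ' σ' := by
  simp only [rr, mul_sub, sub_smul, smul_sub]; abel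

theorem qq_sub (γ γ' : ℂ) (σ σ' : ℝ →ᵇ ℂ) :
    qq B P c (γ - γ') (σ - σ') = qq B P c γ σ - qq B P c γ' σ' := by
  simp only [qq, rr_sub, mul_sub, sub_mul, sub_smul, map_sub]; abel

theorem RR_sub (γ γ' : ℂ) (σ σ' : ℝ →ᵇ ℂ) :
    RR B P c (γ - γ') (σ - σ') = RR B P c γ σ - RR B P c γ' σ' := by
  rw [RR, RR, RR, rr_sub, qq_sub, ← map_sub, ← map_sub]
  congr 2
  ring

theorem SS_sub (γ γ' : ℂ) (σ σ' : ℝ →ᵇ ℂ) :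
    SS B P c (γ - γ') (σ - σ') = SS B P c γ σ - SS B P c γ' σ' := by
  rw [SS, SS, SS, RR_sub, qq_sub]; ring

theorem Phi_sub (F G : HilbertL2) (γ γ' : ℂ) (σ σ' : ℝ →ᵇ ℂ) :
    Phi B P c (F - G) (γ - γ') (σ - σ') = Phi B P c F γ σ - Phi B P c G γ' σ' := by
  ext y
  simp only [Phi_apply, Ph_sub, RR_sub, qq_sub, BoundedContinuousFunction.coe_sub, Pi.sub_apply]
  ring

theorem newσ_sub (F G : HilbertL2) (γ γ' : ℂ) (σ σ' : ℝ →ᵇ ℂ) :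
    newσ B P c (F - G) (γ - γ') (σ - σ') = newσ B P c F γ σ - newσ B P c G γ' σ' := by
  rw [newσ, newσ, newσ, Ph_sub, SS_sub]; ring

theorem newγ_sub (F G : HilbertL2) (γ γ' : ℂ) (σ σ' : ℝ →ᵇ ℂ) :
    newγ B P c (F - G) (γ - γ') (σ - σ') = newγ B P c F γ σ - newγ B P c G γ' σ' := by
  have h : ee B c * SS B P c (γ - γ') (σ - σ') - ee B c ^ 2 * Ph B P c (F - G)
      = (ee B c * SS B P c γ σ - ee B c ^ 2 * Ph B P c F)
        - (ee B c * SS B P c γ' σ' - ee B c ^ 2 * Ph B P c G) := by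
    rw [Ph_sub, SS_sub]; ring
  rw [newγ, newγ, newγ, h, map_sub, map_sub, RR_sub, Ph_sub]
  simp only [BoundedContinuousFunction.coe_sub, Pi.sub_apply]
  ring

variable (X X' : Unknowns)

theorem ΦΦ_sub : ΦΦ B P c (X - X') = ΦΦ B P c X - ΦΦ B P c X' := Phi_sub _ _ _ _ _ _

theorem qX_sub : qX B P c (X - X') = qX B P c X - qX B P c X' := qq_sub _ _ _ _

theorem oX_sub : oX B P c (X - X') = oX B P c X - oX B P c X' := om_sub _ _

theorem qp_sub : qp B P c (X - X') = qp B P c X - qp B P c X' := by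
  have := pp_sub (B := B) (P := P) (c := c) X.F X'.F
  rw [qp, qX_sub, qp, qp]
  change _ + pp B P c (X.F - X'.F) = _
  rw [this]; abel

theorem Φ1_sub : Φ1 B P c (X - X') = Φ1 B P c X - Φ1 B P c X' := by
  rw [Φ1, Φ1, Φ1, qp_sub]; ring

theorem ρ0_sub : ρ0 (X - X') = ρ0 X - ρ0 X' := by
  change (X.α - X'.α) • 1 + primL (X.g0 - X'.g0) = _
  rw [ρ0, ρ0, map_sub, sub_smul]; abel

theorem Gt_sub : Gt (X - X') = Gt X - Gt X' := map_sub _ _ _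

theorem μμ_sub : μμ B P c (X - X') = μμ B P c X - μμ B P c X' := by
  rw [μμ, μμ, μμ, Gt_sub, mul_sub, map_sub, map_sub]
  simp only [BoundedContinuousFunction.coe_sub, Pi.sub_apply]
  ring

theorem Psi1_sub : Psi1 B P c (X - X') = Psi1 B P c X - Psi1 B P c X' := by
  rw [Psi1, Psi1, Psi1, ΦΦ_sub, qp_sub]; ring

theorem Psi2_sub : Psi2 B P c (X - X') = Psi2 B P c X - Psi2 B P c X' := by
  rw [Psi2, Psi2, Psi2, ΦΦ_sub, qp_sub, oX_sub]
  ext y; simp; ring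

theorem Z0_sub : Z0 B P c (X - X') = Z0 B P c X - Z0 B P c X' := by
  rw [Z0, Z0, Z0, ΦΦ_sub, qp_sub, oX_sub, Φ1_sub]
  ext y; simp; ring

theorem X2_sub : X2 B P c (X - X') = X2 B P c X - X2 B P c X' := by
  rw [X2, X2, X2, ΦΦ_sub, qX_sub, ρ0_sub, Φ1_sub]
  ext y; simp; ring

theorem solρ_sub : solρ B P c (X - X') = solρ B P c X - solρ B P c X' := by
  rw [solρ, solρ, solρ, qX_sub, ρ0_sub, Gt_sub]
  ext y; simp; ring

theorem vr_sub : vr B P c (X - X') = vr B P c X - vr B P c X' := by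
  rw [vr, vr, vr, ← neg_sub', ← smul_sub, ← map_sub, ← map_sub, Gt_sub, μμ_sub]
  congr 4
  ext y; simp; ring

theorem solv_sub : solv B P c (X - X') = solv B P c X - solv B P c X' := by
  rw [solv, solv, solv, ΦΦ_sub, vr_sub]
  ext y; simp; ring

theorem Eub_sub : Eub B P c (X - X') = Eub B P c X - Eub B P c X' := by
  rw [Eub, Eub, Eub, Z0_sub, Psi1_sub, X2_sub, qX_sub, ρ0_sub, μμ_sub, Gt_sub, vr_sub]
  ext y; simp; ring

theorem Evb_sub : Evb B P c (X - X') = Evb B P c X - Evb B P c X' := by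
  rw [Evb, Evb, Evb, Psi2_sub, ΦΦ_sub, solv_sub, solρ_sub, Gt_sub, vr_sub]
  ext y; simp; ring

theorem EuH_sub : EuH B P c (X - X') = EuH B P c X - EuH B P c X' := by
  change (P.ε * (P.m : ℂ) ^ 2) • ((2 : ℂ) • mulL2 B.U1 (X.g0 - X'.g0)
    + mulL2 (ee B c) (X.g1 - X'.g1)) = _
  rw [EuH, EuH, map_sub, map_sub]
  module

theorem EvH_sub : EvH B P c (X - X') = EvH B P c X - EvH B P c X' := by
  change (Complex.I * P.k * P.ε * (P.m : ℂ) ^ 2) •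
    mulL2 (ee B c) ((1 + P.lam : ℂ) • (X.gt - X'.gt) + (P.lam : ℂ) • (X.g0 - X'.g0)) = _
  rw [EvH, EvH, ← smul_sub, ← map_sub]
  congr 2
  module

end Linear

/-! ### Holomorphic dependence -/

section Holomorphic

variable {B : Background} {P : Params} {c₀ : ℂ}

theorem differentiableAt_eval {b : ℂ → (ℝ →ᵇ ℂ)} (hb : DifferentiableAt ℂ b c₀) (y : ℝ) :
    DifferentiableAt ℂ (fun c => b c y) c₀ :=
  (BoundedContinuousFunction.evalCLM ℂ (β := ℂ) y).differentiableAt.comp c₀ hb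

theorem differentiableAt_clm {E F : Type*} [NormedAddCommGroup E] [NormedSpace ℂ E]
    [NormedAddCommGroup F] [NormedSpace ℂ F] (L : E →L[ℂ] F) {b : ℂ → E}
    (hb : DifferentiableAt ℂ b c₀) : DifferentiableAt ℂ (fun c => L (b c)) c₀ :=
  L.differentiableAt.comp c₀ hb

theorem differentiableAt_ee : DifferentiableAt ℂ (fun c => ee B c) c₀ := by
  unfold ee; fun_prop

theorem differentiableAt_AA : DifferentiableAt ℂ (fun c => AA B P c) c₀ := by
  have := differentiableAt_ee (B := B) (c₀ := c₀)
  unfold AA; fun_prop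

theorem differentiableAt_dA : DifferentiableAt ℂ (fun c => dA B P c) c₀ := by
  have := differentiableAt_ee (B := B) (c₀ := c₀)
  unfold dA; fun_prop

theorem differentiableAt_Ab : DifferentiableAt ℂ (fun c => Ab P c) c₀ := by
  unfold Ab; fun_prop

/-- Inversion is holomorphic at the units of a Banach algebra; the nondegeneracy conditions enter
the holomorphy statements through this fact. -/
theorem differentiableAt_inverse_bcf {b : ℂ → (ℝ →ᵇ ℂ)} (hb : DifferentiableAt ℂ b c₀)
    (hu : IsUnit (b c₀)) : DifferentiableAt ℂ (fun c => Ring.inverse (b c)) c₀ :=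
  (differentiableAt_inverse hu).comp c₀ hb

/-- Holomorphy of the unknowns at a point. -/
structure Unknowns.Holo (X : ℂ → Unknowns) (c₀ : ℂ) : Prop where
  F : DifferentiableAt ℂ (fun c => (X c).F) c₀
  γ : DifferentiableAt ℂ (fun c => (X c).γ) c₀
  σ : DifferentiableAt ℂ (fun c => (X c).σ) c₀
  α : DifferentiableAt ℂ (fun c => (X c).α) c₀
  g0 : DifferentiableAt ℂ (fun c => (X c).g0) c₀
  g1 : DifferentiableAt ℂ (fun c => (X c).g1) c₀
  gt : DifferentiableAt ℂ (fun c => (X c).gt) c₀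

variable (h : Nondeg B P c₀)
include h

theorem differentiableAt_ei : DifferentiableAt ℂ (fun c => ei B c) c₀ :=
  differentiableAt_inverse_bcf differentiableAt_ee h.ee_unit

theorem differentiableAt_Ai : DifferentiableAt ℂ (fun c => Ai B P c) c₀ :=
  differentiableAt_inverse_bcf differentiableAt_AA h.A_unit

variable {F : ℂ → HilbertL2} {γ : ℂ → ℂ} {σ : ℂ → (ℝ →ᵇ ℂ)}

theorem differentiableAt_th (hF : DifferentiableAt ℂ F c₀) :
    DifferentiableAt ℂ (fun c => th B P c (F c)) c₀ :=
  (differentiableAt_viscInv h.ν_pos h.im_pos.le differentiableAt_ee (ee_im h.valid)).clm_apply hF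

theorem differentiableAt_om (hF : DifferentiableAt ℂ F c₀) :
    DifferentiableAt ℂ (fun c => om B P c (F c)) c₀ :=
  differentiableAt_clm primL (differentiableAt_th h hF)

theorem differentiableAt_pp (hF : DifferentiableAt ℂ F c₀) :
    DifferentiableAt ℂ (fun c => pp B P c (F c)) c₀ :=
  differentiableAt_clm coprimL (differentiableAt_clm toL2
    (differentiableAt_ee.mul (differentiableAt_om h hF)))

theorem differentiableAt_Ph (hF : DifferentiableAt ℂ F c₀) :
    DifferentiableAt ℂ (fun c => Ph B P c (F c)) c₀ :=
  differentiableAt_clm primL (differentiableAt_clm toL2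
    ((differentiableAt_AA.mul ((differentiableAt_ei h).pow 2)).mul (differentiableAt_pp h hF)))

omit h in
theorem differentiableAt_rr (hγ : DifferentiableAt ℂ γ c₀) (hσ : DifferentiableAt ℂ σ c₀) :
    DifferentiableAt ℂ (fun c => rr B P c (γ c) (σ c)) c₀ := by
  have := differentiableAt_ee (B := B) (c₀ := c₀)
  have := differentiableAt_Ab (P := P) (c₀ := c₀)
  unfold rr; fun_prop

omit h in
theorem differentiableAt_qq (hγ : DifferentiableAt ℂ γ c₀) (hσ : DifferentiableAt ℂ σ c₀) :
    DifferentiableAt ℂ (fun c => qq B P c (γ c) (σ c)) c₀ := by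
  have := differentiableAt_clm primL (differentiableAt_clm toL2
    (differentiableAt_rr (B := B) (P := P) hγ hσ))
  unfold qq; fun_prop

theorem differentiableAt_RR (hγ : DifferentiableAt ℂ γ c₀) (hσ : DifferentiableAt ℂ σ c₀) :
    DifferentiableAt ℂ (fun c => RR B P c (γ c) (σ c)) c₀ := by
  refine differentiableAt_clm primL (differentiableAt_clm toL2 ?_)
  have := differentiableAt_ei h
  have := differentiableAt_AA (B := B) (P := P) (c₀ := c₀)
  have := differentiableAt_dA (B := B) (P := P) (c₀ := c₀)
  have := differentiableAt_rr (B := B) (P := P) hγ hσ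
  have := differentiableAt_qq (B := B) (P := P) hγ hσ
  unfold n1 n2; fun_prop

theorem differentiableAt_SS (hγ : DifferentiableAt ℂ γ c₀) (hσ : DifferentiableAt ℂ σ c₀) :
    DifferentiableAt ℂ (fun c => SS B P c (γ c) (σ c)) c₀ := by
  have := differentiableAt_AA (B := B) (P := P) (c₀ := c₀)
  have := differentiableAt_ee (B := B) (c₀ := c₀)
  have := differentiableAt_RR h hγ hσ
  have := differentiableAt_qq (B := B) (P := P) hγ hσ
  unfold SS; fun_prop

theorem differentiableAt_Phi (hF : DifferentiableAt ℂ F c₀) (hγ : DifferentiableAt ℂ γ c₀)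
    (hσ : DifferentiableAt ℂ σ c₀) :
    DifferentiableAt ℂ (fun c => Phi B P c (F c) (γ c) (σ c)) c₀ := by
  have := differentiableAt_AA (B := B) (P := P) (c₀ := c₀)
  have := differentiableAt_Ab (P := P) (c₀ := c₀)
  have := differentiableAt_ei h
  have := differentiableAt_Ph h hF
  have := differentiableAt_RR h hγ hσ
  have := differentiableAt_qq (B := B) (P := P) hγ hσ
  unfold Phi; fun_prop

theorem differentiableAt_newσ (hF : DifferentiableAt ℂ F c₀) (hγ : DifferentiableAt ℂ γ c₀)
    (hσ : DifferentiableAt ℂ σ c₀) :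
    DifferentiableAt ℂ (fun c => newσ B P c (F c) (γ c) (σ c)) c₀ := by
  have := differentiableAt_ee (B := B) (c₀ := c₀)
  have := differentiableAt_Ph h hF
  have := differentiableAt_SS h hγ hσ
  unfold newσ; fun_prop

theorem differentiableAt_newγ (hF : DifferentiableAt ℂ F c₀) (hγ : DifferentiableAt ℂ γ c₀)
    (hσ : DifferentiableAt ℂ σ c₀) :
    DifferentiableAt ℂ (fun c => newγ B P c (F c) (γ c) (σ c)) c₀ := by
  have e := differentiableAt_ee (B := B) (c₀ := c₀)
  have a := (differentiableAt_Ab (P := P) (c₀ := c₀)).fun_inv h.Ab_ne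
  have p := differentiableAt_Ph h hF
  have s := differentiableAt_SS h hγ hσ
  have i1 : DifferentiableAt ℂ (fun c => prim (ee B c ^ 2 : ℝ →ᵇ ℂ) 1) c₀ := by
    have := differentiableAt_eval (differentiableAt_clm primL (differentiableAt_clm toL2 (e.fun_pow 2))) 1
    simpa only [primL_toL2_apply] using this
  have i2 := differentiableAt_eval (differentiableAt_clm primL (differentiableAt_clm toL2
    ((e.mul s).sub ((e.pow 2).mul p)))) 1
  have i3 := differentiableAt_eval (differentiableAt_RR h hγ hσ) 1
  have i4 := differentiableAt_eval p 1
  have d : DifferentiableAt ℂ (fun c => (disp B P c)⁻¹) c₀ := by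
    refine DifferentiableAt.fun_inv ?_ h.disp_ne
    have := differentiableAt_Ab (P := P) (c₀ := c₀)
    unfold disp; fun_prop
  unfold newγ
  exact d.mul (((differentiableAt_const _).mul i2).sub
    (((differentiableAt_id.mul (differentiableAt_const _)).mul a).mul (i3.add i4)))

end Holomorphic

end

/-! ### Holomorphic dependence of the fields and the residual. -/

section

variable {B : Background} {P : Params} {c₀ : ℂ}

namespace Unknowns.Holo

variable {X : ℂ → Unknowns} (hX : Holo X c₀) (h : Nondeg B P c₀)
include hX

theorem d_ρ0 : DifferentiableAt ℂ (fun c => ρ0 (X c)) c₀ := by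
  have := differentiableAt_clm primL hX.g0
  have := hX.α
  unfold ρ0; fun_prop

theorem d_Gt : DifferentiableAt ℂ (fun c => Gt (X c)) c₀ := differentiableAt_clm primL hX.gt

theorem d_μμ : DifferentiableAt ℂ (fun c => μμ B P c (X c)) c₀ := by
  have := differentiableAt_eval (differentiableAt_clm primL (differentiableAt_clm toL2
    ((differentiableAt_ee (B := B)).mul hX.d_Gt))) 1
  exact (this.const_mul (1 / 2 * (P.m : ℂ) ^ 2)).neg

theorem d_vr : DifferentiableAt ℂ (fun c => vr B P c (X c)) c₀ := by
  have h1 := differentiableAt_ee (B := B) (c₀ := c₀)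
  have h2 := hX.d_Gt
  have h3 := hX.d_μμ (B := B) (P := P)
  have h4 : DifferentiableAt ℂ (fun c => μμ B P c (X c) • (1 : ℝ →ᵇ ℂ)
    + ((P.m : ℂ) ^ 2) • (ee B c * Gt (X c))) c₀ := by fun_prop
  exact ((differentiableAt_clm primL (differentiableAt_clm toL2 h4)).const_smul (Complex.I * P.k : ℂ)).neg

theorem d_qX : DifferentiableAt ℂ (fun c => qX B P c (X c)) c₀ := differentiableAt_qq hX.γ hX.σ

theorem d_EuH : DifferentiableAt ℂ (fun c => EuH B P c (X c)) c₀ := by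
  have h1 := differentiableAt_clm (mulL2 B.U1) hX.g0
  have h2 := (differentiableAt_clm mulL2 (differentiableAt_ee (B := B) (c₀ := c₀))).clm_apply hX.g1
  unfold EuH; fun_prop

theorem d_EvH : DifferentiableAt ℂ (fun c => EvH B P c (X c)) c₀ := by
  have h1 := hX.g0
  have h2 := hX.gt
  have h3 : DifferentiableAt ℂ (fun c => (1 + P.lam : ℂ) • (X c).gt + (P.lam : ℂ) • (X c).g0) c₀ := by
    fun_prop
  exact ((differentiableAt_clm mulL2 (differentiableAt_ee (B := B) (c₀ := c₀))).clm_apply h3).const_smul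
    (Complex.I * P.k * P.ε * (P.m : ℂ) ^ 2 : ℂ)

include h

theorem d_ΦΦ : DifferentiableAt ℂ (fun c => ΦΦ B P c (X c)) c₀ :=
  differentiableAt_Phi h hX.F hX.γ hX.σ

theorem d_oX : DifferentiableAt ℂ (fun c => oX B P c (X c)) c₀ := differentiableAt_om h hX.F

theorem d_qp : DifferentiableAt ℂ (fun c => qp B P c (X c)) c₀ :=
  hX.d_qX.add (differentiableAt_pp h hX.F)

theorem d_Φ1 : DifferentiableAt ℂ (fun c => Φ1 B P c (X c)) c₀ := by
  have := hX.d_qp h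
  have := differentiableAt_ei h
  have := differentiableAt_AA (B := B) (P := P) (c₀ := c₀)
  unfold Φ1; fun_prop

theorem d_Psi1 : DifferentiableAt ℂ (fun c => Psi1 B P c (X c)) c₀ := by
  have := hX.d_qp h
  have := hX.d_ΦΦ h
  have := differentiableAt_ei h
  have := differentiableAt_AA (B := B) (P := P) (c₀ := c₀)
  unfold Psi1; fun_prop

theorem d_Psi2 : DifferentiableAt ℂ (fun c => Psi2 B P c (X c)) c₀ := by
  have := hX.d_qp h
  have := hX.d_ΦΦ h
  have := hX.d_oX h
  have := differentiableAt_ee (B := B) (c₀ := c₀)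
  have := differentiableAt_AA (B := B) (P := P) (c₀ := c₀)
  unfold Psi2; fun_prop

theorem d_Z0 : DifferentiableAt ℂ (fun c => Z0 B P c (X c)) c₀ := by
  have := hX.d_qp h
  have := hX.d_ΦΦ h
  have := hX.d_oX h
  have := hX.d_Φ1 h
  have := differentiableAt_ee (B := B) (c₀ := c₀)
  have := differentiableAt_AA (B := B) (P := P) (c₀ := c₀)
  have := differentiableAt_dA (B := B) (P := P) (c₀ := c₀)
  unfold Z0; fun_prop

theorem d_X2 : DifferentiableAt ℂ (fun c => X2 B P c (X c)) c₀ := by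
  have := hX.d_qX (B := B) (P := P)
  have := hX.d_ΦΦ h
  have := hX.d_ρ0
  have := hX.d_Φ1 h
  have := differentiableAt_ee (B := B) (c₀ := c₀)
  unfold X2; fun_prop

omit h in
theorem d_solρ : DifferentiableAt ℂ (fun c => solρ B P c (X c)) c₀ := by
  have := hX.d_qX (B := B) (P := P)
  have := hX.d_ρ0
  have := hX.d_Gt
  unfold solρ; fun_prop

theorem d_solu : DifferentiableAt ℂ (fun c => solu B P c (X c)) c₀ := by
  have := hX.d_qX (B := B) (P := P)
  have := hX.d_ρ0
  have := hX.d_Psi1 h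
  have := hX.d_μμ (B := B) (P := P)
  have := differentiableAt_ee (B := B) (c₀ := c₀)
  unfold solu; fun_prop

theorem d_solv : DifferentiableAt ℂ (fun c => solv B P c (X c)) c₀ := by
  have := hX.d_ΦΦ h
  have := hX.d_vr (B := B) (P := P)
  have := differentiableAt_ee (B := B) (c₀ := c₀)
  unfold solv; fun_prop

theorem d_Eub : DifferentiableAt ℂ (fun c => Eub B P c (X c)) c₀ := by
  have := hX.d_Z0 h
  have := hX.d_Psi1 h
  have := hX.d_X2 h
  have := hX.d_qX (B := B) (P := P)
  have := hX.d_ρ0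
  have := hX.d_Gt
  have := hX.d_μμ (B := B) (P := P)
  have := hX.d_vr (B := B) (P := P)
  have := differentiableAt_ee (B := B) (c₀ := c₀)
  unfold Eub; fun_prop

theorem d_Evb : DifferentiableAt ℂ (fun c => Evb B P c (X c)) c₀ := by
  have := hX.d_Psi2 h
  have := hX.d_solv h
  have := hX.d_solρ (B := B) (P := P)
  have := hX.d_ΦΦ h
  have := hX.d_Gt
  have := hX.d_vr (B := B) (P := P)
  have := differentiableAt_ee (B := B) (c₀ := c₀)
  unfold Evb; fun_prop

end Unknowns.Holo

end

section

variable {K : ℝ}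

/-! ### The fixed point problem -/

/-- The data: forcings `f`, `g`, a vorticity forcing `W`, and a pressure `α + ∫ g0` with
`g0' = g1`. -/
structure ForcingData where
  f : HilbertL2
  g : HilbertL2
  W : ℂ → HilbertL2
  α : ℂ → ℂ
  g0 : HilbertL2
  g1 : HilbertL2

/-- The space in which the iteration takes place. -/
abbrev Iterate := HilbertL2 × HilbertL2 × ℂ × (ℝ →ᵇ ℂ)

/-- The unknowns encoded by an iterate. -/
def unknownsOf (B : Background) (P : Params) (s : ℝ) (D : ForcingData) (c : ℂ) (z : Iterate) :
    Unknowns where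
  F := -toL2 (coprimL (D.W c)) + (Complex.I * P.k : ℂ)⁻¹ • mulL2 (Ai B P c) z.1
  γ := (s : ℂ) * z.2.2.1
  σ := (s : ℂ) • z.2.2.2
  α := D.α c
  g0 := D.g0
  g1 := D.g1
  gt := z.2.1

/-- The iteration. -/
def stepMap (B : Background) (P : Params) (s : ℝ) (D : ForcingData) (c : ℂ) (z : Iterate) :
    Iterate :=
  let X := unknownsOf B P s D c z
  (D.f - (toL2 (Eub B P c X) + EuH B P c X), D.g - (toL2 (Evb B P c X) + EvH B P c X),
    (s : ℂ)⁻¹ * newγ B P c X.F X.γ X.σ, (s : ℂ)⁻¹ • newσ B P c X.F X.γ X.σ)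

instance : Zero ForcingData := ⟨⟨0, 0, 0, 0, 0, 0⟩⟩

theorem unknownsOf_sub (B : Background) (P : Params) (s : ℝ) (D : ForcingData) (c : ℂ)
    (z z' : Iterate) :
    unknownsOf B P s D c z - unknownsOf B P s D c z' = unknownsOf B P s 0 c (z - z') := by
  have h1 : (-toL2 (coprimL (D.W c)) + (Complex.I * P.k : ℂ)⁻¹ • mulL2 (Ai B P c) z.1)
      - (-toL2 (coprimL (D.W c)) + (Complex.I * P.k : ℂ)⁻¹ • mulL2 (Ai B P c) z'.1)
      = -toL2 (coprimL (0 : HilbertL2)) + (Complex.I * P.k : ℂ)⁻¹ • mulL2 (Ai B P c) (z - z').1 := by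
    rw [Prod.fst_sub, map_sub, map_zero, map_zero, smul_sub]; abel
  have h2 : (s : ℂ) * z.2.2.1 - (s : ℂ) * z'.2.2.1 = (s : ℂ) * (z - z').2.2.1 := by
    simp [mul_sub]
  have h3 : (s : ℂ) • z.2.2.2 - (s : ℂ) • z'.2.2.2 = (s : ℂ) • (z - z').2.2.2 := by
    simp [smul_sub]
  refine (Unknowns.mk.injEq ..).mpr ⟨h1, h2, h3, sub_self _, sub_self _, sub_self _, rfl⟩

/-- The scaling of the amplitude of the inviscid part. -/
def ampScale (M δ : ℝ) : ℝ := M / δ ^ 5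

/-- The first component of z enters F divided by ikA, which costs 1/δ on top of the δ⁻⁴ of
`Regime.viscSize`; γ and σ are rescaled by M/δ⁵ to have the same size. The bound for the viscous
part is stated separately because its constant must not depend on M. -/
theorem exists_size (hK : 1 ≤ K) (M : ℝ) (hM : 0 ≤ M) : ∃ C : ℝ, 0 ≤ C ∧
    ∀ {δ : ℝ} {B : Background} {P : Params} {c : ℂ}, Regime K δ B P c →
    ∀ (D : ForcingData) (z : Iterate),
      ViscSize B P c δ (unknownsOf B P (ampScale M δ) D c z).F
        (12 * K ^ 4 * ((δ ^ 2)⁻¹ * ‖D.W c‖) + 6 * K ^ 5 * ((δ ^ 5)⁻¹ * ‖z‖)) ∧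
      (unknownsOf B P (ampScale M δ) D c z).Size B P c δ
        (C * ((δ ^ 2)⁻¹ * ‖D.W c‖ + (δ ^ 5)⁻¹ * ‖z‖)) (‖D.α c‖ + ‖D.g0‖) ‖z‖ := by
  refine ⟨12 * K ^ 4 + 6 * K ^ 5 + 2 * M, by positivity, fun {δ B P c} h D z => ?_⟩
  have hδ := h.δ_pos
  have hz1 : ‖z.1‖ ≤ ‖z‖ := norm_fst_le z
  have hz2 : ‖z.2‖ ≤ ‖z‖ := norm_snd_le z
  have hz21 : ‖z.2.1‖ ≤ ‖z‖ := (norm_fst_le z.2).trans hz2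
  have hz22 : ‖z.2.2‖ ≤ ‖z‖ := (norm_snd_le z.2).trans hz2
  have hz3 : ‖z.2.2.1‖ ≤ ‖z‖ := (norm_fst_le z.2.2).trans hz22
  have hz4 : ‖z.2.2.2‖ ≤ ‖z‖ := (norm_snd_le z.2.2).trans hz22
  have hF : ‖(Complex.I * P.k : ℂ)⁻¹ • mulL2 (Ai B P c) z.1‖ ≤ K ^ 2 * (δ⁻¹ * ‖z‖) := by
    rw [norm_smul, norm_inv, norm_mul, Complex.norm_I, one_mul, Complex.norm_real,
      Real.norm_of_nonneg h.k_pos.le]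
    have h1 : P.k⁻¹ ≤ K * δ⁻¹ := by
      rw [inv_le_iff_one_le_mul₀ h.k_pos]
      have := h.k_lo
      field_simp
      linarith
    have h2 : ‖mulL2 (Ai B P c) z.1‖ ≤ K * ‖z‖ := (norm_mulL2_le _ _).trans (by
      have : ‖Ai B P c‖ ≤ K := (BoundedContinuousFunction.norm_le (by linarith)).2 h.norm_Ai_le
      gcongr)
    calc _ ≤ K * δ⁻¹ * (K * ‖z‖) := by gcongr
      _ = _ := by ring
  have hv : ViscSize B P c δ (unknownsOf B P (ampScale M δ) D c z).F
        (12 * K ^ 4 * ((δ ^ 2)⁻¹ * ‖D.W c‖) + 6 * K ^ 5 * ((δ ^ 5)⁻¹ * ‖z‖)) := by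
    refine (h.viscSize_coprim (D.W c)).add hδ ((h.viscSize _).mono ?_)
    calc _ ≤ 6 * K ^ 3 * ((δ ^ 4)⁻¹ * (K ^ 2 * (δ⁻¹ * ‖z‖))) := by gcongr
      _ = _ := by field_simp
  have p1 : 0 ≤ (δ ^ 2)⁻¹ * ‖D.W c‖ := by positivity
  have p2 : 0 ≤ (δ ^ 5)⁻¹ * ‖z‖ := by positivity
  have p3 : 0 ≤ K ^ 4 * ((δ ^ 2)⁻¹ * ‖D.W c‖) := by positivity
  have p4 : 0 ≤ K ^ 5 * ((δ ^ 2)⁻¹ * ‖D.W c‖) := by positivity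
  have p5 : 0 ≤ K ^ 4 * ((δ ^ 5)⁻¹ * ‖z‖) := by positivity
  have p6 : 0 ≤ K ^ 5 * ((δ ^ 5)⁻¹ * ‖z‖) := by positivity
  have p7 : 0 ≤ M * ((δ ^ 2)⁻¹ * ‖D.W c‖) := by positivity
  have p8 : 0 ≤ M * ((δ ^ 5)⁻¹ * ‖z‖) := by positivity
  refine ⟨hv, hv.mono (by linarith), ?_, le_rfl, hz21⟩
  have hs : ‖((ampScale M δ : ℝ) : ℂ)‖ = M * (δ ^ 5)⁻¹ := by
    rw [Complex.norm_real, ampScale, Real.norm_of_nonneg (by positivity), div_eq_mul_inv]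
  have h1 : ‖((ampScale M δ : ℝ) : ℂ) * z.2.2.1‖ ≤ M * (δ ^ 5)⁻¹ * ‖z‖ := by
    rw [norm_mul, hs]; gcongr
  have h2 : ‖((ampScale M δ : ℝ) : ℂ) • z.2.2.2‖ ≤ M * (δ ^ 5)⁻¹ * ‖z‖ := by
    rw [norm_smul, hs]; gcongr
  change ‖((ampScale M δ : ℝ) : ℂ) * z.2.2.1‖ + ‖((ampScale M δ : ℝ) : ℂ) • z.2.2.2‖ ≤ _
  linarith

/-- The residuals are O(δ)‖z‖, and so is the self-interaction of (γ, σ). The effect of the viscous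
part on (γ, σ) is of order one in δ; it is made small by the weight M, not by δ. -/
theorem exists_step_bound (hK : 1 ≤ K) : ∃ M : ℝ, 0 < M ∧ ∃ C : ℝ, 0 ≤ C ∧
    ∀ {δ : ℝ} {B : Background} {P : Params} {c : ℂ}, Regime K δ B P c →
    ∀ (D : ForcingData) (z : Iterate),
      let X := unknownsOf B P (ampScale M δ) D c z
      let N := C * (δ ^ 3 * ‖D.W c‖ + δ ^ 7 * (‖D.α c‖ + ‖D.g0‖ + ‖D.g1‖)) + (C * δ + 1 / 4) * ‖z‖
      ‖toL2 (Eub B P c X) + EuH B P c X‖ ≤ N ∧ ‖toL2 (Evb B P c X) + EvH B P c X‖ ≤ N ∧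
      ‖((ampScale M δ : ℝ) : ℂ)⁻¹ * newγ B P c X.F X.γ X.σ‖ ≤ N ∧
      ‖((ampScale M δ : ℝ) : ℂ)⁻¹ • newσ B P c X.F X.γ X.σ‖ ≤ N := by
  obtain ⟨C1, hC10, hC1⟩ := exists_bound_new hK
  set A := 1 + 4 * K ^ 2 with hA
  -- Chosen so that the coupling constant divided by M is at most 1/4. It is fixed before C2, which
  -- depends on M; this is harmless, as C2 reaches the coefficient of ‖z‖ only with a factor δ.
  set M := 4 * (C1 * (A * (6 * K ^ 5)) + 1) with hM
  have hM0 : 0 < M := by positivity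
  obtain ⟨C2, hC20, hC2⟩ := exists_size hK M hM0.le
  obtain ⟨C3, hC31, hC3⟩ := exists_parts hK
  obtain ⟨C4, hC40, hC4⟩ := exists_bound_residual hK
  set Q := C4 * C3 * (C2 + 1) with hQ
  have hQ0 : 0 ≤ Q := by positivity
  have hA0 : 0 ≤ A := by positivity
  refine ⟨M, hM0, Q + C1 * C2 * M⁻¹ + C1 * (A * (12 * K ^ 4)) * M⁻¹, by positivity,
    fun {δ B P c} h D z => ?_⟩
  intro X N
  have hδ := h.δ_pos
  obtain ⟨hv, hX⟩ := hC2 h D z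
  have hr := hC4 h (hC3 h hX)
  set w := ‖D.W c‖ with hw
  set r := ‖D.α c‖ + ‖D.g0‖ with hrr
  set C := Q + C1 * C2 * M⁻¹ + C1 * (A * (12 * K ^ 4)) * M⁻¹ with hC
  have hw0 : 0 ≤ w := norm_nonneg _
  have hr0 : 0 ≤ r := by positivity
  have hz0 : 0 ≤ ‖z‖ := norm_nonneg _
  have hg0 : 0 ≤ ‖D.g1‖ := norm_nonneg _
  have hQC : Q ≤ C := by
    have : 0 ≤ C1 * C2 * M⁻¹ := by positivity
    have : 0 ≤ C1 * (A * (12 * K ^ 4)) * M⁻¹ := by positivity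
    rw [hC]; linarith
  have hE : C4 * (δ ^ 6 * (C3 * (C2 * ((δ ^ 2)⁻¹ * w + (δ ^ 5)⁻¹ * ‖z‖)))
      + δ ^ 7 * (C3 * r + ‖D.g1‖) + δ * (C3 * ‖z‖)) ≤ N := by
    have e1 : δ ^ 6 * ((δ ^ 2)⁻¹ * w + (δ ^ 5)⁻¹ * ‖z‖) = δ ^ 4 * w + δ * ‖z‖ := by
      field_simp
    have e2 : δ ^ 4 * w ≤ δ ^ 3 * w :=
      mul_le_mul_of_nonneg_right (pow_le_pow_of_le_one hδ.le h.δ_le (by norm_num)) hw0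
    calc _ = C4 * C3 * (C2 * (δ ^ 6 * ((δ ^ 2)⁻¹ * w + (δ ^ 5)⁻¹ * ‖z‖)) + δ ^ 7 * r + δ * ‖z‖)
          + C4 * (δ ^ 7 * ‖D.g1‖) := by ring
      _ ≤ C4 * C3 * (C2 * (δ ^ 6 * ((δ ^ 2)⁻¹ * w + (δ ^ 5)⁻¹ * ‖z‖)) + δ ^ 7 * r + δ * ‖z‖)
          + C4 * C3 * (δ ^ 7 * ‖D.g1‖) := by
          gcongr
          exact le_mul_of_one_le_right hC40 hC31
      _ = C4 * C3 * (C2 * (δ ^ 4 * w + δ * ‖z‖) + δ ^ 7 * (r + ‖D.g1‖) + δ * ‖z‖) := by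
          rw [e1]; ring
      _ ≤ C4 * C3 * (C2 * (δ ^ 3 * w + δ ^ 7 * (r + ‖D.g1‖) + δ * ‖z‖)
          + (δ ^ 3 * w + δ ^ 7 * (r + ‖D.g1‖) + δ * ‖z‖)) := by
          have e3 : 0 ≤ δ ^ 7 * (r + ‖D.g1‖) := by positivity
          have e4 : 0 ≤ δ ^ 3 * w := by positivity
          have e5 : C2 * (δ ^ 4 * w + δ * ‖z‖) ≤ C2 * (δ ^ 3 * w + δ ^ 7 * (r + ‖D.g1‖) + δ * ‖z‖) := by
            gcongr; linarith
          gcongr C4 * C3 * ?_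
          linarith
      _ = Q * (δ ^ 3 * w + δ ^ 7 * (r + ‖D.g1‖) + δ * ‖z‖) := by rw [hQ]; ring
      _ ≤ C * (δ ^ 3 * w + δ ^ 7 * (r + ‖D.g1‖) + δ * ‖z‖) := by gcongr
      _ ≤ N := by
          change _ ≤ C * (δ ^ 3 * w + δ ^ 7 * (r + ‖D.g1‖)) + (C * δ + 1 / 4) * ‖z‖
          linarith
  have hnew := hC1 h X.F X.γ X.σ
  have hPh : ‖Ph B P c X.F‖ ≤ A * (12 * K ^ 4 * ((δ ^ 2)⁻¹ * w) + 6 * K ^ 5 * ((δ ^ 5)⁻¹ * ‖z‖)) := by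
    have := h.norm_Ph_le hv.pp_size
    exact le_of_mul_le_mul_left (by linarith) (pow_pos hδ 2)
  have hs : ‖(((ampScale M δ : ℝ) : ℂ))⁻¹‖ = M⁻¹ * δ ^ 5 := by
    rw [norm_inv, Complex.norm_real, ampScale, Real.norm_of_nonneg (by positivity), inv_div,
      div_eq_mul_inv, mul_comm]
  have hn : M⁻¹ * δ ^ 5 * (‖newγ B P c X.F X.γ X.σ‖ + ‖newσ B P c X.F X.γ X.σ‖) ≤ N := by
    have hinv := hX.invisc
    have e1 : δ ^ 5 * (δ * (C2 * ((δ ^ 2)⁻¹ * w + (δ ^ 5)⁻¹ * ‖z‖))) = C2 * (δ ^ 4 * w + δ * ‖z‖) := by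
      field_simp
    have e2 : δ ^ 5 * (A * (12 * K ^ 4 * ((δ ^ 2)⁻¹ * w) + 6 * K ^ 5 * ((δ ^ 5)⁻¹ * ‖z‖)))
        = A * (12 * K ^ 4) * (δ ^ 3 * w) + A * (6 * K ^ 5) * ‖z‖ := by
      field_simp
    have e3 : C1 * (A * (6 * K ^ 5)) * M⁻¹ ≤ 1 / 4 := by
      rw [← div_eq_mul_inv, div_le_iff₀ hM0, hM]; linarith
    have e4 : δ ^ 4 * w ≤ δ ^ 3 * w :=
      mul_le_mul_of_nonneg_right (pow_le_pow_of_le_one hδ.le h.δ_le (by norm_num)) hw0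
    calc _ ≤ M⁻¹ * δ ^ 5 * (C1 * (δ * (C2 * ((δ ^ 2)⁻¹ * w + (δ ^ 5)⁻¹ * ‖z‖))
          + A * (12 * K ^ 4 * ((δ ^ 2)⁻¹ * w) + 6 * K ^ 5 * ((δ ^ 5)⁻¹ * ‖z‖)))) := by
          gcongr
          refine hnew.trans ?_
          gcongr
      _ = M⁻¹ * C1 * (δ ^ 5 * (δ * (C2 * ((δ ^ 2)⁻¹ * w + (δ ^ 5)⁻¹ * ‖z‖)))
          + δ ^ 5 * (A * (12 * K ^ 4 * ((δ ^ 2)⁻¹ * w) + 6 * K ^ 5 * ((δ ^ 5)⁻¹ * ‖z‖)))) := by ring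
      _ = M⁻¹ * C1 * (C2 * (δ ^ 4 * w + δ * ‖z‖) + A * (12 * K ^ 4) * (δ ^ 3 * w))
          + C1 * (A * (6 * K ^ 5)) * M⁻¹ * ‖z‖ := by rw [e1, e2]; ring
      _ ≤ M⁻¹ * C1 * (C2 * (δ ^ 3 * w + δ * ‖z‖) + A * (12 * K ^ 4) * (δ ^ 3 * w + δ * ‖z‖))
          + 1 / 4 * ‖z‖ := by
          gcongr
          have : 0 ≤ δ * ‖z‖ := by positivity
          linarith
      _ = (C - Q) * (δ ^ 3 * w + δ * ‖z‖) + 1 / 4 * ‖z‖ := by rw [hC]; ring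
      _ ≤ C * (δ ^ 3 * w + δ * ‖z‖) + 1 / 4 * ‖z‖ := by gcongr; linarith
      _ ≤ N := by
          change _ ≤ C * (δ ^ 3 * w + δ ^ 7 * (r + ‖D.g1‖)) + (C * δ + 1 / 4) * ‖z‖
          have : 0 ≤ C * (δ ^ 7 * (r + ‖D.g1‖)) := by
            have : 0 ≤ C := hQ0.trans hQC
            positivity
          linarith
  have hM5 : 0 ≤ M⁻¹ * δ ^ 5 := by positivity
  refine ⟨hr.1.trans hE, hr.2.trans hE, ?_, ?_⟩
  · rw [norm_mul, hs]
    exact (mul_le_mul_of_nonneg_left (le_add_of_nonneg_right (norm_nonneg _)) hM5).trans hn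
  · rw [norm_smul, hs]
    exact (mul_le_mul_of_nonneg_left (le_add_of_nonneg_left (norm_nonneg _)) hM5).trans hn

end

/-! ### Solving the fixed point problem. -/

section

variable {K : ℝ}

theorem holo_unknownsOf {B : Background} {P : Params} {c₀ : ℂ} (h : Nondeg B P c₀) (s : ℝ)
    {D : ForcingData} {z : ℂ → Iterate} (hW : DifferentiableAt ℂ D.W c₀)
    (hα : DifferentiableAt ℂ D.α c₀) (hz : DifferentiableAt ℂ z c₀) :
    Unknowns.Holo (fun c => unknownsOf B P s D c (z c)) c₀ where
  F := by
    have h1 := (differentiableAt_clm mulL2 (differentiableAt_Ai h)).clm_apply hz.fst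
    exact (differentiableAt_clm toL2 (differentiableAt_clm coprimL hW)).neg.add
      (h1.const_smul (Complex.I * P.k : ℂ)⁻¹)
  γ := hz.snd.snd.fst.const_mul _
  σ := hz.snd.snd.snd.const_smul (s : ℂ)
  α := hα
  g0 := differentiableAt_const _
  g1 := differentiableAt_const _
  gt := hz.snd.fst

theorem differentiableAt_stepMap {B : Background} {P : Params} {c₀ : ℂ} (h : Nondeg B P c₀) (s : ℝ)
    {D : ForcingData} {z : ℂ → Iterate} (hW : DifferentiableAt ℂ D.W c₀)
    (hα : DifferentiableAt ℂ D.α c₀) (hz : DifferentiableAt ℂ z c₀) :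
    DifferentiableAt ℂ (fun c => stepMap B P s D c (z c)) c₀ := by
  have hX := holo_unknownsOf h s hW hα hz
  have h1 := (differentiableAt_clm toL2 (hX.d_Eub h)).add (hX.d_EuH (B := B) (P := P))
  have h2 := (differentiableAt_clm toL2 (hX.d_Evb h)).add (hX.d_EvH (B := B) (P := P))
  have h3 := differentiableAt_newγ h hX.F hX.γ hX.σ
  have h4 := differentiableAt_newσ h hX.F hX.γ hX.σ
  exact (h1.const_sub D.f).prodMk ((h2.const_sub D.g).prodMk
    ((h3.const_mul (s : ℂ)⁻¹).prodMk (h4.const_smul (s : ℂ)⁻¹)))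

/-- The iteration is affine, and differences evolve by its linear part, which is the iteration with
zero data up to signs. Hence `exists_step_bound` also gives the contraction constant. -/
theorem stepMap_sub (B : Background) (P : Params) (s : ℝ) (D : ForcingData) (c : ℂ)
    (z z' : Iterate) :
    let X := unknownsOf B P s 0 c (z - z')
    stepMap B P s D c z - stepMap B P s D c z' =
      (-(toL2 (Eub B P c X) + EuH B P c X), -(toL2 (Evb B P c X) + EvH B P c X),
        (s : ℂ)⁻¹ * newγ B P c X.F X.γ X.σ, (s : ℂ)⁻¹ • newσ B P c X.F X.γ X.σ) := by
  intro X
  have hX : X = unknownsOf B P s D c z - unknownsOf B P s D c z' := (unknownsOf_sub ..).symm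
  rw [hX, Eub_sub, Evb_sub, EuH_sub, EvH_sub, map_sub, map_sub]
  set Z := unknownsOf B P s D c z with hZ
  set Z' := unknownsOf B P s D c z' with hZ'
  have e1 : newγ B P c (Z - Z').F (Z - Z').γ (Z - Z').σ
      = newγ B P c Z.F Z.γ Z.σ - newγ B P c Z'.F Z'.γ Z'.σ := newγ_sub _ _ _ _ _ _
  have e2 : newσ B P c (Z - Z').F (Z - Z').γ (Z - Z').σ
      = newσ B P c Z.F Z.γ Z.σ - newσ B P c Z'.F Z'.γ Z'.σ := newσ_sub _ _ _ _ _ _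
  rw [e1, e2, mul_sub, smul_sub]
  refine Prod.ext ?_ (Prod.ext ?_ rfl)
  · change D.f - (toL2 (Eub B P c Z) + EuH B P c Z) - (D.f - (toL2 (Eub B P c Z') + EuH B P c Z')) = _
    abel_nf
  · change D.g - (toL2 (Evb B P c Z) + EvH B P c Z) - (D.g - (toL2 (Evb B P c Z') + EvH B P c Z')) = _
    abel_nf

/-- Bounds for a solution and its derivatives. -/
structure SolBound (δ : ℝ) (ρ u v : ℝ → ℂ) (N : ℝ) : Prop where
  ρ_le : l2 ρ ≤ N
  u_le : l2 u ≤ N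
  v_le : l2 v ≤ N
  dρ_le : l2 (weakDeriv ρ) ≤ N
  du_le : l2 (weakDeriv u) ≤ N
  dv_le : l2 (weakDeriv v) ≤ N
  ddu_le : δ ^ 2 * l2 (weakDeriv (weakDeriv u)) ≤ N
  ddv_le : δ ^ 2 * l2 (weakDeriv (weakDeriv v)) ≤ N

/-- The residual is cancelled by feeding it back: at the fixed point the first two components of z
are f and g minus the residuals, so the assembled fields have exactly the prescribed forcing. The
splitting of the forcing into W, α, g0 and (f, g) is left open, so that both estimates follow from
this one statement. -/
theorem exists_solution_family (hK : 1 ≤ K) : ∃ δ₀ : ℝ, 0 < δ₀ ∧ ∃ C : ℝ, 0 ≤ C ∧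
    ∀ {δ : ℝ} {B : Background} {P : Params} {R : Set ℂ}, δ < δ₀ → IsOpen R →
    (∀ c ∈ R, Regime K δ B P c) →
    ∀ {U : ℝ → ℝ}, (∀ y ∈ Ioo (-1 : ℝ) 1, B.U y = (U y : ℂ)) →
    (∀ y ∈ Ioo (-1 : ℝ) 1, B.U1 y = ((deriv U y : ℝ) : ℂ)) →
    (∀ y ∈ Ioo (-1 : ℝ) 1, B.U2 y = ((deriv (deriv U) y : ℝ) : ℂ)) →
    ∀ (D : ForcingData), DifferentiableOn ℂ D.W R → DifferentiableOn ℂ D.α R →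
    HasWeakDeriv D.g0 D.g1 → ∀ {fu fv : ℝ → ℂ},
    (∀ c ∈ R, ∀ᵐ y ∂chan, fu y = Complex.I * P.k * AA B P c y *
      ((-coprimL (D.W c) y) + (D.α c + primL D.g0 y)) + D.f y) →
    (∀ᵐ y ∂chan, fv y = D.g0 y + D.g y) →
    ∃ ρ u v : ℂ → ℝ → ℂ, (∀ c ∈ R,
      IsRemainderSolution U P.m P.lam P.ε P.k c fu fv (ρ c) (u c) (v c) ∧
      SolBound δ (ρ c) (u c) (v c) (C * ((δ ^ 5)⁻¹ * (‖D.f‖ + ‖D.g‖) + (δ ^ 2)⁻¹ * ‖D.W c‖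
        + (‖D.α c‖ + ‖D.g0‖) + δ ^ 2 * ‖D.g1‖))) ∧
      ∀ y, DifferentiableOn ℂ (fun c => u c y) R := by
  obtain ⟨M, hM, C1, hC10, hC1⟩ := exists_step_bound hK
  obtain ⟨C2, hC20, hC2⟩ := exists_size hK M hM.le
  obtain ⟨C3, hC31, hC3⟩ := exists_parts hK
  obtain ⟨C4, hC40, hC4⟩ := exists_bound_sol K
  set E := 2 * (C1 + 1) with hE
  have hE0 : 0 ≤ E := by positivity
  have hC30 : 0 ≤ C3 := by linarith
  -- This threshold ensures C1·δ ≤ 1/4, so the contraction constant is at most 1/4 + 1/4.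
  refine ⟨(4 * (C1 + 1))⁻¹, by positivity, C4 * (C3 * (C2 * (1 + E) + E + 1) + 1), by positivity, ?_⟩
  intro δ B P R hδ0 hR hreg U hU hU1 hU2 D hW hα hg fu fv hfu hfv
  have hstep : ∀ c ∈ R, ∀ z z', ‖stepMap B P (ampScale M δ) D c z
      - stepMap B P (ampScale M δ) D c z'‖ ≤ 1 / 2 * ‖z - z'‖ := fun c hc z z' => by
    have h := hreg c hc
    obtain ⟨b1, b2, b3, b4⟩ := hC1 h 0 (z - z')
    have hz0 : 0 ≤ ‖z - z'‖ := norm_nonneg _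
    have hN : C1 * (δ ^ 3 * ‖(0 : ForcingData).W c‖ + δ ^ 7 * (‖(0 : ForcingData).α c‖
        + ‖(0 : ForcingData).g0‖ + ‖(0 : ForcingData).g1‖)) + (C1 * δ + 1 / 4) * ‖z - z'‖
        ≤ 1 / 2 * ‖z - z'‖ := by
      have e1 : ‖(0 : ForcingData).W c‖ = 0 := norm_zero
      have e2 : ‖(0 : ForcingData).α c‖ = 0 := norm_zero
      have e3 : ‖(0 : ForcingData).g0‖ = 0 := norm_zero
      have e4 : ‖(0 : ForcingData).g1‖ = 0 := norm_zero
      rw [e1, e2, e3, e4]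
      have e5 : δ * (4 * (C1 + 1)) ≤ 1 := by
        rw [← le_div_iff₀ (by positivity), one_div]; exact hδ0.le
      have e6 : C1 * δ ≤ 1 / 4 := by
        have := h.δ_pos
        linarith
      have := mul_le_mul_of_nonneg_right e6 hz0
      linarith
    rw [stepMap_sub, Prod.norm_def, Prod.norm_def, Prod.norm_def]
    refine max_le ?_ (max_le ?_ (max_le (b3.trans hN) (b4.trans hN)))
    · rw [norm_neg]; exact b1.trans hN
    · rw [norm_neg]; exact b2.trans hN
  obtain ⟨z, hzfix, hzd⟩ := exists_holomorphic_fixedPoint hR (stepMap B P (ampScale M δ) D) hstep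
    fun z hz c hc => (differentiableAt_stepMap (hreg c hc).nondeg _
      (hW.differentiableAt (hR.mem_nhds hc)) (hα.differentiableAt (hR.mem_nhds hc))
      (hz.differentiableAt (hR.mem_nhds hc))).differentiableWithinAt
  let X : ℂ → Unknowns := fun c => unknownsOf B P (ampScale M δ) D c (z c)
  refine ⟨fun c => solρ B P c (X c), fun c => solu B P c (X c), fun c => solv B P c (X c),
    fun c hc => ?_, fun y c hc => ?_⟩
  · have h := hreg c hc
    have hδ := h.δ_pos
    have hs : ((ampScale M δ : ℝ) : ℂ) ≠ 0 := by
      have : 0 < ampScale M δ := by rw [ampScale]; positivity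
      exact_mod_cast this.ne'
    have f1 : D.f - (toL2 (Eub B P c (X c)) + EuH B P c (X c)) = (z c).1 :=
      congrArg (fun w : Iterate => w.1) (hzfix c hc)
    have f2 : D.g - (toL2 (Evb B P c (X c)) + EvH B P c (X c)) = (z c).2.1 :=
      congrArg (fun w : Iterate => w.2.1) (hzfix c hc)
    have f3 : ((ampScale M δ : ℝ) : ℂ)⁻¹ * newγ B P c (X c).F (X c).γ (X c).σ = (z c).2.2.1 :=
      congrArg (fun w : Iterate => w.2.2.1) (hzfix c hc)
    have f4 : ((ampScale M δ : ℝ) : ℂ)⁻¹ • newσ B P c (X c).F (X c).γ (X c).σ = (z c).2.2.2 :=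
      congrArg (fun w : Iterate => w.2.2.2) (hzfix c hc)
    have hsol : (X c).Solves B P c :=
      { nondeg := h.nondeg
        eqγ := by
          change _ = ((ampScale M δ : ℝ) : ℂ) * (z c).2.2.1
          rw [← f3, mul_inv_cancel_left₀ hs]
        eqσ := by
          change _ = ((ampScale M δ : ℝ) : ℂ) • (z c).2.2.2
          rw [← f4, smul_smul, mul_inv_cancel₀ hs, one_smul]
        weak_g := hg }
    have hbound : ‖z c‖ ≤ E * (‖D.f‖ + ‖D.g‖
        + (δ ^ 3 * ‖D.W c‖ + δ ^ 7 * (‖D.α c‖ + ‖D.g0‖ + ‖D.g1‖))) := by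
      obtain ⟨b1, b2, b3, b4⟩ := hC1 h D (z c)
      set T := δ ^ 3 * ‖D.W c‖ + δ ^ 7 * (‖D.α c‖ + ‖D.g0‖ + ‖D.g1‖) with hT
      have hT0 : 0 ≤ T := by positivity
      have e5 : δ * (4 * (C1 + 1)) ≤ 1 := by
        rw [← le_div_iff₀ (by positivity), one_div]; exact hδ0.le
      have e6 := mul_le_mul_of_nonneg_right (show C1 * δ ≤ 1 / 4 by linarith) (norm_nonneg (z c))
      have hf := norm_nonneg D.f
      have hg := norm_nonneg D.g
      have key : ‖z c‖ ≤ ‖D.f‖ + ‖D.g‖ + (C1 * T + (C1 * δ + 1 / 4) * ‖z c‖) := by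
        conv_lhs => rw [Prod.norm_def, Prod.norm_def, Prod.norm_def, ← f1, ← f2, ← f3, ← f4]
        refine max_le ?_ (max_le ?_ (max_le (b3.trans (by linarith)) (b4.trans (by linarith))))
        · exact (norm_sub_le _ _).trans (by linarith)
        · exact (norm_sub_le _ _).trans (by linarith)
      have h7 : 0 ≤ C1 * (‖D.f‖ + ‖D.g‖) := by positivity
      rw [hE]
      linarith
    have hr := hC4 h (hC3 h (hC2 h D (z c)).2)
    set T := (δ ^ 5)⁻¹ * (‖D.f‖ + ‖D.g‖) + (δ ^ 2)⁻¹ * ‖D.W c‖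
        + (‖D.α c‖ + ‖D.g0‖) + δ ^ 2 * ‖D.g1‖ with hT
    have hf := norm_nonneg D.f
    have hgn := norm_nonneg D.g
    have hw := norm_nonneg (D.W c)
    have hg1 := norm_nonneg D.g1
    have hrn : 0 ≤ ‖D.α c‖ + ‖D.g0‖ := by positivity
    have t1 : 0 ≤ (δ ^ 5)⁻¹ * (‖D.f‖ + ‖D.g‖) := by positivity
    have t2 : 0 ≤ (δ ^ 2)⁻¹ * ‖D.W c‖ := by positivity
    have t3 : 0 ≤ δ ^ 2 * ‖D.g1‖ := by positivity
    have hT0 : 0 ≤ T := by positivity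
    have hd2 : δ ^ 2 * (‖D.α c‖ + ‖D.g0‖) ≤ ‖D.α c‖ + ‖D.g0‖ :=
      mul_le_of_le_one_left hrn (h.pow_le_one 2)
    have hzT : (δ ^ 5)⁻¹ * ‖z c‖ ≤ E * T := by
      have e1 : (δ ^ 5)⁻¹ * (E * (‖D.f‖ + ‖D.g‖
        + (δ ^ 3 * ‖D.W c‖ + δ ^ 7 * (‖D.α c‖ + ‖D.g0‖ + ‖D.g1‖))))
        = E * ((δ ^ 5)⁻¹ * (‖D.f‖ + ‖D.g‖) + (δ ^ 2)⁻¹ * ‖D.W c‖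
          + δ ^ 2 * (‖D.α c‖ + ‖D.g0‖) + δ ^ 2 * ‖D.g1‖) := by
        field_simp
        ring
      calc _ ≤ (δ ^ 5)⁻¹ * (E * (‖D.f‖ + ‖D.g‖
        + (δ ^ 3 * ‖D.W c‖ + δ ^ 7 * (‖D.α c‖ + ‖D.g0‖ + ‖D.g1‖)))) := by gcongr
        _ = _ := e1
        _ ≤ _ := by
          gcongr
          rw [hT]
          linarith
    have hS : C2 * ((δ ^ 2)⁻¹ * ‖D.W c‖ + (δ ^ 5)⁻¹ * ‖z c‖) ≤ C2 * (1 + E) * T := by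
      rw [mul_assoc]
      gcongr
      linarith
    have hz5 : ‖z c‖ ≤ (δ ^ 5)⁻¹ * ‖z c‖ :=
      le_mul_of_one_le_left (norm_nonneg _) ((one_le_inv₀ (pow_pos hδ 5)).2 (h.pow_le_one 5))
    have hrT : ‖D.α c‖ + ‖D.g0‖ ≤ T := by linarith
    have hC2' : 0 ≤ C2 * (1 + E) := by positivity
    have hall : C3 * (C2 * ((δ ^ 2)⁻¹ * ‖D.W c‖ + (δ ^ 5)⁻¹ * ‖z c‖)) + C3 * (‖D.α c‖ + ‖D.g0‖)
        + C3 * ‖z c‖ ≤ C3 * (C2 * (1 + E) + E + 1) * T := by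
      have := mul_le_mul_of_nonneg_left (add_le_add (add_le_add hS hrT) (hz5.trans hzT)) hC30
      linarith
    have hX1 : ‖(X c).g1‖ = ‖D.g1‖ := rfl
    have hd2' : ∀ {a : ℝ}, 0 ≤ a → δ ^ 2 * a ≤ a := fun ha =>
      mul_le_of_le_one_left ha (h.pow_le_one 2)
    have hall2 : C3 * (C2 * ((δ ^ 2)⁻¹ * ‖D.W c‖ + (δ ^ 5)⁻¹ * ‖z c‖))
        + δ ^ 2 * (C3 * (‖D.α c‖ + ‖D.g0‖) + ‖(X c).g1‖ + C3 * ‖z c‖)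
        ≤ (C3 * (C2 * (1 + E) + E + 1) + 1) * T := by
      have e1 := hd2' (show 0 ≤ C3 * (‖D.α c‖ + ‖D.g0‖) by positivity)
      have e2 := hd2' (show 0 ≤ C3 * ‖z c‖ by positivity)
      rw [hX1]
      linarith
    have g1 : ∀ {a : ℝ}, a ≤ C4 * (C3 * (C2 * ((δ ^ 2)⁻¹ * ‖D.W c‖ + (δ ^ 5)⁻¹ * ‖z c‖))
        + C3 * (‖D.α c‖ + ‖D.g0‖) + C3 * ‖z c‖) →
        a ≤ C4 * (C3 * (C2 * (1 + E) + E + 1) + 1) * T := fun ha => by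
      have := mul_le_mul_of_nonneg_left hall hC40
      have : 0 ≤ C4 * T := by positivity
      linarith
    have g2 : ∀ {a : ℝ}, a ≤ C4 * (C3 * (C2 * ((δ ^ 2)⁻¹ * ‖D.W c‖ + (δ ^ 5)⁻¹ * ‖z c‖))
        + δ ^ 2 * (C3 * (‖D.α c‖ + ‖D.g0‖) + ‖(X c).g1‖ + C3 * ‖z c‖)) →
        a ≤ C4 * (C3 * (C2 * (1 + E) + E + 1) + 1) * T := fun ha => by
      have := mul_le_mul_of_nonneg_left hall2 hC40
      linarith
    obtain ⟨r1, r2, r3, r4, r5, r6, r7, r8⟩ := hr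
    refine ⟨hsol.isRemainderSolution hU hU1 hU2 ?_ ?_, g1 r1, g1 r2, g1 r3, ?_, ?_, ?_, ?_, ?_⟩
    · have e1 := Lp.coeFn_sub D.f (toL2 (Eub B P c (X c)) + EuH B P c (X c))
      have e2 := Lp.coeFn_add (toL2 (Eub B P c (X c))) (EuH B P c (X c))
      have e3 := coeFn_toL2 (Eub B P c (X c))
      rw [f1] at e1
      have e4 := Lp.coeFn_add (-toL2 (coprimL (D.W c)))
        ((Complex.I * P.k : ℂ)⁻¹ • mulL2 (Ai B P c) (z c).1)
      have e5 := Lp.coeFn_neg (toL2 (coprimL (D.W c)))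
      have e6 := coeFn_toL2 (coprimL (D.W c))
      have e7 := Lp.coeFn_smul (Complex.I * P.k : ℂ)⁻¹ (mulL2 (Ai B P c) (z c).1)
      have e8 := coeFn_mulL2 (Ai B P c) (z c).1
      filter_upwards [hfu c hc, e1, e2, e3, e4, e5, e6, e7, e8] with y h0 h1 h2 h3 h4 h5 h6 h7 h8
      have hF : (X c).F y = -coprimL (D.W c) y + (Complex.I * P.k : ℂ)⁻¹ * ((AA B P c y)⁻¹ * (z c).1 y) := by
        change (-toL2 (coprimL (D.W c)) + (Complex.I * P.k : ℂ)⁻¹ • mulL2 (Ai B P c) (z c).1 :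
          HilbertL2) y = _
        rw [h4, Pi.add_apply, h5, Pi.neg_apply, h6, h7, Pi.smul_apply, h8, h.nondeg.Ai_apply,
          smul_eq_mul]
      rw [Pi.sub_apply, h2, Pi.add_apply, h3] at h1
      have hρ : ρ0 (X c) y = D.α c + primL D.g0 y := by
        change ((D.α c) • (1 : ℝ →ᵇ ℂ) + primL D.g0 : ℝ →ᵇ ℂ) y = _
        simp
      have hA := h.nondeg.AA_ne y
      have hk : (P.k : ℂ) ≠ 0 := by exact_mod_cast h.k_pos.ne'
      have hI := Complex.I_ne_zero
      rw [h0, hF, hρ, h1]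
      field_simp
      ring
    · have e1 := Lp.coeFn_sub D.g (toL2 (Evb B P c (X c)) + EvH B P c (X c))
      have e2 := Lp.coeFn_add (toL2 (Evb B P c (X c))) (EvH B P c (X c))
      have e3 := coeFn_toL2 (Evb B P c (X c))
      rw [f2] at e1
      filter_upwards [hfv, e1, e2, e3] with y h0 h1 h2 h3
      rw [Pi.sub_apply, h2, Pi.add_apply, h3] at h1
      change _ = D.g0 y + (z c).2.1 y + _ + _
      rw [h0, h1]
      ring
    · rw [l2_congr hsol.wd_solρ.weakDeriv_ae_eq]; exact g1 r4
    · rw [l2_congr hsol.wd_solu.weakDeriv_ae_eq]; exact g1 r5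
    · rw [l2_congr hsol.wd_solv.weakDeriv_ae_eq]; exact g1 r6
    · rw [l2_congr (weakDeriv_weakDeriv_ae_eq hsol.wd_solu hsol.wd_solu')]; exact g2 r7
    · rw [l2_congr (weakDeriv_weakDeriv_ae_eq hsol.wd_solv hsol.wd_solv')]; exact g2 r8
  · have h := (hreg c hc).nondeg
    have hX := holo_unknownsOf h (ampScale M δ) (hW.differentiableAt (hR.mem_nhds hc))
      (hα.differentiableAt (hR.mem_nhds hc)) (hzd.differentiableAt (hR.mem_nhds hc))
    exact (differentiableAt_eval (hX.d_solu h) y).differentiableWithinAt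

end

section

/-! ### The background flow -/

/-- The projection of the line to `[-1,1]`. -/
def clip (y : ℝ) : ℝ := max (-1) (min 1 y)

theorem clip_mem (y : ℝ) : clip y ∈ Icc (-1 : ℝ) 1 :=
  ⟨le_max_left _ _, max_le (by norm_num) (min_le_left _ _)⟩

theorem clip_eq {y : ℝ} (hy : y ∈ Icc (-1 : ℝ) 1) : clip y = y := by
  rw [clip, min_eq_right hy.2, max_eq_right hy.1]

theorem continuous_clip : Continuous clip := by unfold clip; fun_prop

/-- The restriction of a continuous function to `[-1,1]`, extended by constants. -/
def clipped (g : ℝ → ℝ) (hg : Continuous g) : ℝ →ᵇ ℂ :=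
  BoundedContinuousFunction.ofNormedAddCommGroup (fun y => (g (clip y) : ℂ))
    (Complex.continuous_ofReal.comp (hg.comp continuous_clip))
    (isCompact_Icc.exists_bound_of_continuousOn (s := Icc (-1 : ℝ) 1) hg.continuousOn).choose
    fun y => by
      rw [Complex.norm_real]
      exact (isCompact_Icc.exists_bound_of_continuousOn (s := Icc (-1 : ℝ) 1)
        hg.continuousOn).choose_spec _ (clip_mem y)

theorem clipped_apply {g : ℝ → ℝ} (hg : Continuous g) (y : ℝ) :
    clipped g hg y = (g (clip y) : ℂ) := rfl

theorem clipped_eq {g : ℝ → ℝ} (hg : Continuous g) {y : ℝ} (hy : y ∈ Icc (-1 : ℝ) 1) :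
    clipped g hg y = (g y : ℂ) := by rw [clipped_apply, clip_eq hy]

theorem hasDerivAt_clipped {g g' : ℝ → ℝ} (hg : Continuous g) (hg' : Continuous g')
    (h : ∀ y, HasDerivAt g (g' y) y) {y : ℝ} (hy : y ∈ Ioo (-1 : ℝ) 1) :
    HasDerivAt (clipped g hg) (clipped g' hg' y) y := by
  rw [clipped_eq hg' (Ioo_subset_Icc_self hy)]
  refine (h y).ofReal_comp.congr_of_eventuallyEq ?_
  filter_upwards [isOpen_Ioo.mem_nhds hy] with x hx
  exact clipped_eq hg (Ioo_subset_Icc_self hx)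

theorem contDiffOn_clipped {g : ℝ → ℝ} (hg : ContDiff ℝ ∞ g) :
    ContDiffOn ℝ ∞ (clipped g hg.continuous) (Ioo (-1) 1) :=
  (Complex.ofRealCLM.contDiff.comp hg).contDiffOn.congr fun _ hx =>
    clipped_eq hg.continuous (Ioo_subset_Icc_self hx)

theorem contDiff_deriv_infty {g : ℝ → ℝ} (hg : ContDiff ℝ ∞ g) : ContDiff ℝ ∞ (deriv g) :=
  (contDiff_infty_iff_deriv.1 hg).2

theorem hasDerivAt_of_contDiff {g : ℝ → ℝ} (hg : ContDiff ℝ ∞ g) (y : ℝ) :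
    HasDerivAt g (deriv g y) y := ((contDiff_infty_iff_deriv.1 hg).1 y).hasDerivAt

/-- The affine function interpolating `1/U'` at the walls. -/
def wallInterp (U : ℝ → ℝ) (y : ℝ) : ℝ :=
  (1 - y) / 2 * (deriv U (-1))⁻¹ + (1 + y) / 2 * (deriv U 1)⁻¹

def wallSlope (U : ℝ → ℝ) : ℝ := -(1 / 2) * (deriv U (-1))⁻¹ + 1 / 2 * (deriv U 1)⁻¹

theorem hasDerivAt_wallInterp (U : ℝ → ℝ) (y : ℝ) :
    HasDerivAt (wallInterp U) (wallSlope U) y := by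
  have h1 := (((hasDerivAt_id y).const_sub 1).div_const 2).mul_const (deriv U (-1))⁻¹
  have h2 := (((hasDerivAt_id y).const_add 1).div_const 2).mul_const (deriv U 1)⁻¹
  refine (h1.add h2).congr_deriv ?_
  rw [wallSlope]; ring

theorem continuous_wallInterp (U : ℝ → ℝ) : Continuous (wallInterp U) :=
  continuous_iff_continuousAt.2 fun y => (hasDerivAt_wallInterp U y).continuousAt

namespace IsPoiseuilleType

variable {U : ℝ → ℝ} (hU : IsPoiseuilleType U)
include hU

theorem s1 : ContDiff ℝ ∞ (deriv U) := contDiff_deriv_infty hU.smooth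
theorem s2 : ContDiff ℝ ∞ (deriv (deriv U)) := contDiff_deriv_infty hU.s1
theorem s3 : ContDiff ℝ ∞ (deriv (deriv (deriv U))) := contDiff_deriv_infty hU.s2

/-- The `Background` of a profile. -/
def background : Background where
  U := clipped U hU.smooth.continuous
  U1 := clipped (deriv U) hU.s1.continuous
  U2 := clipped (deriv (deriv U)) hU.s2.continuous
  U3 := clipped (deriv (deriv (deriv U))) hU.s3.continuous
  L := clipped (wallInterp U) (continuous_wallInterp U)
  L1 := clipped (fun _ => wallSlope U) continuous_const

theorem background_valid : hU.background.Valid where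
  real y := Complex.ofReal_im _
  dU y hy := hasDerivAt_clipped hU.smooth.continuous hU.s1.continuous (hasDerivAt_of_contDiff hU.smooth) hy
  dU1 y hy := hasDerivAt_clipped hU.s1.continuous hU.s2.continuous (hasDerivAt_of_contDiff hU.s1) hy
  dU2 y hy := hasDerivAt_clipped hU.s2.continuous hU.s3.continuous (hasDerivAt_of_contDiff hU.s2) hy
  dL y hy := hasDerivAt_clipped (continuous_wallInterp U) continuous_const (hasDerivAt_wallInterp U) hy
  smoothU := contDiffOn_clipped hU.smooth
  smoothU1 := contDiffOn_clipped hU.s1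
  U_left := by
    change clipped U hU.smooth.continuous (-1) = 0
    rw [clipped_eq _ (by norm_num), hU.left, Complex.ofReal_zero]
  U_right := by
    change clipped U hU.smooth.continuous 1 = 0
    rw [clipped_eq _ (by norm_num), hU.right, Complex.ofReal_zero]
  L_left := by
    change clipped (wallInterp U) (continuous_wallInterp U) (-1) * clipped (deriv U) hU.s1.continuous (-1) = 1
    rw [clipped_eq _ (by norm_num), clipped_eq _ (by norm_num), ← Complex.ofReal_mul,
      ← Complex.ofReal_one, wallInterp]
    congr 1
    have := hU.deriv_left.ne'
    field_simp
    norm_num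
  L_right := by
    change clipped (wallInterp U) (continuous_wallInterp U) 1 * clipped (deriv U) hU.s1.continuous 1 = 1
    rw [clipped_eq _ (by norm_num), clipped_eq _ (by norm_num), ← Complex.ofReal_mul,
      ← Complex.ofReal_one, wallInterp]
    congr 1
    have := hU.deriv_right.ne
    field_simp
    norm_num

theorem concaveOn : ConcaveOn ℝ (Icc (-1) 1) U := by
  refine concaveOn_of_deriv2_nonpos (convex_Icc _ _) hU.smooth.continuous.continuousOn ?_ ?_ ?_
  · exact fun y _ => (hasDerivAt_of_contDiff hU.smooth y).differentiableAt.differentiableWithinAt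
  · exact fun y _ => (hasDerivAt_of_contDiff hU.s1 y).differentiableAt.differentiableWithinAt
  · intro y hy
    rw [interior_Icc] at hy
    exact (hU.concave y hy).le

/-- By concavity the graph lies above the two chords joining the wall points to a point where U = 1.
Each chord spans a length at most 2, so its slope is at least 1/2 in absolute value. -/
theorem lower {y : ℝ} (hy : y ∈ Icc (-1 : ℝ) 1) : 1 - |y| ≤ 2 * U y := by
  obtain ⟨⟨y0, hy0, h1⟩, -⟩ := hU.max_eq_one
  have hc := hU.concaveOn
  have hl : (-1 : ℝ) ∈ Icc (-1 : ℝ) 1 := by norm_num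
  have hr : (1 : ℝ) ∈ Icc (-1 : ℝ) 1 := by norm_num
  have hne1 : -1 < y0 := by
    rcases hy0.1.eq_or_lt with h | h
    · rw [← h, hU.left] at h1; norm_num at h1
    · exact h
  have hne2 : y0 < 1 := by
    rcases hy0.2.eq_or_lt with h | h
    · rw [h, hU.right] at h1; norm_num at h1
    · exact h
  rcases le_total y y0 with h | h
  · have h2 := hc.2 hl hy0 (show 0 ≤ (y0 - y) / (y0 + 1) from div_nonneg (by linarith) (by linarith))
      (show 0 ≤ (y + 1) / (y0 + 1) from div_nonneg (by linarith [hy.1]) (by linarith))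
      (by have : y0 + 1 ≠ 0 := by linarith
          rw [← add_div, div_eq_one_iff_eq this]; ring)
    have e : ((y0 - y) / (y0 + 1)) • (-1 : ℝ) + ((y + 1) / (y0 + 1)) • y0 = y := by
      have : y0 + 1 ≠ 0 := by linarith
      simp only [smul_eq_mul]; field_simp; ring
    rw [e, hU.left, h1, smul_zero, zero_add, smul_eq_mul, mul_one] at h2
    have h3 : (y + 1) / 2 ≤ (y + 1) / (y0 + 1) :=
      div_le_div_of_nonneg_left (by linarith [hy.1]) (by linarith) (by linarith)
    have := neg_le_abs y
    linarith
  · have h2 := hc.2 hy0 hr (show 0 ≤ (1 - y) / (1 - y0) from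
        div_nonneg (by linarith [hy.2]) (by linarith))
      (show 0 ≤ (y - y0) / (1 - y0) from div_nonneg (by linarith) (by linarith))
      (by have : 1 - y0 ≠ 0 := by linarith
          rw [← add_div, div_eq_one_iff_eq this]; ring)
    have e : ((1 - y) / (1 - y0)) • y0 + ((y - y0) / (1 - y0)) • (1 : ℝ) = y := by
      have : 1 - y0 ≠ 0 := by linarith
      simp only [smul_eq_mul]; field_simp; ring
    rw [e, hU.right, h1, smul_zero, add_zero, smul_eq_mul, mul_one] at h2
    have h3 : (1 - y) / 2 ≤ (1 - y) / (1 - y0) :=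
      div_le_div_of_nonneg_left (by linarith [hy.2]) (by linarith) (by linarith)
    have := le_abs_self y
    linarith

theorem nonneg {y : ℝ} (hy : y ∈ Icc (-1 : ℝ) 1) : 0 ≤ U y := by
  have := hU.lower hy
  have := abs_le.2 hy
  linarith

theorem norm_U_le : ‖hU.background.U‖ ≤ 1 := by
  refine (BoundedContinuousFunction.norm_le zero_le_one).2 fun y => ?_
  change ‖((U (clip y) : ℝ) : ℂ)‖ ≤ 1
  rw [Complex.norm_real, Real.norm_of_nonneg (hU.nonneg (clip_mem y))]
  exact hU.max_eq_one.2 ⟨_, clip_mem y, rfl⟩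

/-- The function 1 - LU' vanishes at both walls by the choice of L, and it is Lipschitz, so it is
bounded by the distance to the nearer wall. Combined with `dist_le`, this gives the field `near` of
`Regime`. -/
theorem exists_near : ∃ M : ℝ, 0 ≤ M ∧ ∀ y, ‖1 - hU.background.L y * hU.background.U1 y‖
    ≤ M * (1 - |clip y|) := by
  set f : ℝ → ℝ := fun y => 1 - wallInterp U y * deriv U y with hf
  have hd : ∀ y, HasDerivAt f (-(wallSlope U * deriv U y + wallInterp U y * deriv (deriv U) y)) y :=
    fun y => ((hasDerivAt_wallInterp U y).mul (hasDerivAt_of_contDiff hU.s1 y)).const_sub 1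
  have hc : Continuous fun y => -(wallSlope U * deriv U y + wallInterp U y * deriv (deriv U) y) :=
    ((continuous_const.mul hU.s1.continuous).add
      ((continuous_wallInterp U).mul hU.s2.continuous)).neg
  obtain ⟨M, hM⟩ := isCompact_Icc.exists_bound_of_continuousOn (s := Icc (-1 : ℝ) 1) hc.continuousOn
  have hl : (-1 : ℝ) ∈ Icc (-1 : ℝ) 1 := by norm_num
  have hr : (1 : ℝ) ∈ Icc (-1 : ℝ) 1 := by norm_num
  have hM0 : 0 ≤ M := (norm_nonneg _).trans (hM _ hl)
  have hlip : ∀ x ∈ Icc (-1 : ℝ) 1, ∀ y ∈ Icc (-1 : ℝ) 1, ‖f y - f x‖ ≤ M * ‖y - x‖ :=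
    fun x hx y hy => (convex_Icc (-1 : ℝ) 1).norm_image_sub_le_of_norm_hasDerivWithin_le
      (fun z _ => (hd z).hasDerivWithinAt) hM hx hy
  have f1 : f 1 = 0 := by
    have := hU.deriv_right.ne
    simp only [hf, wallInterp]; field_simp; norm_num
  have f2 : f (-1) = 0 := by
    have := hU.deriv_left.ne'
    simp only [hf, wallInterp]; field_simp; norm_num
  refine ⟨M, hM0, fun y => ?_⟩
  have hy := clip_mem y
  have e : 1 - hU.background.L y * hU.background.U1 y = ((f (clip y) : ℝ) : ℂ) := by
    change 1 - ((wallInterp U (clip y) : ℝ) : ℂ) * ((deriv U (clip y) : ℝ) : ℂ) = _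
    simp only [hf]; push_cast; ring
  rw [e, Complex.norm_real]
  rcases le_total 0 (clip y) with h | h
  · have := hlip 1 hr _ hy
    rw [f1, sub_zero, Real.norm_eq_abs (_ - 1), abs_sub_comm, abs_of_nonneg (by linarith [hy.2])]
      at this
    rwa [abs_of_nonneg h]
  · have := hlip (-1) hl _ hy
    rw [f2, sub_zero, Real.norm_eq_abs (_ - -1), abs_of_nonneg (by linarith [hy.1])] at this
    rw [abs_of_nonpos h]
    have e2 : clip y - -1 = 1 - -clip y := by ring
    rwa [e2] at this

end IsPoiseuilleType

/-! ### The square integral of `(U - c)⁻¹` -/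

theorem l2_sq {f : ℝ → ℂ} (hf : MemL2 f) : l2 f ^ 2 = ∫ y, ‖f y‖ ^ 2 ∂chan := by
  have h0 : 0 ≤ ∫ y, ‖f y‖ ^ 2 ∂chan := integral_nonneg fun y => by positivity
  rw [l2, MemLp.eLpNorm_eq_integral_rpow_norm (by norm_num) (by norm_num) hf]
  norm_num
  rw [ENNReal.toReal_ofReal (by positivity), ← Real.sqrt_eq_rpow, Real.sq_sqrt h0]

/-- The square has the primitive -τ/(1 + τy + s), and the integral is 1/s - 1/(2 + s). The sign τ
selects the wall at which the function is large. -/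
theorem memL2_inv_wall {s τ : ℝ} (hs : 0 < s) (hτ : τ = 1 ∨ τ = -1) :
    MemL2 (fun y => (((1 + τ * clip y + s : ℝ) : ℂ))⁻¹) ∧
      l2 (fun y => (((1 + τ * clip y + s : ℝ) : ℂ))⁻¹) ≤ (Real.sqrt s)⁻¹ := by
  have hpos : ∀ y ∈ Icc (-1 : ℝ) 1, s ≤ 1 + τ * y + s := fun y hy => by
    rcases hτ with rfl | rfl <;> linarith [hy.1, hy.2]
  have hm : MemL2 (fun y => (((1 + τ * clip y + s : ℝ) : ℂ))⁻¹) := by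
    refine MemLp.of_bound (Continuous.aestronglyMeasurable ?_) s⁻¹ (.of_forall fun y => ?_)
    · refine Continuous.inv₀ (Complex.continuous_ofReal.comp ?_) fun y => ?_
      · have := continuous_clip; fun_prop
      · have := hpos _ (clip_mem y)
        exact_mod_cast (by linarith : 1 + τ * clip y + s ≠ 0)
    · have := hpos _ (clip_mem y)
      rw [norm_inv, Complex.norm_real, Real.norm_of_nonneg (by linarith)]
      exact inv_anti₀ hs this
  refine ⟨hm, le_of_abs_le (abs_le_of_sq_le_sq ?_ (by positivity))⟩
  rw [l2_sq hm, inv_pow, Real.sq_sqrt hs.le]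
  have h1 : ∫ y, ‖(((1 + τ * clip y + s : ℝ) : ℂ))⁻¹‖ ^ 2 ∂chan
      = ∫ y in (-1 : ℝ)..1, ((1 + τ * y + s) ^ 2)⁻¹ := by
    rw [intervalIntegral.integral_of_le (by norm_num), integral_Ioc_eq_integral_Ioo]
    refine setIntegral_congr_fun measurableSet_Ioo fun y hy => ?_
    have hy' := Ioo_subset_Icc_self hy
    simp only [clip_eq hy']
    rw [norm_inv, Complex.norm_real, inv_pow, Real.norm_eq_abs, sq_abs]
  have h2 : ∫ y in (-1 : ℝ)..1, ((1 + τ * y + s) ^ 2)⁻¹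
      = -τ * (1 + τ * 1 + s)⁻¹ - -τ * (1 + τ * (-1) + s)⁻¹ := by
    refine intervalIntegral.integral_eq_sub_of_hasDerivAt (f := fun y => -τ * (1 + τ * y + s)⁻¹)
      (fun y hy => ?_) ?_
    · rw [uIcc_of_le (by norm_num)] at hy
      have hne : 1 + τ * y + s ≠ 0 := by linarith [hpos y hy]
      have d : HasDerivAt (fun y => 1 + τ * y + s) τ y := by
        simpa using (((hasDerivAt_id y).const_mul τ).const_add 1).add_const s
      refine ((d.inv hne).const_mul (-τ)).congr_deriv ?_
      have : τ * τ = 1 := by rcases hτ with rfl | rfl <;> norm_num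
      rw [mul_div_assoc', neg_mul_neg, this, one_div]
    · refine ContinuousOn.intervalIntegrable ?_
      rw [uIcc_of_le (by norm_num)]
      refine ContinuousOn.inv₀ (by fun_prop) fun y hy => ?_
      have : 0 < 1 + τ * y + s := by linarith [hpos y hy]
      positivity
  rw [h1, h2]
  have h3 : 0 ≤ (2 + s)⁻¹ := by positivity
  rcases hτ with rfl | rfl
  · have e1 : (1 + 1 * 1 + s : ℝ) = 2 + s := by ring
    have e2 : (1 + 1 * (-1) + s : ℝ) = s := by ring
    rw [e1, e2]; linarith
  · have e1 : (1 + -1 * 1 + s : ℝ) = s := by ring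
    have e2 : (1 + -1 * (-1) + s : ℝ) = 2 + s := by ring
    rw [e1, e2]; linarith

end

/-! ### Verification of the asymptotic regime for a given profile. -/

section

namespace IsPoiseuilleType

variable {U : ℝ → ℝ} (hU : IsPoiseuilleType U)
include hU

theorem norm_ee_le {c : ℂ} (y : ℝ) : ‖ee hU.background c y‖ ≤ 1 + ‖c‖ := by
  rw [ee_apply]
  exact (norm_sub_le _ _).trans (add_le_add
    ((BoundedContinuousFunction.norm_coe_le_norm _ y).trans hU.norm_U_le) le_rfl)

theorem im_le_norm_ee {c : ℂ} (hc : 0 < c.im) (y : ℝ) : c.im ≤ ‖ee hU.background c y‖ := by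
  have := Complex.abs_im_le_norm (ee hU.background c y)
  rwa [ee_im hU.background_valid, abs_neg, abs_of_pos hc] at this

/-- `|U - c|` controls the distance to the walls. -/
theorem dist_le {c : ℂ} {a b s : ℝ} (ha : 0 < a) (hab : a < b) (hs : 0 < s)
    (hre : c.re ≤ b * s) (him : a * s ≤ c.im) (y : ℝ) :
    1 - |clip y| ≤ 2 * (1 + b / a) * ‖ee hU.background c y‖ := by
  have h1 := hU.lower (clip_mem y)
  have h2 := hU.im_le_norm_ee (c := c) (by nlinarith) y
  have h3 := Complex.re_le_norm (ee hU.background c y)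
  have h4 : (ee hU.background c y).re = U (clip y) - c.re := by
    rw [ee_apply, Complex.sub_re]; rfl
  rw [h4] at h3
  set e := ‖ee hU.background c y‖
  have h5 : b * s ≤ b / a * e := by
    rw [div_mul_eq_mul_div, le_div_iff₀ ha]
    nlinarith
  linarith

/-- |U - c| dominates both the distance to the walls and Im c ≥ aδ², hence their sum. Thus |1/(U -
c)| is bounded by the two explicit wall profiles with s = δ², each of L² norm at most 1/δ. -/
theorem l2_ei_le {c : ℂ} {a b δ : ℝ} (ha : 0 < a) (hab : a < b) (hδ : 0 < δ)
    (hre : c.re ≤ b * δ ^ 2) (him : a * δ ^ 2 ≤ c.im) :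
    δ * l2 (ei hU.background c) ≤ 2 * (2 * (1 + b / a) + a⁻¹) := by
  have hc : 0 < c.im := by have : 0 < a * δ ^ 2 := by positivity
                           linarith
  set Q := 2 * (1 + b / a) + a⁻¹ with hQ
  have hb : 0 < b := ha.trans hab
  have hQ0 : 0 ≤ Q := by positivity
  have hs : 0 < δ ^ 2 := by positivity
  have hu : IsUnit (ee hU.background c) := isUnit_bcf hc (hU.im_le_norm_ee hc)
  obtain ⟨m1, n1⟩ := memL2_inv_wall hs (Or.inl rfl)
  obtain ⟨m2, n2⟩ := memL2_inv_wall hs (Or.inr rfl)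
  have key := l2_le_sum (n := 2) (f := ei hU.background c) (g := ![fun y => (((1 + 1 * clip y
      + δ ^ 2 : ℝ) : ℂ))⁻¹, fun y => (((1 + -1 * clip y + δ ^ 2 : ℝ) : ℂ))⁻¹]) hQ0
    (by intro i; fin_cases i; exacts [m1, m2]) (.of_forall fun y => by
      have hy := clip_mem y
      have p1 : 0 < 1 + 1 * clip y + δ ^ 2 := by linarith [hy.1]
      have p2 : 0 < 1 + -1 * clip y + δ ^ 2 := by linarith [hy.2]
      have h1 := hU.dist_le ha hab hs hre him y
      have h2 := hU.im_le_norm_ee hc y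
      have h3 : δ ^ 2 ≤ a⁻¹ * ‖ee hU.background c y‖ := by
        rw [inv_mul_eq_div, le_div_iff₀ ha]; linarith
      have h4 : 1 - |clip y| + δ ^ 2 ≤ Q * ‖ee hU.background c y‖ := by rw [hQ]; linarith
      have p3 : 0 < ‖ee hU.background c y‖ := hc.trans_le h2
      have h5 : ‖ei hU.background c y‖ ≤ Q * (1 - |clip y| + δ ^ 2)⁻¹ := by
        have : 0 < 1 - |clip y| + δ ^ 2 := by have := abs_le.2 hy; linarith
        rw [ei, inverse_bcf_apply hu, norm_inv, ← div_eq_mul_inv, le_div_iff₀ this,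
          inv_mul_le_iff₀ p3]
        linarith
      have q1 : 0 ≤ (1 + 1 * clip y + δ ^ 2)⁻¹ := inv_nonneg.2 p1.le
      have q2 : 0 ≤ (1 + -1 * clip y + δ ^ 2)⁻¹ := inv_nonneg.2 p2.le
      simp only [Fin.sum_univ_two, Matrix.cons_val_zero, Matrix.cons_val_one, norm_inv,
        Complex.norm_real, Real.norm_of_nonneg p1.le, Real.norm_of_nonneg p2.le]
      refine h5.trans ?_
      gcongr
      rcases le_total 0 (clip y) with h | h
      · rw [abs_of_nonneg h]
        have : 1 - clip y + δ ^ 2 = 1 + -1 * clip y + δ ^ 2 := by ring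
        rw [this]; linarith
      · rw [abs_of_nonpos h]
        have : 1 - -clip y + δ ^ 2 = 1 + 1 * clip y + δ ^ 2 := by ring
        rw [this]; linarith)
  simp only [Fin.sum_univ_two, Matrix.cons_val_zero, Matrix.cons_val_one] at key
  rw [Real.sqrt_sq hδ.le] at n1 n2
  calc _ ≤ δ * (Q * (δ⁻¹ + δ⁻¹)) := by
        gcongr
        refine key.trans ?_
        gcongr
    _ = 2 * Q := by field_simp; ring

/-- Only the imaginary part is used. At c = 0 the integral multiplying k² is ∫U², which is real, so
its imaginary part is O(|c|), and Im c (U'(-1) - U'(1)) cannot be cancelled to leading order. -/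
theorem norm_disp_ge {P : Params} {c : ℂ} (hm0 : 0 < P.m) (hm1 : P.m ≤ 1) (hc : ‖c‖ ≤ 1 / 2) :
    c.im * (deriv U (-1) - deriv U 1) - P.k ^ 2 * (24 * ‖c‖) ≤ ‖disp hU.background P c‖ := by
  set B := hU.background with hB
  have hUr : ∀ y, B.U y = ((U (clip y) : ℝ) : ℂ) := fun y => rfl
  set w := Ab P c * prim (ee B c ^ 2 : ℝ →ᵇ ℂ) 1 with hw
  set w0 := prim (B.U ^ 2 : ℝ →ᵇ ℂ) 1 with hw0
  have hw0i : w0.im = 0 := by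
    have h1 := prim_conj (B.U ^ 2 : ℝ →ᵇ ℂ) 1
    have h2 : (fun t => conj ((B.U ^ 2 : ℝ →ᵇ ℂ) t)) = (B.U ^ 2 : ℝ →ᵇ ℂ) := by
      funext t
      simp only [BoundedContinuousFunction.coe_pow, Pi.pow_apply, hUr, map_pow, Complex.conj_ofReal]
    rw [h2] at h1
    exact Complex.conj_eq_iff_im.1 h1.symm
  have hww : ‖w - w0‖ ≤ 24 * ‖c‖ := by
    have h1 : w - w0 = primL (toL2 (Ab P c • ee B c ^ 2 - B.U ^ 2)) 1 := by
      simp only [map_sub, map_smul, BoundedContinuousFunction.coe_sub, Pi.sub_apply,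
        BoundedContinuousFunction.coe_smul, smul_eq_mul, primL_toL2_apply]
      rfl
    rw [h1]
    refine ((BoundedContinuousFunction.norm_coe_le_norm _ 1).trans (norm_primL_toL2_le _)).trans ?_
    have h2 : ‖Ab P c • ee B c ^ 2 - B.U ^ 2‖ ≤ 6 * ‖c‖ := by
      refine (BoundedContinuousFunction.norm_le (by positivity)).2 fun y => ?_
      have e : (Ab P c • ee B c ^ 2 - B.U ^ 2) y
          = c * (-(2 * B.U y) + c - (P.m : ℂ) ^ 2 * c * ee B c y ^ 2) := by
        simp only [BoundedContinuousFunction.coe_sub, Pi.sub_apply,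
          BoundedContinuousFunction.coe_smul, BoundedContinuousFunction.coe_pow, Pi.pow_apply,
          smul_eq_mul, Ab]
        rw [ee_apply]
        ring
      rw [e, norm_mul, mul_comm]
      gcongr
      have f1 : ‖B.U y‖ ≤ 1 := (BoundedContinuousFunction.norm_coe_le_norm _ y).trans hU.norm_U_le
      have f2 : ‖ee B c y‖ ≤ 3 / 2 := (hU.norm_ee_le y).trans (by linarith)
      have f3 : ‖(P.m : ℂ) ^ 2 * c * ee B c y ^ 2‖ ≤ 1 * (1 / 2) * (3 / 2) ^ 2 := by
        rw [norm_mul, norm_mul, norm_pow, norm_pow, Complex.norm_real, Real.norm_of_nonneg hm0.le]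
        have : P.m ^ 2 ≤ 1 := pow_le_one₀ hm0.le hm1
        gcongr
      have f4 : ‖2 * B.U y‖ ≤ 2 := by rw [norm_mul, Complex.norm_two]; linarith
      have g1 := norm_sub_le (-(2 * B.U y) + c) ((P.m : ℂ) ^ 2 * c * ee B c y ^ 2)
      have g2 := norm_add_le (-(2 * B.U y)) c
      rw [norm_neg] at g2
      linarith
    linarith
  have hd : disp B P c = c * ((deriv U (-1) - deriv U 1 : ℝ) : ℂ) - ((P.k ^ 2 : ℝ) : ℂ) * w := by
    have e1 : B.U1 (-1) = ((deriv U (-1) : ℝ) : ℂ) := clipped_eq hU.s1.continuous (by norm_num)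
    have e2 : B.U1 1 = ((deriv U 1 : ℝ) : ℂ) := clipped_eq hU.s1.continuous (by norm_num)
    rw [disp, e1, e2, hw]
    push_cast
    ring
  have him : (disp B P c).im = c.im * (deriv U (-1) - deriv U 1) - P.k ^ 2 * w.im := by
    rw [hd, Complex.sub_im, Complex.im_mul_ofReal, Complex.im_ofReal_mul]
  have hwi : w.im ≤ 24 * ‖c‖ := by
    have := (Complex.im_le_norm (w - w0)).trans hww
    rwa [Complex.sub_im, hw0i, sub_zero] at this
  have h1 := Complex.im_le_norm (disp B P c)
  rw [him] at h1
  have := mul_le_mul_of_nonneg_left hwi (sq_nonneg P.k)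
  linarith

theorem norm_AA_ge {P : Params} {c : ℂ} (hm0 : 0 ≤ P.m) (hm2 : P.m ^ 2 < 1) (hc2 : ‖c‖ ≤ 1 / 2)
    (hc3 : ‖c‖ ≤ (1 - P.m ^ 2) / 6) (y : ℝ) : (1 - P.m ^ 2) / 2 ≤ ‖AA hU.background P c y‖ := by
  rw [AA_apply]
  have e1 := norm_sub_norm_le (1 : ℂ) ((P.m : ℂ) ^ 2 * ee hU.background c y ^ 2)
  rw [norm_one, norm_mul, norm_pow, norm_pow, Complex.norm_real, Real.norm_of_nonneg hm0] at e1
  have e2 : ‖ee hU.background c y‖ ^ 2 ≤ (1 + ‖c‖) ^ 2 :=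
    pow_le_pow_left₀ (norm_nonneg _) (hU.norm_ee_le y) 2
  have e3 : P.m ^ 2 * ‖ee hU.background c y‖ ^ 2 ≤ P.m ^ 2 * (1 + ‖c‖) ^ 2 := by gcongr
  have hc0 := norm_nonneg c
  have e4 : P.m ^ 2 * (2 * ‖c‖ + ‖c‖ ^ 2) ≤ 1 * (2 * ‖c‖ + ‖c‖ ^ 2) := by gcongr
  have e5 : ‖c‖ ^ 2 ≤ ‖c‖ := by
    rw [sq]; exact mul_le_of_le_one_right hc0 (by linarith)
  have e6 : P.m ^ 2 * (1 + ‖c‖) ^ 2 = P.m ^ 2 + P.m ^ 2 * (2 * ‖c‖ + ‖c‖ ^ 2) := by ring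
  linarith

omit hU in
theorem norm_Ab_ge {P : Params} {c : ℂ} (hm0 : 0 ≤ P.m) (hm2 : P.m ^ 2 < 1) (hc : ‖c‖ ≤ 1 / 2) :
    1 / 2 ≤ ‖Ab P c‖ := by
  rw [Ab]
  have e1 := norm_sub_norm_le (1 : ℂ) ((P.m : ℂ) ^ 2 * c ^ 2)
  rw [norm_one, norm_mul, norm_pow, norm_pow, Complex.norm_real, Real.norm_of_nonneg hm0] at e1
  have e3 : P.m ^ 2 * ‖c‖ ^ 2 ≤ 1 * (1 / 2) ^ 2 := by gcongr
  linarith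

theorem norm_disp_ge_of_le {P : Params} {c : ℂ} {a b δ : ℝ} (hm0 : 0 < P.m) (hm1 : P.m ≤ 1)
    (hc : ‖c‖ ≤ 1 / 2) (hc' : ‖c‖ ≤ 2 * b * δ ^ 2)
    (hk0 : 0 ≤ P.k) (hk2 : P.k ≤ b * δ) (him : a * δ ^ 2 ≤ c.im)
    (hd : δ ^ 2 * (96 * b ^ 3) ≤ a * (deriv U (-1) - deriv U 1)) :
    δ ^ 2 * (a * (deriv U (-1) - deriv U 1) / 2) ≤ ‖disp hU.background P c‖ := by
  have hG0 : 0 ≤ deriv U (-1) - deriv U 1 := by linarith [hU.deriv_left, hU.deriv_right]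
  have h1 := hU.norm_disp_ge hm0 hm1 hc
  have hkk : P.k ^ 2 ≤ (b * δ) ^ 2 := pow_le_pow_left₀ hk0 hk2 2
  have h2 : P.k ^ 2 * (24 * ‖c‖) ≤ (b * δ) ^ 2 * (24 * (2 * b * δ ^ 2)) := by gcongr
  have h3 := mul_le_mul_of_nonneg_right him hG0
  have h6 := mul_le_mul_of_nonneg_left hd (sq_nonneg δ)
  have e : (b * δ) ^ 2 * (24 * (2 * b * δ ^ 2)) = δ ^ 2 * (δ ^ 2 * (96 * b ^ 3)) / 2 := by ring
  linarith

set_option maxHeartbeats 1000000 in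
-- K is a sum of nonnegative constants, so that it dominates each one required. The thresholds on δ
-- make |c| small enough for A to stay away from zero and make the k²|c| error in the dispersion
-- function at most half of its main term.
theorem exists_regime {m lam a b : ℝ} (hm0 : 0 < m) (hm1 : m < 1) (hlam : 0 ≤ lam) (ha : 0 < a)
    (hab : a < b) : ∃ K : ℝ, 1 ≤ K ∧ ∃ δ₀ : ℝ, 0 < δ₀ ∧ ∀ δ : ℝ, 0 < δ → δ < δ₀ →
      ∀ k : ℝ, a * δ ≤ k → k ≤ b * δ → ∀ c : ℂ, c.re ∈ Ioo (a * δ ^ 2) (b * δ ^ 2) →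
      c.im ∈ Ioo (a * δ ^ 2) (b * δ ^ 2) → Regime K δ hU.background ⟨m, lam, δ ^ 7, k⟩ c := by
  set B := hU.background with hB
  obtain ⟨M, hM0, hM⟩ := hU.exists_near
  set G := deriv U (-1) - deriv U 1 with hG
  have hG0 : 0 < G := by have := hU.deriv_left; have := hU.deriv_right; rw [hG]; linarith
  have hb : 0 < b := ha.trans hab
  have hm2 : m ^ 2 < 1 := pow_lt_one₀ hm0.le hm1 (by norm_num)
  have hm3 : 0 < 1 - m ^ 2 := by linarith
  set q := 2 * (1 + b / a) with hq
  have hq0 : 0 ≤ q := by positivity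
  set K1 := 1 + a⁻¹ + 3 * b + lam with hK1
  set K2 := 1 + ‖B.U1‖ + ‖B.U2‖ + ‖B.U3‖ + ‖B.L‖ + ‖B.L1‖ with hK2
  set K3 := 2 / (1 - m ^ 2) + 2 + 2 * (q + a⁻¹) + M * q + 2 / (a * G) with hK3
  have a0 : 0 < a⁻¹ := inv_pos.2 ha
  have u1 := norm_nonneg B.U1
  have u2 := norm_nonneg B.U2
  have u3 := norm_nonneg B.U3
  have u4 := norm_nonneg B.L
  have u5 := norm_nonneg B.L1
  have v1 : 0 ≤ 2 / (1 - m ^ 2) := by positivity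
  have v2 : 0 ≤ 2 * (q + a⁻¹) := by positivity
  have v3 : 0 ≤ M * q := by positivity
  have v4 : 0 ≤ 2 / (a * G) := by positivity
  set K := K1 + K2 + K3 with hK
  have k1 : 0 ≤ K1 := by positivity
  have k2 : 0 ≤ K2 := by positivity
  have k3 : 0 ≤ K3 := by positivity
  set x0 := min (1 / 2) ((1 - m ^ 2) / 6) with hx0
  have hx00 : 0 < x0 := lt_min (by norm_num) (by positivity)
  refine ⟨K, by linarith, min 1 (min (x0 / (2 * b)) (a * G / (96 * b ^ 3))), by positivity,
    fun δ hδ hδ0 k hk1 hk2 c hre him => ?_⟩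
  have d1 : δ < 1 := hδ0.trans_le (min_le_left _ _)
  have d2 : δ < x0 / (2 * b) := hδ0.trans_le ((min_le_right _ _).trans (min_le_left _ _))
  have d3 : δ < a * G / (96 * b ^ 3) := hδ0.trans_le ((min_le_right _ _).trans (min_le_right _ _))
  have hsq : δ ^ 2 ≤ δ := by nlinarith
  have hs : 0 < δ ^ 2 := by positivity
  have hk0 : 0 < k := (mul_pos ha hδ).trans_le hk1
  have hi0 : 0 < c.im := (mul_pos ha hs).trans him.1
  have hr0 : 0 < c.re := (mul_pos ha hs).trans hre.1
  have hc : ‖c‖ ≤ 2 * b * δ ^ 2 := by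
    have := Complex.norm_le_abs_re_add_abs_im c
    rw [abs_of_pos hi0, abs_of_pos hr0] at this
    linarith [hre.2, him.2]
  have hcx : ‖c‖ ≤ x0 := by
    rw [lt_div_iff₀ (by positivity)] at d2
    nlinarith
  have hc2 : ‖c‖ ≤ 1 / 2 := hcx.trans (min_le_left _ _)
  have hc3 : ‖c‖ ≤ (1 - m ^ 2) / 6 := hcx.trans (min_le_right _ _)
  have mK : ∀ {x t : ℝ}, 0 ≤ t → x ≤ K → x * t ≤ K * t := fun ht hx =>
    mul_le_mul_of_nonneg_right hx ht
  have hcn := norm_nonneg c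
  constructor
  · exact hU.background_valid
  · linarith
  · exact hδ
  · exact d1.le
  · rfl
  · refine le_trans ?_ (mK hk0.le (show a⁻¹ ≤ K by linarith))
    rw [inv_mul_eq_div, le_div_iff₀ ha]; linarith
  · exact hk2.trans (mK hδ.le (by linarith))
  · exact hc.trans (mK hs.le (by linarith))
  · refine le_trans ?_ (mK hi0.le (show a⁻¹ ≤ K by linarith))
    rw [inv_mul_eq_div, le_div_iff₀ ha]; linarith [him.1]
  · exact hm0
  · exact hm1.le
  · exact hlam
  · change lam ≤ K
    linarith
  · exact hU.norm_U_le.trans (by linarith)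
  · linarith
  · linarith
  · linarith
  · linarith
  · linarith
  · intro y
    have h1 := hU.norm_AA_ge (P := ⟨m, lam, δ ^ 7, k⟩) hm0.le hm2 hc2 hc3 y
    refine le_trans (le_of_eq ?_) ((mul_le_mul_of_nonneg_left h1 v1).trans
      (mK (norm_nonneg _) (by linarith)))
    field_simp
  · have h1 := norm_Ab_ge (P := ⟨m, lam, δ ^ 7, k⟩) hm0.le hm2 hc2
    have := mK (norm_nonneg (Ab ⟨m, lam, δ ^ 7, k⟩ c)) (show 2 ≤ K by linarith)
    linarith
  · exact (hU.l2_ei_le ha hab hδ hre.2.le him.1.le).trans (by linarith)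
  · intro y
    refine (hM y).trans ?_
    have h1 := mul_le_mul_of_nonneg_left (hU.dist_le ha hab hs hre.2.le him.1.le y) hM0
    have h2 := mK (norm_nonneg (ee B c y)) (show M * q ≤ K by linarith)
    linarith
  · have h4 : δ ^ 2 * (96 * b ^ 3) ≤ a * G := by
      rw [lt_div_iff₀ (by positivity)] at d3
      have : δ ^ 2 * (96 * b ^ 3) ≤ δ * (96 * b ^ 3) := by gcongr
      linarith
    have h5 := hU.norm_disp_ge_of_le (P := ⟨m, lam, δ ^ 7, k⟩) hm0 hm1.le hc2 hc hk0.le hk2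
      him.1.le h4
    rw [← hG, ← hB] at h5
    refine le_trans (le_of_eq ?_) ((mul_le_mul_of_nonneg_left h5 v4).trans
      (mK (norm_nonneg _) (by linarith)))
    field_simp

end IsPoiseuilleType

end

section

/-! ### The vorticity of the forcing -/

section Vorticity

variable {K δ : ℝ} {B : Background} {P : Params} {c : ℂ}

theorem Nondeg.contDiffOn_Ai (h : Nondeg B P c) : ContDiffOn ℝ ∞ (Ai B P c) (Ioo (-1) 1) := by
  have e : ⇑(Ai B P c) = fun y => (1 - (P.m : ℂ) ^ 2 * (B.U y - c) ^ 2)⁻¹ := by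
    funext y
    rw [h.Ai_apply, AA_apply, ee_apply]
  rw [e]
  refine ContDiffOn.inv (contDiffOn_const.sub (contDiffOn_const.mul
    ((h.valid.smoothU.sub contDiffOn_const).pow 2))) fun y _ => ?_
  have := h.AA_ne y
  rwa [AA_apply, ee_apply] at this

theorem Nondeg.hasDerivAt_Ai (h : Nondeg B P c) {y : ℝ} (hy : y ∈ Ioo (-1 : ℝ) 1) :
    HasDerivAt (Ai B P c) (-(dA B P c y * Ai B P c y ^ 2)) y := by
  have e : ⇑(Ai B P c) = fun y => (AA B P c y)⁻¹ := funext h.Ai_apply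
  rw [e]
  refine ((hasDerivAt_AA h.valid hy).inv (h.AA_ne y)).congr_deriv ?_
  ring

/-- `(ik)⁻¹ ∂_y (A⁻¹ a)`, where `a' = a1`. -/
def dAi (B : Background) (P : Params) (c : ℂ) (a a1 : HilbertL2) : HilbertL2 :=
  (Complex.I * P.k : ℂ)⁻¹ • (mulL2 (Ai B P c) a1 - mulL2 (dA B P c * Ai B P c ^ 2) a)

theorem coeFn_dAi (a a1 : HilbertL2) : ∀ᵐ y ∂chan, dAi B P c a a1 y
    = (Complex.I * P.k : ℂ)⁻¹ * (Ai B P c y * a1 y - dA B P c y * Ai B P c y ^ 2 * a y) := by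
  have e1 := Lp.coeFn_smul (Complex.I * P.k : ℂ)⁻¹
    (mulL2 (Ai B P c) a1 - mulL2 (dA B P c * Ai B P c ^ 2) a)
  have e2 := Lp.coeFn_sub (mulL2 (Ai B P c) a1) (mulL2 (dA B P c * Ai B P c ^ 2) a)
  have e3 := coeFn_mulL2 (Ai B P c) a1
  have e4 := coeFn_mulL2 (dA B P c * Ai B P c ^ 2) a
  filter_upwards [e1, e2, e3, e4] with y e1 e2 e3 e4
  rw [dAi, e1, Pi.smul_apply, e2, Pi.sub_apply, e3, e4]
  simp

theorem Nondeg.hasWeakDeriv_dAi (h : Nondeg B P c) {a a1 : HilbertL2} (ha : HasWeakDeriv a a1) :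
    HasWeakDeriv (fun y => (Complex.I * P.k : ℂ)⁻¹ * (Ai B P c y * a y)) (dAi B P c a a1) := by
  refine ((ha.smooth_mul h.contDiffOn_Ai fun y hy => h.hasDerivAt_Ai hy).const_mul _).congr
    (ae_eq_refl _) ?_
  filter_upwards [coeFn_dAi (B := B) (P := P) (c := c) a a1] with y hy
  rw [hy]
  ring

/-- `Ω` of the forcing as an element of `L²`. -/
def vortForcing (B : Background) (P : Params) (c : ℂ) (a a1 b : HilbertL2) : HilbertL2 :=
  dAi B P c a a1 - b

theorem Nondeg.Omega_ae_eq (h : Nondeg B P c) {U : ℝ → ℝ}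
    (hU : ∀ y ∈ Ioo (-1 : ℝ) 1, B.U y = U y) {a a1 b : HilbertL2} {fu fv : ℝ → ℂ}
    (ha : HasWeakDeriv a a1) (hfu : a =ᵐ[chan] fu) (hfv : b =ᵐ[chan] fv) :
    Omega U P.m P.k c fu fv =ᵐ[chan] vortForcing B P c a a1 b := by
  have h1 : HasWeakDeriv (fun x => (coefA U P.m c x)⁻¹ * fu x)
      (fun y => (Complex.I * P.k : ℂ) * dAi B P c a a1 y) := by
    refine ((h.hasWeakDeriv_dAi ha).const_mul (Complex.I * P.k : ℂ)).congr ?_ (ae_eq_refl _)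
    filter_upwards [hfu, ae_chan_mem] with y e1 hy
    have hk : (P.k : ℂ) ≠ 0 := by exact_mod_cast h.k_pos.ne'
    rw [mul_inv_cancel_left₀ (mul_ne_zero Complex.I_ne_zero hk), h.Ai_apply, AA_apply, ee_apply,
      hU y hy, e1, coefA]
  have hk : (P.k : ℂ) ≠ 0 := by exact_mod_cast h.k_pos.ne'
  filter_upwards [h1.weakDeriv_ae_eq, hfv, Lp.coeFn_sub (dAi B P c a a1) b] with y e1 e2 e3
  rw [Omega, e1, inv_mul_cancel_left₀ (mul_ne_zero Complex.I_ne_zero hk), vortForcing, e3,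
    Pi.sub_apply, e2]
  ring

/-- The pressure constant that matches the vorticity forcing. -/
def pressureConst (B : Background) (P : Params) (c : ℂ) (a a1 b : HilbertL2) : ℂ :=
  1 / 2 * primL ((Complex.I * P.k : ℂ)⁻¹ • mulL2 (Ai B P c) a
    + toL2 (coprimL (vortForcing B P c a a1 b)) - toL2 (primL b)) 1

/-- By definition of W, the function (ik)⁻¹A⁻¹a has weak derivative W + b, hence equals a constant
plus primitives of W and b. Taking the constant as a mean over the interval of length 2, and not as
a boundary value, makes it visibly holomorphic in c and bounded by L² norms. -/
theorem Nondeg.pressureConst_spec (h : Nondeg B P c) {a a1 : HilbertL2} (b : HilbertL2)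
    (ha : HasWeakDeriv a a1) : ∀ᵐ y ∂chan, a y = Complex.I * P.k * AA B P c y
      * (-coprimL (vortForcing B P c a a1 b) y + (pressureConst B P c a a1 b + primL b y)) := by
  set W := vortForcing B P c a a1 b with hW
  obtain ⟨α, hα⟩ := (h.hasWeakDeriv_dAi ha).ae_eq_add_prim (integrable_coe _)
  have hV : dAi B P c a a1 = W + b := by rw [hW, vortForcing, sub_add_cancel]
  have hp : ∀ y, prim (dAi B P c a a1) y = prim W y + prim b y := fun y => by
    rw [hV, ← primL_apply, map_add]; rfl
  have e1 := Lp.coeFn_sub ((Complex.I * P.k : ℂ)⁻¹ • mulL2 (Ai B P c) a + toL2 (coprimL W))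
    (toL2 (primL b))
  have e2 := Lp.coeFn_add ((Complex.I * P.k : ℂ)⁻¹ • mulL2 (Ai B P c) a) (toL2 (coprimL W))
  have e3 := Lp.coeFn_smul (Complex.I * P.k : ℂ)⁻¹ (mulL2 (Ai B P c) a)
  have e4 := coeFn_mulL2 (Ai B P c) a
  have e5 := coeFn_toL2 (coprimL W)
  have e6 := coeFn_toL2 (primL b)
  have hc : pressureConst B P c a a1 b = α + prim W 1 := by
    rw [pressureConst, ← hW, primL_apply, prim_one]
    have : ∫ t, ((Complex.I * P.k : ℂ)⁻¹ • mulL2 (Ai B P c) a + toL2 (coprimL W)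
        - toL2 (primL b) : HilbertL2) t ∂chan = ∫ _, (α + prim W 1) ∂chan := by
      refine integral_congr_ae ?_
      filter_upwards [hα, e1, e2, e3, e4, e5, e6] with y h0 h1 h2 h3 h4 h5 h6
      rw [h1, Pi.sub_apply, h2, Pi.add_apply, h3, Pi.smul_apply, h4, h5, h6, smul_eq_mul, h0, hp,
        coprimL_apply, primL_apply]
      ring
    rw [this, integral_const, Measure.real, chan_univ, Complex.real_smul]
    norm_num
    ring
  filter_upwards [hα] with y hy
  have hk : (P.k : ℂ) ≠ 0 := by exact_mod_cast h.k_pos.ne'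
  have e : -coprimL W y + (pressureConst B P c a a1 b + primL b y)
      = (Complex.I * P.k : ℂ)⁻¹ * (Ai B P c y * a y) := by
    rw [hy, hc, hp, coprimL_apply, primL_apply]
    ring
  have hA := h.AA_ne y
  have hI := Complex.I_ne_zero
  rw [e, h.Ai_apply]
  field_simp

theorem Regime.norm_inv_Ik_le (h : Regime K δ B P c) : ‖(Complex.I * P.k : ℂ)⁻¹‖ ≤ K * δ⁻¹ := by
  rw [norm_inv, norm_mul, Complex.norm_I, one_mul, Complex.norm_real,
    Real.norm_of_nonneg h.k_pos.le, ← div_eq_mul_inv, le_div_iff₀ h.δ_pos,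
    inv_mul_le_iff₀ h.k_pos, mul_comm]
  exact h.k_lo

theorem Regime.norm_pressureConst_le (h : Regime K δ B P c) (a a1 b : HilbertL2) :
    ‖pressureConst B P c a a1 b‖ ≤ K ^ 2 * (δ⁻¹ * ‖a‖) + 8 * ‖vortForcing B P c a a1 b‖
      + 4 * ‖b‖ := by
  set W := vortForcing B P c a a1 b with hW
  set x := (Complex.I * P.k : ℂ)⁻¹ • mulL2 (Ai B P c) a
  have h1 : ‖x‖ ≤ K * δ⁻¹ * (K * ‖a‖) := by
    rw [norm_smul]
    have := h.K_pos
    have := h.δ_pos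
    exact mul_le_mul h.norm_inv_Ik_le ((norm_mulL2_le _ _).trans (by
      gcongr
      exact (BoundedContinuousFunction.norm_le h.K_pos.le).2 h.norm_Ai_le)) (norm_nonneg _)
      (by positivity)
  have h2 : ‖toL2 (coprimL W)‖ ≤ 2 * (4 * ‖W‖) := by
    rw [norm_toL2]
    exact (l2_bcf_le _).trans (by gcongr; exact norm_coprimL_le W)
  have h3 : ‖toL2 (primL b)‖ ≤ 2 * (2 * ‖b‖) := by
    rw [norm_toL2]
    exact (l2_bcf_le _).trans (by gcongr; exact norm_primL_le b)
  have h4 := ((primL (x + toL2 (coprimL W) - toL2 (primL b))).norm_coe_le_norm 1).trans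
    (norm_primL_le _)
  have h5 := norm_sub_le (x + toL2 (coprimL W)) (toL2 (primL b))
  have h6 := norm_add_le x (toL2 (coprimL W))
  rw [pressureConst, norm_mul]
  have h7 : ‖(1 / 2 : ℂ)‖ = 1 / 2 := by norm_num
  rw [h7]
  linarith

theorem Nondeg.differentiableAt_vortForcing (h : Nondeg B P c) (a a1 b : HilbertL2) :
    DifferentiableAt ℂ (fun c => vortForcing B P c a a1 b) c := by
  have h1 := differentiableAt_Ai h
  have h2 := differentiableAt_dA (B := B) (P := P) (c₀ := c)
  have h3 := (differentiableAt_clm mulL2 h1).clm_apply (differentiableAt_const a1)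
  have h4 := (differentiableAt_clm mulL2 (h2.mul (h1.pow 2))).clm_apply (differentiableAt_const a)
  exact ((h3.sub h4).const_smul (Complex.I * P.k : ℂ)⁻¹).sub_const b

theorem Nondeg.differentiableAt_pressureConst (h : Nondeg B P c) (a a1 b : HilbertL2) :
    DifferentiableAt ℂ (fun c => pressureConst B P c a a1 b) c := by
  have h1 := (differentiableAt_clm mulL2 (differentiableAt_Ai h)).clm_apply
    (differentiableAt_const a)
  have h2 := differentiableAt_clm toL2 (differentiableAt_clm coprimL
    (h.differentiableAt_vortForcing a a1 b))
  have h3 := ((h1.const_smul (Complex.I * P.k : ℂ)⁻¹).add h2).sub_const (toL2 (primL b))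
  exact (differentiableAt_eval (differentiableAt_clm primL h3) 1).const_mul (1 / 2)

/-- The vorticity forcings for two wave speeds in the regime are comparable. -/
theorem exists_vortForcing_comparable (hK : 1 ≤ K) : ∃ C : ℝ, 0 ≤ C ∧
    ∀ {δ : ℝ} {B : Background} {P : Params} {c c' : ℂ}, Regime K δ B P c → Regime K δ B P c' →
    ∀ a a1 b : HilbertL2, ‖vortForcing B P c' a a1 b‖
      ≤ C * (‖vortForcing B P c a a1 b‖ + δ * (‖a‖ + ‖b‖)) := by
  -- The derivative of a is eliminated between the two forcings: the one at c' is A(c)/A(c') times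
  -- the one at c, plus terms in (c' - c)b and (ik)⁻¹(c' - c)a. As c' - c = O(δ²) and 1/k = O(1/δ),
  -- these are O(δ).
  obtain ⟨C, hC0, hC⟩ := exists_l2_bound (n := 7) (r := 3)
    (fun z x => z 2 * z 0 * x 0 - z 6 ^ 2 * (z 3 + z 4) * z 0 * x 1
      - 2 * z 6 ^ 2 * z 5 * (1 - z 6 ^ 2 * z 4 ^ 2 + z 6 ^ 2 * z 4 * (z 3 + z 4))
        * z 1 * z 0 ^ 2 * x 2) (by fun_prop) (by intros; simp; ring) (5 * K ^ 2)
  have hK2 : K ≤ K ^ 2 := by nlinarith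
  refine ⟨C * (2 * K ^ 2), by positivity, fun {δ B P c c'} h h' a a1 b => ?_⟩
  have hδ := h.δ_pos
  have hK0 := h.K_pos
  have ht : ‖c' - c‖ ≤ 2 * K * δ ^ 2 := by
    have := norm_sub_le c' c
    linarith [h.c_hi, h'.c_hi]
  have hδ2 : δ ^ 2 ≤ δ := by
    rw [sq]; exact mul_le_of_le_one_left hδ.le h.δ_le
  set W := vortForcing B P c a a1 b with hW
  have key := hC (fun y => ![Ai B P c' y, Ai B P c y, AA B P c y, ee B c y, ee B c' y, B.U1 y, P.m])
    ![W, ((c' - c) • b : HilbertL2), (((Complex.I * P.k : ℂ)⁻¹ * (c' - c)) • a : HilbertL2)]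
    (vortForcing B P c' a a1 b) ?_ ?_ ?_
  · rw [l2_coe, Fin.sum_univ_three] at key
    simp only [Matrix.cons_val_zero, Matrix.cons_val_one, Matrix.cons_val_two, Matrix.head_cons,
      Matrix.tail_cons, l2_coe, norm_smul, norm_mul] at key
    refine key.trans ?_
    have q1 : ‖c' - c‖ * ‖b‖ ≤ 2 * K ^ 2 * (δ * ‖b‖) := by
      calc _ ≤ 2 * K * δ ^ 2 * ‖b‖ := by gcongr
        _ ≤ 2 * K ^ 2 * δ * ‖b‖ := by gcongr
        _ = _ := by ring
    have q2 : ‖(Complex.I * P.k : ℂ)⁻¹‖ * ‖c' - c‖ * ‖a‖ ≤ 2 * K ^ 2 * (δ * ‖a‖) := by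
      calc _ ≤ K * δ⁻¹ * (2 * K * δ ^ 2) * ‖a‖ := by
            gcongr
            exact h.norm_inv_Ik_le
        _ = _ := by field_simp
    have q3 : ‖W‖ ≤ 2 * K ^ 2 * ‖W‖ := le_mul_of_one_le_left (norm_nonneg _) (by nlinarith)
    rw [mul_assoc C]
    refine mul_le_mul_of_nonneg_left ?_ hC0
    linarith
  · intro y i
    have k1 : 2 * K ≤ 5 * K ^ 2 := by linarith
    have k2 : 1 ≤ K ^ 2 := one_le_pow₀ hK
    fin_cases i
    · exact (h'.norm_Ai_le y).trans (by linarith)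
    · exact (h.norm_Ai_le y).trans (by linarith)
    · exact (h.norm_AA_le y).trans (by linarith)
    · exact (h.norm_ee_le y).trans k1
    · exact (h'.norm_ee_le y).trans k1
    · exact ((BoundedContinuousFunction.norm_coe_le_norm _ y).trans h.U1_le).trans (by linarith)
    · change ‖(P.m : ℂ)‖ ≤ _
      rw [Complex.norm_real, Real.norm_of_nonneg h.m_pos.le]
      linarith [h.m_le]
  · intro i
    fin_cases i <;> exact memL2_coe _
  · filter_upwards [coeFn_dAi (B := B) (P := P) (c := c) a a1,
      coeFn_dAi (B := B) (P := P) (c := c') a a1, Lp.coeFn_sub (dAi B P c a a1) b,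
      Lp.coeFn_sub (dAi B P c' a a1) b, Lp.coeFn_smul (c' - c) b,
      Lp.coeFn_smul ((Complex.I * P.k : ℂ)⁻¹ * (c' - c)) a] with y e1 e2 e3 e4 e5 e6
    rw [Pi.sub_apply, e1] at e3
    rw [Pi.sub_apply, e2] at e4
    rw [vortForcing, e4]
    simp only [Matrix.cons_val_zero, Matrix.cons_val_one, Matrix.cons_val]
    rw [hW, vortForcing, e3, e5, e6, Pi.smul_apply, Pi.smul_apply, smul_eq_mul, smul_eq_mul,
      h.nondeg.Ai_apply, h'.nondeg.Ai_apply]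
    have hA := h.nondeg.AA_ne y
    have hA' := h'.nondeg.AA_ne y
    have hcc : c' - c = ee B c y - ee B c' y := by rw [ee_apply, ee_apply]; ring
    rw [hcc, dA_apply, dA_apply]
    rw [AA_apply] at hA hA' ⊢
    rw [AA_apply]
    have hk : (P.k : ℂ) ≠ 0 := by exact_mod_cast h.k_pos.ne'
    have hI := Complex.I_ne_zero
    field_simp
    ring

end Vorticity

end

/-! ### One solution satisfying both estimates. -/

section

variable {K : ℝ}

theorem MemH1.memL2_weakDeriv {f : ℝ → ℂ} (hf : MemH1 f) : MemL2 (weakDeriv f) := by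
  obtain ⟨-, g, hg, h⟩ := hf
  exact hg.congr h.weakDeriv_ae_eq.symm

theorem MemH1.hasWeakDeriv {f : ℝ → ℂ} (hf : MemH1 f) : HasWeakDeriv f (weakDeriv f) := by
  obtain ⟨-, g, -, h⟩ := hf
  exact h.of_ae_eq_weakDeriv

theorem l2_weakDeriv_le_divk {fu fv : ℝ → ℂ} (hu : MemL2 fu) (hv : MemH1 fv) {k : ℝ}
    (hk : 0 ≤ k) : l2 (weakDeriv fv) ≤ l2 (divk k fu fv) + k * l2 fu := by
  have m1 : MemL2 (fun y => Complex.I * k * fu y) := MemLp.const_mul hu (Complex.I * k)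
  have m2 : MemL2 (divk k fu fv) := MemLp.add m1 hv.memL2_weakDeriv
  have m3 : MemL2 (fun y => -(Complex.I * k) * fu y) := MemLp.const_mul hu (-(Complex.I * k))
  have h1 := l2_add_le m2 m3
  have h2 : (fun y => divk k fu fv y + -(Complex.I * k) * fu y) = weakDeriv fv := by
    funext y
    simp only [divk]
    ring
  rw [h2] at h1
  have h3 : l2 (fun y => -(Complex.I * k) * fu y) ≤ k * l2 fu :=
    l2_le_mul hk hu (.of_forall fun y => by
      rw [norm_mul, norm_neg, norm_mul, Complex.norm_I, one_mul, Complex.norm_real,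
        Real.norm_of_nonneg hk])
  linarith

/-- The quantity that controls the solution for forcings in `H¹`. -/
def vortSize (U : ℝ → ℝ) (m k δ : ℝ) (c : ℂ) (fu fv : ℝ → ℂ) : ℝ :=
  l2 (Omega U m k c fu fv) + δ * (l2 fu + l2 fv) + δ ^ 2 * l2 (divk k fu fv)

theorem hasWeakDeriv_zero : HasWeakDeriv (0 : HilbertL2) (0 : HilbertL2) := by
  refine (hasWeakDeriv_prim (integrable_coe (0 : HilbertL2)) 0).congr ?_ (ae_eq_refl _)
  filter_upwards [Lp.coeFn_zero ℂ 2 chan] with y hy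
  rw [hy, ← primL_apply, map_zero]
  simp

/-- The forcing is fed in either through its vorticity or as a generic L² forcing, whichever bound
is the smaller one up to constants. The bound N is shared by all norms of the solution, so both
estimates reduce to inequalities for N. -/
theorem exists_solution (hK : 1 ≤ K) : ∃ δ₀ : ℝ, 0 < δ₀ ∧ ∃ C : ℝ, 0 ≤ C ∧
    ∀ {δ : ℝ} {B : Background} {P : Params} {R : Set ℂ}, δ < δ₀ → IsOpen R →
    (∀ c ∈ R, Regime K δ B P c) → ∀ {U : ℝ → ℝ}, (∀ y ∈ Ioo (-1 : ℝ) 1, B.U y = U y) →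
    (∀ y ∈ Ioo (-1 : ℝ) 1, B.U1 y = (deriv U y : ℝ)) →
    (∀ y ∈ Ioo (-1 : ℝ) 1, B.U2 y = (deriv (deriv U) y : ℝ)) →
    ∀ {fu fv : ℝ → ℂ}, MemL2 fu → MemL2 fv → ∃ ρ u v : ℂ → ℝ → ℂ,
      (∀ c ∈ R, IsRemainderSolution U P.m P.lam P.ε P.k c fu fv (ρ c) (u c) (v c) ∧
        ∃ N : ℝ, SolBound δ (ρ c) (u c) (v c) N ∧ δ ^ 5 * N ≤ C * (l2 fu + l2 fv) ∧
          (MemH1 fu → MemH1 fv → δ ^ 2 * N ≤ C * vortSize U P.m P.k δ c fu fv)) ∧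
      ∀ y, DifferentiableOn ℂ (fun c => u c y) R := by
  obtain ⟨δ₀, hδ₀, C, hC, hsol⟩ := exists_solution_family hK
  obtain ⟨C', hC', hcomp⟩ := exists_vortForcing_comparable hK
  have hK0 : 0 ≤ K := by linarith
  refine ⟨δ₀, hδ₀, C * (K ^ 2 + K + 14) + C * (C' + 1), by positivity,
    fun {δ B P R} hδ hR hreg {U} hU hU1 hU2 {fu fv} hfu hfv => ?_⟩
  have n1 := l2_nonneg fu
  have n2 := l2_nonneg fv
  have hWl : ∀ c ∈ R, ∀ (h1 : MemH1 fu), l2 (Omega U P.m P.k c fu fv)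
      = ‖vortForcing B P c (MemLp.toLp fu hfu) (MemLp.toLp _ h1.memL2_weakDeriv)
        (MemLp.toLp fv hfv)‖ := fun c hc h1 => by
    rw [← l2_coe, l2_congr ((hreg c hc).nondeg.Omega_ae_eq hU (h1.hasWeakDeriv.congr
      (MemLp.coeFn_toLp hfu).symm (MemLp.coeFn_toLp h1.memL2_weakDeriv).symm)
      (MemLp.coeFn_toLp hfu) (MemLp.coeFn_toLp hfv))]
  -- The alternative is quantified over all c in R, so that a single representation, holomorphic in
  -- c, serves the whole regime.
  by_cases H : MemH1 fu ∧ MemH1 fv ∧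
      ∀ c ∈ R, δ ^ 3 * vortSize U P.m P.k δ c fu fv ≤ l2 fu + l2 fv
  · obtain ⟨h1, h2, H⟩ := H
    set a : HilbertL2 := MemLp.toLp fu hfu
    set a1 : HilbertL2 := MemLp.toLp _ h1.memL2_weakDeriv
    set b : HilbertL2 := MemLp.toLp fv hfv
    set b1 : HilbertL2 := MemLp.toLp _ h2.memL2_weakDeriv
    have ea : a =ᵐ[chan] fu := MemLp.coeFn_toLp hfu
    have eb : b =ᵐ[chan] fv := MemLp.coeFn_toLp hfv
    have wa : HasWeakDeriv a a1 := h1.hasWeakDeriv.congr ea.symm (MemLp.coeFn_toLp _).symm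
    have wb : HasWeakDeriv b b1 := h2.hasWeakDeriv.congr eb.symm (MemLp.coeFn_toLp _).symm
    have e0 := Lp.coeFn_zero ℂ 2 chan
    obtain ⟨ρ, u, v, hs, hd⟩ := hsol hδ hR hreg hU hU1 hU2
      ⟨0, 0, fun c => vortForcing B P c a a1 b, fun c => pressureConst B P c a a1 b, b, b1⟩
      (fun c hc => ((hreg c hc).nondeg.differentiableAt_vortForcing a a1 b).differentiableWithinAt)
      (fun c hc => ((hreg c hc).nondeg.differentiableAt_pressureConst a a1
        b).differentiableWithinAt) wb (fu := fu) (fv := fv)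
      (fun c hc => by
        filter_upwards [ea, e0, (hreg c hc).nondeg.pressureConst_spec b wa] with y e1 e2 e3
        rw [← e1, e3]
        rw [e2, Pi.zero_apply, add_zero])
      (by
        filter_upwards [eb, e0] with y e1 e2
        rw [e2, Pi.zero_apply, add_zero, e1])
    refine ⟨ρ, u, v, fun c hc => ⟨(hs c hc).1, _, (hs c hc).2, ?_⟩, hd⟩
    have h := hreg c hc
    have hδ0 := h.δ_pos
    have key : δ ^ 2 * (C * ((δ ^ 5)⁻¹ * (‖(0 : HilbertL2)‖ + ‖(0 : HilbertL2)‖)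
        + (δ ^ 2)⁻¹ * ‖vortForcing B P c a a1 b‖ + (‖pressureConst B P c a a1 b‖ + ‖b‖)
        + δ ^ 2 * ‖b1‖)) ≤ C * (K ^ 2 + K + 14) * vortSize U P.m P.k δ c fu fv := by
      have p1 := h.norm_pressureConst_le a a1 b
      have p2 := l2_weakDeriv_le_divk hfu h2 h.k_pos.le
      have p3 : P.k * l2 fu ≤ K * δ * l2 fu := mul_le_mul_of_nonneg_right h.k_hi n1
      have na : ‖a‖ = l2 fu := MemL2.norm_toLp hfu
      have nb : ‖b‖ = l2 fv := MemL2.norm_toLp hfv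
      have nb1 : ‖b1‖ = l2 (weakDeriv fv) := MemL2.norm_toLp h2.memL2_weakDeriv
      have hw := hWl c hc h1
      have n3 := l2_nonneg (Omega U P.m P.k c fu fv)
      have n4 := l2_nonneg (divk P.k fu fv)
      set w := l2 (Omega U P.m P.k c fu fv) with hw'
      rw [vortSize, norm_zero, ← hw', nb, nb1, ← hw, mul_assoc, mul_left_comm]
      rw [na, nb, ← hw] at p1
      refine mul_le_mul_of_nonneg_left ?_ hC
      have q1 : δ ^ 2 * (K ^ 2 * (δ⁻¹ * l2 fu)) = K ^ 2 * (δ * l2 fu) := by field_simp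
      have q2 : δ ^ 2 * ((δ ^ 2)⁻¹ * w) = w := by field_simp
      have q3 := mul_le_mul_of_nonneg_left p1 (sq_nonneg δ)
      have q4 := mul_le_mul_of_nonneg_left (p2.trans (add_le_add_right p3 _))
        (by positivity : 0 ≤ δ ^ 4)
      have s2 : δ ^ 2 * w ≤ w := mul_le_of_le_one_left n3 (h.pow_le_one 2)
      have s3 : δ ^ 2 * l2 fv ≤ δ * l2 fv := by
        have := mul_le_mul_of_nonneg_right h.δ_le (mul_nonneg hδ0.le n2)
        linarith
      have s4 : δ ^ 4 * l2 (divk P.k fu fv) ≤ δ ^ 2 * l2 (divk P.k fu fv) := by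
        have := mul_le_mul_of_nonneg_right (h.pow_le_one 2) (mul_nonneg (sq_nonneg δ) n4)
        linarith
      have s5 : δ ^ 4 * (K * δ * l2 fu) ≤ K * (δ * l2 fu) := by
        have := mul_le_mul_of_nonneg_right (h.pow_le_one 4)
          (mul_nonneg hK0 (mul_nonneg hδ0.le n1))
        linarith
      have t1 : 0 ≤ δ * l2 fu := by positivity
      have t2 : 0 ≤ δ * l2 fv := by positivity
      have t3 : 0 ≤ δ ^ 2 * l2 (divk P.k fu fv) := by positivity
      have r1 : 0 ≤ (K ^ 2 + K) * w := by positivity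
      have r2 : 0 ≤ (K ^ 2 + K) * (δ * l2 fv) := by positivity
      have r3 : 0 ≤ (K ^ 2 + K) * (δ ^ 2 * l2 (divk P.k fu fv)) := by positivity
      linarith
    have hv0 : 0 ≤ vortSize U P.m P.k δ c fu fv := by
      have := l2_nonneg (Omega U P.m P.k c fu fv)
      have := l2_nonneg (divk P.k fu fv)
      rw [vortSize]; positivity
    have g1 : 0 ≤ C * (C' + 1) * (l2 fu + l2 fv) := by positivity
    have g2 : 0 ≤ C * (C' + 1) * vortSize U P.m P.k δ c fu fv := by positivity
    refine ⟨?_, fun _ _ => key.trans (by linarith)⟩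
    -- In this case the vorticity estimate implies the general one: δ⁵N = δ³·δ²N is at most a
    -- constant times δ³ `vortSize`, which the case assumption bounds by ‖fu‖ + ‖fv‖.
    have k1 := mul_le_mul_of_nonneg_left key (pow_pos hδ0 3).le
    have k2 := mul_le_mul_of_nonneg_left (H c hc) (show 0 ≤ C * (K ^ 2 + K + 14) by positivity)
    refine le_trans (le_of_eq ?_) (k1.trans (le_trans (le_of_eq ?_) (k2.trans (by linarith))))
    · ring
    · ring
  · set a : HilbertL2 := MemLp.toLp fu hfu
    set b : HilbertL2 := MemLp.toLp fv hfv
    have ea : a =ᵐ[chan] fu := MemLp.coeFn_toLp hfu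
    have eb : b =ᵐ[chan] fv := MemLp.coeFn_toLp hfv
    have na : ‖a‖ = l2 fu := MemL2.norm_toLp hfu
    have nb : ‖b‖ = l2 fv := MemL2.norm_toLp hfv
    obtain ⟨ρ, u, v, hs, hd⟩ := hsol hδ hR hreg hU hU1 hU2
      ⟨a, b, fun _ => 0, fun _ => 0, 0, 0⟩ (differentiableOn_const _) (differentiableOn_const _)
      hasWeakDeriv_zero (fu := fu) (fv := fv)
      (fun c hc => by
        filter_upwards [ea] with y e1
        rw [map_zero, map_zero, e1]
        simp)
      (by
        filter_upwards [eb, Lp.coeFn_zero ℂ 2 chan] with y e1 e2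
        rw [e2, Pi.zero_apply, zero_add, e1])
    refine ⟨ρ, u, v, fun c hc => ⟨(hs c hc).1, _, (hs c hc).2, ?_⟩, hd⟩
    have h := hreg c hc
    have hδ0 := h.δ_pos
    simp only [norm_zero, mul_zero, add_zero]
    rw [na, nb]
    have g1 : 0 ≤ C * (K ^ 2 + K + 13 + C' + 1) * (l2 fu + l2 fv) := by positivity
    refine ⟨?_, fun h1 h2 => ?_⟩
    · have e : δ ^ 5 * (C * ((δ ^ 5)⁻¹ * (l2 fu + l2 fv))) = C * (l2 fu + l2 fv) := by field_simp
      rw [e]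
      linarith
    -- The vorticity bound fails to be the smaller one at some speed c'. Since the quantities at c
    -- and c' are comparable, ‖fu‖ + ‖fv‖ is bounded by a multiple of δ³ `vortSize` at c, and the
    -- general estimate implies the vorticity estimate there.
    · push Not at H
      obtain ⟨c', hc', H⟩ := H h1 h2
      have hq := hcomp h (hreg c' hc') a (MemLp.toLp _ h1.memL2_weakDeriv) b
      rw [← hWl c hc h1, ← hWl c' hc' h1, na, nb] at hq
      have e : δ ^ 2 * (C * ((δ ^ 5)⁻¹ * (l2 fu + l2 fv))) = C * ((l2 fu + l2 fv) / δ ^ 3) := by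
        field_simp
      have n3 := l2_nonneg (Omega U P.m P.k c fu fv)
      have n4 := l2_nonneg (divk P.k fu fv)
      have hv : vortSize U P.m P.k δ c' fu fv ≤ (C' + 1) * vortSize U P.m P.k δ c fu fv := by
        have : 0 ≤ C' * (δ ^ 2 * l2 (divk P.k fu fv)) := by positivity
        rw [vortSize, vortSize]
        linarith
      have hv0 : 0 ≤ vortSize U P.m P.k δ c fu fv := by rw [vortSize]; positivity
      have g2 : 0 ≤ C * (K ^ 2 + K + 14) * vortSize U P.m P.k δ c fu fv := by positivity
      have hF : (l2 fu + l2 fv) / δ ^ 3 ≤ (C' + 1) * vortSize U P.m P.k δ c fu fv :=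
        ((div_le_iff₀' (pow_pos hδ0 3)).2 H.le).trans hv
      rw [e]
      refine (mul_le_mul_of_nonneg_left hF hC).trans ?_
      linarith

end

/-! ### Weighted norms and conclusion. -/

section

theorem l2pair_le (f g : ℝ → ℂ) : l2pair f g ≤ l2 f + l2 g := by
  have h1 := l2_nonneg f
  have h2 := l2_nonneg g
  refine Real.sqrt_le_iff.2 ⟨by positivity, ?_⟩
  have : 0 ≤ l2 f * l2 g := by positivity
  linarith [add_sq (l2 f) (l2 g)]

theorem l2triple_le (f g h : ℝ → ℂ) : l2triple f g h ≤ l2 f + l2 g + l2 h := by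
  have h1 := l2_nonneg f
  have h2 := l2_nonneg g
  have h3 := l2_nonneg h
  refine Real.sqrt_le_iff.2 ⟨by positivity, ?_⟩
  have : 0 ≤ l2 f * l2 g := by positivity
  have : 0 ≤ (l2 f + l2 g) * l2 h := by positivity
  linarith [add_sq (l2 f) (l2 g), add_sq (l2 f + l2 g) (l2 h)]

theorem add_le_l2pair (f g : ℝ → ℂ) : l2 f + l2 g ≤ 2 * l2pair f g := by
  have h1 : l2 f ≤ l2pair f g := Real.le_sqrt_of_sq_le (by linarith [sq_nonneg (l2 g)])
  have h2 : l2 g ≤ l2pair f g := Real.le_sqrt_of_sq_le (by linarith [sq_nonneg (l2 f)])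
  linarith

/-- The factor 8 counts the norms on the left, 3 + 3 + 2, each bounded by N/m² after weighting. The
second weight is left free because δ⁹ ≤ δ⁵·δ² in the first estimate, whereas δ⁴ = δ²·δ² in the
second. -/
theorem SolBound.weighted {δ N m w : ℝ} {ρ u v : ℝ → ℂ} (h : SolBound δ ρ u v N) (hρ : MemH1 ρ)
    (hm0 : 0 < m) (hm1 : m ≤ 1) (hw : 0 ≤ w) {w' : ℝ} (hw' : w' ≤ w * δ ^ 2) :
    w * l2triple (fun y => (m : ℂ)⁻¹ * ρ y) u v
      + w * l2triple (fun y => ((m : ℂ) ^ 2)⁻¹ * weakDeriv ρ y) (weakDeriv u) (weakDeriv v)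
      + w' * l2pair (weakDeriv (weakDeriv u)) (weakDeriv (weakDeriv v))
      ≤ 8 * (m ^ 2)⁻¹ * (w * N) := by
  have hN : 0 ≤ N := (l2_nonneg _).trans h.ρ_le
  have hm2 : 1 ≤ (m ^ 2)⁻¹ := (one_le_inv₀ (pow_pos hm0 2)).2 (pow_le_one₀ hm0.le hm1)
  have hm3 : m⁻¹ ≤ (m ^ 2)⁻¹ := inv_anti₀ (pow_pos hm0 2) (by
    rw [sq]; exact mul_le_of_le_one_left hm0.le hm1)
  have p1 : l2 (fun y => (m : ℂ)⁻¹ * ρ y) ≤ (m ^ 2)⁻¹ * N := by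
    refine (l2_le_mul (inv_nonneg.2 hm0.le) hρ.1 (.of_forall fun y => ?_)).trans
      (mul_le_mul hm3 h.ρ_le (l2_nonneg _) (by positivity))
    rw [norm_mul, norm_inv, Complex.norm_real, Real.norm_of_nonneg hm0.le]
  have p2 : l2 (fun y => ((m : ℂ) ^ 2)⁻¹ * weakDeriv ρ y) ≤ (m ^ 2)⁻¹ * N := by
    refine (l2_le_mul (by positivity) hρ.memL2_weakDeriv (.of_forall fun y => ?_)).trans
      (mul_le_mul_of_nonneg_left h.dρ_le (by positivity))
    rw [norm_mul, norm_inv, norm_pow, Complex.norm_real, Real.norm_of_nonneg hm0.le]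
  have hMN : N ≤ (m ^ 2)⁻¹ * N := le_mul_of_one_le_left hN hm2
  set M := (m ^ 2)⁻¹
  have t1 : l2triple (fun y => (m : ℂ)⁻¹ * ρ y) u v ≤ 3 * (M * N) := by
    have := l2triple_le (fun y => (m : ℂ)⁻¹ * ρ y) u v
    linarith [h.u_le, h.v_le]
  have t2 : l2triple (fun y => ((m : ℂ) ^ 2)⁻¹ * weakDeriv ρ y) (weakDeriv u) (weakDeriv v)
      ≤ 3 * (M * N) := by
    have := l2triple_le (fun y => ((m : ℂ) ^ 2)⁻¹ * weakDeriv ρ y) (weakDeriv u) (weakDeriv v)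
    linarith [h.du_le, h.dv_le]
  have t3 : w' * l2pair (weakDeriv (weakDeriv u)) (weakDeriv (weakDeriv v)) ≤ w * (2 * (M * N)) := by
    refine (mul_le_mul_of_nonneg_right hw' (Real.sqrt_nonneg _)).trans ?_
    rw [mul_assoc]
    refine mul_le_mul_of_nonneg_left ?_ hw
    change δ ^ 2 * l2pair (weakDeriv (weakDeriv u)) (weakDeriv (weakDeriv v)) ≤ _
    have := mul_le_mul_of_nonneg_left (l2pair_le (weakDeriv (weakDeriv u))
      (weakDeriv (weakDeriv v))) (sq_nonneg δ)
    linarith [h.ddu_le, h.ddv_le]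
  have s1 := mul_le_mul_of_nonneg_left t1 hw
  have s2 := mul_le_mul_of_nonneg_left t2 hw
  linarith

theorem rpow_div_seven {ε : ℝ} (hε : 0 ≤ ε) (n : ℕ) :
    ε ^ ((n : ℝ) / 7) = (ε ^ (1 / 7 : ℝ)) ^ n := by
  rw [← Real.rpow_natCast, ← Real.rpow_mul hε]
  congr 1
  ring

theorem isOpen_speedRegime (a b ε : ℝ) : IsOpen (speedRegime a b ε) :=
  (isOpen_Ioo.preimage Complex.continuous_re).inter (isOpen_Ioo.preimage Complex.continuous_im)

end

end PoiseuilleCNS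

end

open PoiseuilleCNS

theorem proposition3p1 (U : ℝ → ℝ) (hU : PoiseuilleCNS.IsPoiseuilleType U)
    (m : ℝ) (hm0 : 0 < m) (hm1 : m < 1 / Real.sqrt 3) (lam : ℝ) (hlam : 0 ≤ lam)
    (a b : ℝ) (ha : 0 < a) (hab : a < b) :
    ∃ ε₀ > 0, ∃ C > 0, ∀ ε : ℝ, 0 < ε → ε < ε₀ →
      ∀ k : ℝ, a * ε ^ (1 / 7 : ℝ) ≤ k → k ≤ b * ε ^ (1 / 7 : ℝ) →
      ∀ fu fv : ℝ → ℂ, PoiseuilleCNS.MemL2 fu → PoiseuilleCNS.MemL2 fv →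
      ∃ ρ u v : ℂ → ℝ → ℂ,
        (∀ c ∈ PoiseuilleCNS.speedRegime a b ε,
          PoiseuilleCNS.IsRemainderSolution U m lam ε k c fu fv (ρ c) (u c) (v c) ∧
          ε ^ (5 / 7 : ℝ) * PoiseuilleCNS.l2triple (fun y => (m : ℂ)⁻¹ * ρ c y) (u c) (v c)
            + ε ^ (5 / 7 : ℝ) * PoiseuilleCNS.l2triple
                (fun y => ((m : ℂ) ^ 2)⁻¹ * PoiseuilleCNS.weakDeriv (ρ c) y)
                (PoiseuilleCNS.weakDeriv (u c)) (PoiseuilleCNS.weakDeriv (v c))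
            + ε ^ (9 / 7 : ℝ) * PoiseuilleCNS.l2pair
                (PoiseuilleCNS.weakDeriv (PoiseuilleCNS.weakDeriv (u c)))
                (PoiseuilleCNS.weakDeriv (PoiseuilleCNS.weakDeriv (v c)))
            ≤ C * PoiseuilleCNS.l2pair fu fv ∧
          (PoiseuilleCNS.MemH1 fu → PoiseuilleCNS.MemH1 fv →
            ε ^ (2 / 7 : ℝ) * PoiseuilleCNS.l2triple (fun y => (m : ℂ)⁻¹ * ρ c y) (u c) (v c)
              + ε ^ (2 / 7 : ℝ) * PoiseuilleCNS.l2triple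
                  (fun y => ((m : ℂ) ^ 2)⁻¹ * PoiseuilleCNS.weakDeriv (ρ c) y)
                  (PoiseuilleCNS.weakDeriv (u c)) (PoiseuilleCNS.weakDeriv (v c))
              + ε ^ (4 / 7 : ℝ) * PoiseuilleCNS.l2pair
                  (PoiseuilleCNS.weakDeriv (PoiseuilleCNS.weakDeriv (u c)))
                  (PoiseuilleCNS.weakDeriv (PoiseuilleCNS.weakDeriv (v c)))
              ≤ C * PoiseuilleCNS.l2 (PoiseuilleCNS.Omega U m k c fu fv)
                + C * ε ^ (1 / 7 : ℝ) * PoiseuilleCNS.l2pair fu fv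
                + C * ε ^ (2 / 7 : ℝ) * PoiseuilleCNS.l2 (PoiseuilleCNS.divk k fu fv))) ∧
        AnalyticOnNhd ℂ (fun c => u c 1) (PoiseuilleCNS.speedRegime a b ε) ∧
        AnalyticOnNhd ℂ (fun c => u c (-1)) (PoiseuilleCNS.speedRegime a b ε) := by
  have hm : m < 1 := hm1.trans_le (by
    rw [div_le_one (by positivity)]
    exact Real.one_le_sqrt.2 (by norm_num))
  obtain ⟨K, hK, δ₁, hδ₁, hreg⟩ := hU.exists_regime hm0 hm hlam ha hab
  obtain ⟨δ₂, hδ₂, C, hC, hsol⟩ := exists_solution hK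
  -- The seventh power turns thresholds on δ = ε^(1/7) into one on ε. The constant 16 is the 8 of
  -- `SolBound.weighted` times the 2 lost in passing from a sum of two norms to the Euclidean norm
  -- of the pair; C + 1 ensures positivity.
  refine ⟨(min 1 (min δ₁ δ₂)) ^ 7, by positivity, 16 * (m ^ 2)⁻¹ * (C + 1), by positivity,
    fun ε hε hε0 k hk1 hk2 fu fv hfu hfv => ?_⟩
  set δ := ε ^ (1 / 7 : ℝ) with hδdef
  have hδ : 0 < δ := Real.rpow_pos_of_pos hε _
  have hεδ : δ ^ 7 = ε := by
    rw [← rpow_div_seven hε.le 7]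
    norm_num
  have e2 : ε ^ (2 / 7 : ℝ) = δ ^ 2 := by exact_mod_cast rpow_div_seven hε.le 2
  have e4 : ε ^ (4 / 7 : ℝ) = δ ^ 4 := by exact_mod_cast rpow_div_seven hε.le 4
  have e5 : ε ^ (5 / 7 : ℝ) = δ ^ 5 := by exact_mod_cast rpow_div_seven hε.le 5
  have e9 : ε ^ (9 / 7 : ℝ) = δ ^ 9 := by exact_mod_cast rpow_div_seven hε.le 9
  have hδ0 : δ < min 1 (min δ₁ δ₂) := by
    rw [← hεδ] at hε0
    exact lt_of_pow_lt_pow_left₀ 7 (by positivity) hε0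
  have d1 : δ < 1 := hδ0.trans_le (min_le_left _ _)
  have d2 : δ < δ₁ := hδ0.trans_le ((min_le_right _ _).trans (min_le_left _ _))
  have d3 : δ < δ₂ := hδ0.trans_le ((min_le_right _ _).trans (min_le_right _ _))
  obtain ⟨ρ, u, v, hs, hd⟩ := hsol (P := ⟨m, lam, δ ^ 7, k⟩) d3 (isOpen_speedRegime a b ε)
    (fun c hc => by
      rw [speedRegime, mem_ofPred_eq, e2] at hc
      exact hreg δ hδ d2 k hk1 hk2 c hc.1 hc.2)
    (fun y hy => clipped_eq hU.smooth.continuous (Ioo_subset_Icc_self hy))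
    (fun y hy => clipped_eq hU.s1.continuous (Ioo_subset_Icc_self hy))
    (fun y hy => clipped_eq hU.s2.continuous (Ioo_subset_Icc_self hy)) hfu hfv
  refine ⟨ρ, u, v, fun c hc => ?_, (hd 1).analyticOnNhd (isOpen_speedRegime a b ε),
    (hd (-1)).analyticOnNhd (isOpen_speedRegime a b ε)⟩
  obtain ⟨h1, N, h2, h3, h4⟩ := hs c hc
  rw [e2, e4, e5, e9]
  have hM : 0 ≤ (m ^ 2)⁻¹ := by positivity
  have hp := add_le_l2pair fu fv
  have hp0 : 0 ≤ l2pair fu fv := Real.sqrt_nonneg _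
  have hMp : 0 ≤ (m ^ 2)⁻¹ * l2pair fu fv := by positivity
  refine ⟨by rw [← hεδ]; exact h1, ?_, fun hf1 hf2 => ?_⟩
  · refine (h2.weighted h1.memH1_ρ hm0 hm.le (by positivity) (by
      rw [← pow_add]; exact pow_le_pow_of_le_one hδ.le d1.le (by norm_num))).trans ?_
    have q1 := mul_le_mul_of_nonneg_left (h3.trans (mul_le_mul_of_nonneg_left hp hC)) hM
    linarith
  · refine (h2.weighted h1.memH1_ρ hm0 hm.le (by positivity) (by
      rw [← pow_add])).trans ?_
    have n1 := l2_nonneg (Omega U m k c fu fv)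
    have n2 := l2_nonneg (divk k fu fv)
    have q0 : vortSize U m k δ c fu fv ≤ 2 * (l2 (Omega U m k c fu fv) + δ * l2pair fu fv
        + δ ^ 2 * l2 (divk k fu fv)) := by
      have s1 := mul_le_mul_of_nonneg_left hp hδ.le
      have s2 : 0 ≤ δ ^ 2 * l2 (divk k fu fv) := by positivity
      rw [vortSize]
      linarith
    have q1 := mul_le_mul_of_nonneg_left ((h4 hf1 hf2).trans (mul_le_mul_of_nonneg_left q0 hC)) hM
    have q2 : 0 ≤ (m ^ 2)⁻¹ * (l2 (Omega U m k c fu fv) + δ * l2pair fu fv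
        + δ ^ 2 * l2 (divk k fu fv)) := by positivity
    linarith
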